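/- **Setting.** A 2-pro is a strict monoidal category whose monoid of objects is $(\mathbb N,+)$, seen as a 2-category with one 0-cell: $\star_0$ is the product, $\star_1$ is composition in diagrammatic order. A track 3-prop is a strict 3-category with one 0-cell, with $(\mathbb N,+)$ as its monoid of 1-cells, whose 3-cells are invertible for $\star_2$, equipped with a symmetry $\tau:2\Rightarrow 2$ satisfying $\tau\star_1\tau=\mathrm{id}_2$, the Yang–Baxter relation, and naturality with respect to all 2-cells and 3-cells. Let $\mathbf{BrCat}$ be the track 3-prop presented by the 2-cells $\mu:2\Rightarrow 1$, $\eta:0\Rightarrow 1$, the 3-cells $$\alpha:(\mu\star_0 1)\star_1\mu\Rrightarrow(1\star_0\mu)\star_1\mu,\quad \lambda:(\eta\star_0 1)\star_1\mu\Rrightarrow 1,\quad \rho:(1\star_0\eta)\star_1\mu\Rrightarrow 1,\quad \beta:\tau\star_1\mu\Rrightarrow\mu,$$ and the relations given by the pentagon and the unit triangle for $\alpha,\lambda,\rho$ and by the two hexagons $$((1\star_0\tau)\star_1(\beta\star_0 1)\star_1\mu)\star_2((1\star_0\tau)\star_1\alpha)\star_2((1\star_0\beta)\star_1\mu)=((1\star_0\tau)\star_1(\tau\star_0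 1)\star_1\alpha)\star_2((\mu\star_0 1)\star_1\beta)\star_2\alpha,$$ $$((\beta\star_0 1)\star_1\mu)^-\star_2((\tau\star_0 1)\star_1\alpha)\star_2((\tau\star_0 1)\star_1(1\star_0\beta)\star_1\mu)^-=\alpha\star_2((1\star_0\mu)\star_1\beta)^-\star_2((\tau\star_0 1)\star_1(1\star_0\tau)\star_1\alpha).$$ Let $\mathbf P=\mathbf{BrCat}/\mathbf{MonCat}$ be its quotient obtained by making every 3-cell generated by $\alpha,\lambda,\rho$ an identity (so that its source and target are identified). The underlying category $\mathcal B(1)$ of the initial $\mathbf P$-algebra $\mathcal B$ is defined as follows. Its objects are the classes of the 2-cells $f:n\Rightarrow 1$ of $\mathbf P$ modulo $f\approx\sigma\star_1 f$, for $\sigma:n\Rightarrow n$ a permutation (a 2-cell written with $\tau$ only). Its morphisms from the class of $f$ to the class of $g$ are the classes of the 3-cells $A:f\Rrightarrow g:n\Rightarrow 1$ of $\mathbf P$ modulo the congruence generated by $A\approx\sigma\star_1 A$ for permutations $\sigma$. Composition is induced by $\star_2$, after applying permutations to make representatives composable. It is a strict monoidal category for the product $x\otimes y=(x\star_0 y)\star_1\mu$,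 on objects and on morphisms, with unit the class of $\eta$. Let $\mathbf{Brd}$ be the 2-pro of braids, presented by two 2-cells $b_+,b_-:2\Rightarrow 2$ (the positive and the negative crossing) and the relations $b_+\star_1 b_-=\mathrm{id}_2=b_-\star_1 b_+$ and $(b_+\star_0 1)\star_1(1\star_0 b_+)\star_1(b_+\star_0 1)=(1\star_0 b_+)\star_1(b_+\star_0 1)\star_1(1\star_0 b_+)$. Let $\mathbf{Brd}^o$ be $\mathbf{Brd}$ with the composition $\star_1$ reversed. **Proposition.** Sending the class of $f:n\Rightarrow 1$ to $n$ is a well-defined isomorphism from the monoid of objects of $\mathcal B(1)$ to $(\mathbb N,+)$, so that $\mathcal B(1)$ is a 2-pro, and it extends to an isomorphism of 2-pros (strict monoidal categories) $\mathcal B(1)\cong\mathbf{Brd}^o$ that sends the class of $\beta$ to the positive crossing $b_+$ and the class of $\beta^-$ to the negative crossing $b_-$. -/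

import Mathlib

/-! ## Strict monoidal categories -/

/-- A 2-monoid, i.e. a strict monoidal category seen as a 2-category with one 0-cell: a monoid `C1`
of 1-cells (objects), a set `C2` of 2-cells (morphisms) with source, target, identities, the
composition `comp` (defined on composable pairs, in diagrammatic order) and the product `tens`. -/
structure TwoMonoid where
  C1 : Type
  C2 : Type
  addMonoid : AddMonoid C1
  src : C2 → C1
  tgt : C2 → C1
  id : C1 → C2
  comp : (x y : C2) → tgt x = src y → C2
  tens : C2 → C2 → C2
  src_id : ∀ a, src (id a) = a
  tgt_id : ∀ a, tgt (id a) = a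
  src_comp : ∀ x y h, src (comp x y h) = src x
  tgt_comp : ∀ x y h, tgt (comp x y h) = tgt y
  src_tens : ∀ x y, src (tens x y) = src x + src y
  tgt_tens : ∀ x y, tgt (tens x y) = tgt x + tgt y
  id_comp : ∀ x, comp (id (src x)) x (tgt_id _) = x
  comp_id : ∀ x, comp x (id (tgt x)) (src_id _).symm = x
  comp_assoc : ∀ x y z (h : tgt x = src y) (k : tgt y = src z),
    comp (comp x y h) z ((tgt_comp x y h).trans k) = comp x (comp y z k) (h.trans (src_comp y z k).symm)
  id_tens_id : ∀ a b, tens (id a) (id b) = id (a + b)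
  interchange : ∀ x y z w (h : tgt x = src y) (k : tgt z = src w),
    tens (comp x y h) (comp z w k) = comp (tens x z) (tens y w)
      ((tgt_tens x z).trans ((congrArg₂ (· + ·) h k).trans (src_tens y w).symm))
  tens_assoc : ∀ x y z, tens (tens x y) z = tens x (tens y z)
  id_zero_tens : ∀ x, tens (id 0) x = x
  tens_id_zero : ∀ x, tens x (id 0) = x

attribute [instance] TwoMonoid.addMonoid

namespace TwoMonoid

/-- The opposite 2-monoid: composition of 2-cells reversed. -/
def op (M : TwoMonoid) : TwoMonoid where
  C1 := M.C1
  C2 := M.C2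
  addMonoid := M.addMonoid
  src := M.tgt
  tgt := M.src
  id := M.id
  comp x y h := M.comp y x h.symm
  tens := M.tens
  src_id := M.tgt_id
  tgt_id := M.src_id
  src_comp x y h := M.tgt_comp y x h.symm
  tgt_comp x y h := M.src_comp y x h.symm
  src_tens := M.tgt_tens
  tgt_tens := M.src_tens
  id_comp := M.comp_id
  comp_id := M.id_comp
  comp_assoc x y z h k := (M.comp_assoc z y x k.symm h.symm).symm
  id_tens_id := M.id_tens_id
  interchange x y z w h k := M.interchange y x w z h.symm k.symm
  tens_assoc := M.tens_assoc
  id_zero_tens := M.id_zero_tens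
  tens_id_zero := M.tens_id_zero

/-- Isomorphisms of 2-monoids: bijections on 1-cells and on 2-cells that preserve the whole
structure. If the monoid of 1-cells of one side is `ℕ`, so is that of the other: this is then an
isomorphism of 2-pros. -/
structure Iso (M N : TwoMonoid) where
  ob : M.C1 ≃+ N.C1
  cell : M.C2 ≃ N.C2
  src_cell : ∀ x, N.src (cell x) = ob (M.src x)
  tgt_cell : ∀ x, N.tgt (cell x) = ob (M.tgt x)
  cell_id : ∀ a, cell (M.id a) = N.id (ob a)
  cell_comp : ∀ x y (h : M.tgt x = M.src y),
    cell (M.comp x y h) = N.comp (cell x) (cell y)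
      ((tgt_cell x).trans ((congrArg ob h).trans (src_cell y).symm))
  cell_tens : ∀ x y, cell (M.tens x y) = N.tens (cell x) (cell y)

end TwoMonoid

/-! ## 2-pros presented by generators and relations -/

/-- Generating 2-cells `g : dom g ⇒ cod g` over the 1-cells `ℕ`. -/
structure Sig where
  Gen : Type
  dom : Gen → ℕ
  cod : Gen → ℕ

/-- Formal composites of generating 2-cells. -/
inductive Term (S : Sig) : Type
  | gen (g : S.Gen) : Term S
  | id (n : ℕ) : Term S
  | tens (f g : Term S) : Term S
  | comp (f g : Term S) : Term S

infixl:75 " ⋆₀ " => Term.tens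
infixl:70 " ⋆₁ " => Term.comp

namespace Term

variable {S : Sig}

def dom : Term S → ℕ
  | gen g => S.dom g
  | id n => n
  | tens f g => dom f + dom g
  | comp f _ => dom f

def cod : Term S → ℕ
  | gen g => S.cod g
  | id n => n
  | tens f g => cod f + cod g
  | comp _ g => cod g

/-- Only composable 2-cells are composed. -/
def WF : Term S → Prop
  | gen _ => True
  | id _ => True
  | tens f g => WF f ∧ WF g
  | comp f g => WF f ∧ WF g ∧ cod f = dom g

end Term

/-- The congruence generated by the axioms of 2-pros and by the relation `R` between parallel
2-cells. -/
inductive Cong {S : Sig} (R : Term S → Term S → Prop) : Term S → Term S → Prop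
  | of {f g} : R f g → f.WF → g.WF → f.dom = g.dom → f.cod = g.cod → Cong R f g
  | refl {f} : f.WF → Cong R f f
  | symm {f g} : Cong R f g → Cong R g f
  | trans {f g h} : Cong R f g → Cong R g h → Cong R f h
  | tens {f f' g g'} : Cong R f f' → Cong R g g' → Cong R (f ⋆₀ g) (f' ⋆₀ g')
  | comp {f f' g g'} : Cong R f f' → Cong R g g' → f.cod = g.dom → Cong R (f ⋆₁ g) (f' ⋆₁ g')
  | tens_assoc {f g h} : f.WF → g.WF → h.WF → Cong R (f ⋆₀ g ⋆₀ h) (f ⋆₀ (g ⋆₀ h))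
  | id_tens {f} : f.WF → Cong R (.id 0 ⋆₀ f) f
  | tens_id {f} : f.WF → Cong R (f ⋆₀ .id 0) f
  | id_tens_id (m n) : Cong R (.id m ⋆₀ .id n) (.id (m + n))
  | comp_assoc {f g h} : f.WF → g.WF → h.WF → f.cod = g.dom → g.cod = h.dom →
      Cong R (f ⋆₁ g ⋆₁ h) (f ⋆₁ (g ⋆₁ h))
  | id_comp {f} : f.WF → Cong R (.id f.dom ⋆₁ f) f
  | comp_id {f} : f.WF → Cong R (f ⋆₁ .id f.cod) f
  | interchange {f f' g g'} : f.WF → f'.WF → g.WF → g'.WF → f.cod = f'.dom → g.cod = g'.dom →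
      Cong R ((f ⋆₁ f') ⋆₀ (g ⋆₁ g')) ((f ⋆₀ g) ⋆₁ (f' ⋆₀ g'))

theorem Cong.parallel {S : Sig} {R : Term S → Term S → Prop} {f g : Term S} (h : Cong R f g) :
    f.WF ∧ g.WF ∧ f.dom = g.dom ∧ f.cod = g.cod := by
  induction h <;> simp_all [Term.WF, Term.dom, Term.cod, add_assoc]

theorem Cong.wf_left {S : Sig} {R : Term S → Term S → Prop} {f g : Term S} (h : Cong R f g) :
    f.WF := h.parallel.1
theorem Cong.wf_right {S : Sig} {R : Term S → Term S → Prop} {f g : Term S} (h : Cong R f g) :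
    g.WF := h.parallel.2.1
theorem Cong.dom_eq {S : Sig} {R : Term S → Term S → Prop} {f g : Term S} (h : Cong R f g) :
    f.dom = g.dom := h.parallel.2.2.1
theorem Cong.cod_eq {S : Sig} {R : Term S → Term S → Prop} {f g : Term S} (h : Cong R f g) :
    f.cod = g.cod := h.parallel.2.2.2

namespace Presented

variable {S : Sig} (R : Term S → Term S → Prop)

def cellSetoid : Setoid {f : Term S // f.WF} where
  r f g := Cong R f.1 g.1
  iseqv := ⟨fun f => .refl f.2, fun h => h.symm, fun h k => h.trans k⟩

/-- The 2-cells of the presented 2-pro. -/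
def Cell : Type := Quotient (cellSetoid R)

def mk (f : Term S) (h : f.WF) : Cell R := Quotient.mk (cellSetoid R) ⟨f, h⟩

variable {R}

theorem mk_eq {f g : Term S} {hf : f.WF} {hg : g.WF} : mk R f hf = mk R g hg ↔ Cong R f g :=
  ⟨fun h => Quotient.exact (s := cellSetoid R) h, fun h => Quotient.sound (s := cellSetoid R) h⟩

theorem exists_mk (x : Cell R) : ∃ f hf, x = mk R f hf := by
  induction x using Quotient.inductionOn with | h f => exact ⟨f.1, f.2, rfl⟩

def src : Cell R → ℕ := Quotient.lift (fun f => f.1.dom) fun _ _ h => h.dom_eq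
def tgt : Cell R → ℕ := Quotient.lift (fun f => f.1.cod) fun _ _ h => h.cod_eq

def tens : Cell R → Cell R → Cell R :=
  Quotient.map₂ (fun f g => ⟨f.1 ⋆₀ g.1, f.2, g.2⟩) fun _ _ h _ _ k => h.tens k

theorem exists_comp (x y : Cell R) (h : tgt x = src y) :
    ∃ z : Cell R, ∀ f g hf hg, x = mk R f hf → y = mk R g hg →
      ∃ hfg, z = mk R (f ⋆₁ g) hfg := by
  obtain ⟨f, hf, rfl⟩ := exists_mk x
  obtain ⟨g, hg, rfl⟩ := exists_mk y
  refine ⟨mk R (f ⋆₁ g) ⟨hf, hg, h⟩, fun f' g' hf' hg' hx hy => ?_⟩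
  rw [mk_eq] at hx hy
  have h' : f.cod = g.dom := h
  exact ⟨⟨hf', hg', by rw [← hx.cod_eq, h', hy.dom_eq]⟩, mk_eq.2 (hx.comp hy h)⟩

/-- The composite of the classes of `f` and `g` is the class of `f ⋆₁ g`. -/
noncomputable def comp (x y : Cell R) (h : tgt x = src y) : Cell R := (exists_comp x y h).choose

theorem comp_mk {f g : Term S} (hf : f.WF) (hg : g.WF) (h : f.cod = g.dom) :
    comp (mk R f hf) (mk R g hg) h = mk R (f ⋆₁ g) ⟨hf, hg, h⟩ :=
  ((exists_comp (mk R f hf) (mk R g hg) h).choose_spec f g hf hg rfl rfl).2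

end Presented

open Presented in
/-- The 2-pro presented by the generating 2-cells `S` and the relations `R`. -/
noncomputable def presentedTwoPro (S : Sig) (R : Term S → Term S → Prop) : TwoMonoid where
  C1 := ℕ
  C2 := Cell R
  addMonoid := inferInstance
  src := src
  tgt := tgt
  id n := mk R (.id n) trivial
  comp := comp
  tens := tens
  src_id _ := rfl
  tgt_id _ := rfl
  src_comp x y h := by
    obtain ⟨f, hf, rfl⟩ := exists_mk x
    obtain ⟨g, hg, rfl⟩ := exists_mk y
    rw [comp_mk hf hg h]; rfl
  tgt_comp x y h := by
    obtain ⟨f, hf, rfl⟩ := exists_mk x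
    obtain ⟨g, hg, rfl⟩ := exists_mk y
    rw [comp_mk hf hg h]; rfl
  src_tens x y := by
    obtain ⟨f, hf, rfl⟩ := exists_mk x
    obtain ⟨g, hg, rfl⟩ := exists_mk y
    rfl
  tgt_tens x y := by
    obtain ⟨f, hf, rfl⟩ := exists_mk x
    obtain ⟨g, hg, rfl⟩ := exists_mk y
    rfl
  id_comp x := by
    obtain ⟨f, hf, rfl⟩ := exists_mk x
    exact (comp_mk (f := .id f.dom) trivial hf rfl).trans (mk_eq.2 (.id_comp hf))
  comp_id x := by
    obtain ⟨f, hf, rfl⟩ := exists_mk x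
    exact (comp_mk (g := .id f.cod) hf trivial rfl).trans (mk_eq.2 (.comp_id hf))
  comp_assoc x y z h k := by
    obtain ⟨f, hf, rfl⟩ := exists_mk x
    obtain ⟨g, hg, rfl⟩ := exists_mk y
    obtain ⟨e, he, rfl⟩ := exists_mk z
    simp only [comp_mk hf hg h, comp_mk hg he k]
    exact (comp_mk (f := f ⋆₁ g) ⟨hf, hg, h⟩ he k).trans
      ((mk_eq.2 (.comp_assoc hf hg he h k)).trans (comp_mk (g := g ⋆₁ e) hf ⟨hg, he, k⟩ h).symm)
  id_tens_id a b := mk_eq.2 (.id_tens_id a b)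
  interchange x y z w h k := by
    obtain ⟨f, hf, rfl⟩ := exists_mk x
    obtain ⟨f', hf', rfl⟩ := exists_mk y
    obtain ⟨g, hg, rfl⟩ := exists_mk z
    obtain ⟨g', hg', rfl⟩ := exists_mk w
    have h' : f.cod = f'.dom := h
    have k' : g.cod = g'.dom := k
    simp only [comp_mk hf hf' h, comp_mk hg hg' k]
    exact (mk_eq.2 (.interchange hf hf' hg hg' h k)).trans
      (comp_mk (f := f ⋆₀ g) (g := f' ⋆₀ g') ⟨hf, hg⟩ ⟨hf', hg'⟩
        (congrArg₂ (· + ·) h' k')).symm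
  tens_assoc x y z := by
    obtain ⟨f, hf, rfl⟩ := exists_mk x
    obtain ⟨g, hg, rfl⟩ := exists_mk y
    obtain ⟨e, he, rfl⟩ := exists_mk z
    exact mk_eq.2 (.tens_assoc hf hg he)
  id_zero_tens x := by
    obtain ⟨f, hf, rfl⟩ := exists_mk x
    exact mk_eq.2 (.id_tens hf)
  tens_id_zero x := by
    obtain ⟨f, hf, rfl⟩ := exists_mk x
    exact mk_eq.2 (.tens_id hf)

/-! ## The 2-pro of braids -/

/-- The positive and the negative crossing. -/
inductive Crossing : Type
  | pos
  | neg

/-- Two generating 2-cells `2 ⇒ 2`. -/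
def crossingSig : Sig := ⟨Crossing, fun _ => 2, fun _ => 2⟩

namespace Brd

def pos : Term crossingSig := .gen Crossing.pos
def neg : Term crossingSig := .gen Crossing.neg
def one : Term crossingSig := .id 1

inductive Rel : Term crossingSig → Term crossingSig → Prop
  | pos_neg : Rel (pos ⋆₁ neg) (.id 2)
  | neg_pos : Rel (neg ⋆₁ pos) (.id 2)
  | yang_baxter : Rel ((pos ⋆₀ one) ⋆₁ (one ⋆₀ pos) ⋆₁ (pos ⋆₀ one))
      ((one ⋆₀ pos) ⋆₁ (pos ⋆₀ one) ⋆₁ (one ⋆₀ pos))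

end Brd

/-- The 2-pro of braids. -/
noncomputable def BrdPro : TwoMonoid := presentedTwoPro crossingSig Brd.Rel

def positiveCrossing : BrdPro.C2 := Presented.mk Brd.Rel Brd.pos trivial
def negativeCrossing : BrdPro.C2 := Presented.mk Brd.Rel Brd.neg trivial

/-! ## The track 3-prop of braided monoidal categories and its quotients -/

/-- The generating 2-cells: the product `mu : 2 ⇒ 1`, the unit `eta : 0 ⇒ 1` and the symmetry
`tau : 2 ⇒ 2` of the prop. -/
inductive BrGen2 : Type
  | mu
  | eta
  | tau

def brSig : Sig where
  Gen := BrGen2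
  dom | .mu => 2 | .eta => 0 | .tau => 2
  cod | .mu => 1 | .eta => 1 | .tau => 2

/-- Formal 2-cells. -/
abbrev T2 : Type := Term brSig

namespace T2

def mu : T2 := .gen BrGen2.mu
def eta : T2 := .gen BrGen2.eta
def tau : T2 := .gen BrGen2.tau
def one : T2 := .id 1

/-- `tauL n : n + 1 ⇒ 1 + n` is the symmetry `τ_{n,1}`. -/
def tauL : ℕ → T2
  | 0 => one
  | n + 1 => (.id n ⋆₀ tau) ⋆₁ (tauL n ⋆₀ one)

/-- `tauR n : 1 + n ⇒ n + 1` is the symmetry `τ_{1,n}`. -/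
def tauR : ℕ → T2
  | 0 => one
  | n + 1 => (tau ⋆₀ .id n) ⋆₁ (one ⋆₀ tauR n)

/-- Permutations: the 2-cells written with `tau` only. -/
def IsPerm : T2 → Prop
  | .gen BrGen2.tau => True
  | .gen _ => False
  | .id _ => True
  | .tens f g => IsPerm f ∧ IsPerm g
  | .comp f g => IsPerm f ∧ IsPerm g

end T2

/-- The generating 3-cells. -/
inductive BrGen3 : Type
  | alpha
  | lambda
  | rho
  | beta

/-- Formal 3-cells: formal composites of generating 3-cells, identities and inverses for the
compositions `⋆₀`, `⋆₁`, `⋆₂` (written `◦₀`, `◦₁`, `◦₂` on 3-cells). -/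
inductive T3 : Type
  | gen (g : BrGen3) : T3
  | id (f : T2) : T3
  | tens (A B : T3) : T3
  | comp₁ (A B : T3) : T3
  | comp₂ (A B : T3) : T3
  | inv (A : T3) : T3

infixl:75 " ◦₀ " => T3.tens
infixl:70 " ◦₁ " => T3.comp₁
infixl:65 " ◦₂ " => T3.comp₂

namespace T3

open T2

/-- Source and target of a formal 3-cell. -/
def bdry : T3 → T2 × T2
  | gen .alpha => ((mu ⋆₀ one) ⋆₁ mu, (one ⋆₀ mu) ⋆₁ mu)
  | gen .lambda => ((eta ⋆₀ one) ⋆₁ mu, one)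
  | gen .rho => ((one ⋆₀ eta) ⋆₁ mu, one)
  | gen .beta => (tau ⋆₁ mu, mu)
  | id f => (f, f)
  | tens A B => (A.bdry.1 ⋆₀ B.bdry.1, A.bdry.2 ⋆₀ B.bdry.2)
  | comp₁ A B => (A.bdry.1 ⋆₁ B.bdry.1, A.bdry.2 ⋆₁ B.bdry.2)
  | comp₂ A B => (A.bdry.1, B.bdry.2)
  | inv A => (A.bdry.2, A.bdry.1)

def src (A : T3) : T2 := A.bdry.1
def tgt (A : T3) : T2 := A.bdry.2

def α : T3 := gen BrGen3.alpha
def β : T3 := gen BrGen3.beta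
def lam : T3 := gen BrGen3.lambda
def rho : T3 := gen BrGen3.rho

/-- The identity 3-cells of `1`, of `mu`, of `tau`, of `eta`. -/
def I : T3 := id one
def M : T3 := id mu
def T : T3 := id tau
def E : T3 := id eta

/-- The 3-cells that do not contain `beta`: those of the sub-track-3-prop generated by the
3-cells `alpha`, `lambda`, `rho` of monoidal categories. -/
def IsMon : T3 → Prop
  | gen .beta => False
  | gen _ => True
  | id _ => True
  | tens A B => IsMon A ∧ IsMon B
  | comp₁ A B => IsMon A ∧ IsMon B
  | comp₂ A B => IsMon A ∧ IsMon B
  | inv A => IsMon A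

end T3

section

open T2

/-- The relations on 2-cells: the axioms of 2-props, together with the identification of the
source and the target of every 3-cell in `K`. -/
inductive Rel2 (K : T3 → Prop) : T2 → T2 → Prop
  | symmetry : Rel2 K (tau ⋆₁ tau) (.id 2)
  | yang_baxter : Rel2 K ((tau ⋆₀ one) ⋆₁ (one ⋆₀ tau) ⋆₁ (tau ⋆₀ one))
      ((one ⋆₀ tau) ⋆₁ (tau ⋆₀ one) ⋆₁ (one ⋆₀ tau))
  | natL (f : T2) : Rel2 K ((f ⋆₀ one) ⋆₁ tauL f.cod) (tauL f.dom ⋆₁ (one ⋆₀ f))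
  | natR (f : T2) : Rel2 K ((one ⋆₀ f) ⋆₁ tauR f.cod) (tauR f.dom ⋆₁ (f ⋆₀ one))
  | collapse (A : T3) : K A → Rel2 K A.src A.tgt

end

/-- Equality of 2-cells. -/
abbrev Cong2 (K : T3 → Prop) : T2 → T2 → Prop := Cong (Rel2 K)

namespace T3

/-- Only composable 3-cells are composed. -/
def WF (K : T3 → Prop) : T3 → Prop
  | gen _ => True
  | id f => f.WF
  | tens A B => A.WF K ∧ B.WF K
  | comp₁ A B => A.WF K ∧ B.WF K ∧ A.src.cod = B.src.dom
  | comp₂ A B => A.WF K ∧ B.WF K ∧ Cong2 K A.tgt B.src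
  | inv A => A.WF K

end T3

section

open T2 T3

/-- The generating 4-cells, as pairs of parallel 3-cells. -/
inductive FourCell : T3 → T3 → Prop
  | aleph : FourCell
      (((α ◦₀ I) ◦₁ M) ◦₂ ((I ◦₀ M ◦₀ I) ◦₁ α) ◦₂ ((I ◦₀ α) ◦₁ M))
      (((M ◦₀ .id (.id 2)) ◦₁ α) ◦₂ ((.id (.id 2) ◦₀ M) ◦₁ α))
  | beth : FourCell
      (((I ◦₀ E ◦₀ I) ◦₁ α) ◦₂ ((I ◦₀ lam) ◦₁ M))
      ((rho ◦₀ I) ◦₁ M)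
  | daleth₁ : FourCell
      (((I ◦₀ T) ◦₁ (β ◦₀ I) ◦₁ M) ◦₂ ((I ◦₀ T) ◦₁ α) ◦₂ ((I ◦₀ β) ◦₁ M))
      (((I ◦₀ T) ◦₁ (T ◦₀ I) ◦₁ α) ◦₂ ((M ◦₀ I) ◦₁ β) ◦₂ α)
  | daleth₂ : FourCell
      (((β ◦₀ I) ◦₁ M).inv ◦₂ ((T ◦₀ I) ◦₁ α) ◦₂ ((T ◦₀ I) ◦₁ (I ◦₀ β) ◦₁ M).inv)
      (α ◦₂ ((I ◦₀ M) ◦₁ β).inv ◦₂ ((T ◦₀ I) ◦₁ (I ◦₀ T) ◦₁ α))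

/-- Equality of 3-cells: the congruence generated by the axioms of track 3-props, by the four
generating 4-cells, and by the identification of every 3-cell in `K` with an identity. -/
inductive Cong3 (K : T3 → Prop) : T3 → T3 → Prop
  | refl {A} : A.WF K → Cong3 K A A
  | symm {A B} : Cong3 K A B → Cong3 K B A
  | trans {A B C} : Cong3 K A B → Cong3 K B C → Cong3 K A C
  | id {f g} : Cong2 K f g → Cong3 K (.id f) (.id g)
  | tens {A A' B B'} : Cong3 K A A' → Cong3 K B B' → Cong3 K (A ◦₀ B) (A' ◦₀ B')
  | comp₁ {A A' B B'} : Cong3 K A A' → Cong3 K B B' → A.src.cod = B.src.dom →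
      Cong3 K (A ◦₁ B) (A' ◦₁ B')
  | comp₂ {A A' B B'} : Cong3 K A A' → Cong3 K B B' → Cong2 K A.tgt B.src →
      Cong3 K (A ◦₂ B) (A' ◦₂ B')
  | inv {A A'} : Cong3 K A A' → Cong3 K A.inv A'.inv
  | tens_assoc {A B C} : A.WF K → B.WF K → C.WF K → Cong3 K (A ◦₀ B ◦₀ C) (A ◦₀ (B ◦₀ C))
  | id_tens {A} : A.WF K → Cong3 K (.id (.id 0) ◦₀ A) A
  | tens_id {A} : A.WF K → Cong3 K (A ◦₀ .id (.id 0)) A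
  | comp₁_assoc {A B C} : A.WF K → B.WF K → C.WF K → A.src.cod = B.src.dom →
      B.src.cod = C.src.dom → Cong3 K (A ◦₁ B ◦₁ C) (A ◦₁ (B ◦₁ C))
  | id_comp₁ {A} : A.WF K → Cong3 K (.id (.id A.src.dom) ◦₁ A) A
  | comp₁_id {A} : A.WF K → Cong3 K (A ◦₁ .id (.id A.src.cod)) A
  | comp₂_assoc {A B C} : A.WF K → B.WF K → C.WF K → Cong2 K A.tgt B.src →
      Cong2 K B.tgt C.src → Cong3 K (A ◦₂ B ◦₂ C) (A ◦₂ (B ◦₂ C))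
  | id_comp₂ {A} : A.WF K → Cong3 K (.id A.src ◦₂ A) A
  | comp₂_id {A} : A.WF K → Cong3 K (A ◦₂ .id A.tgt) A
  | exchange₀₁ {A B C D} : A.WF K → B.WF K → C.WF K → D.WF K → A.src.cod = B.src.dom →
      C.src.cod = D.src.dom → Cong3 K ((A ◦₁ B) ◦₀ (C ◦₁ D)) ((A ◦₀ C) ◦₁ (B ◦₀ D))
  | exchange₀₂ {A B C D} : A.WF K → B.WF K → C.WF K → D.WF K → Cong2 K A.tgt B.src →
      Cong2 K C.tgt D.src → Cong3 K ((A ◦₂ B) ◦₀ (C ◦₂ D)) ((A ◦₀ C) ◦₂ (B ◦₀ D))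
  | exchange₁₂ {A B C D} : A.WF K → B.WF K → C.WF K → D.WF K → Cong2 K A.tgt B.src →
      Cong2 K C.tgt D.src → A.src.cod = C.src.dom →
      Cong3 K ((A ◦₂ B) ◦₁ (C ◦₂ D)) ((A ◦₁ C) ◦₂ (B ◦₁ D))
  | id_tens_id {f g} : f.WF → g.WF → Cong3 K (.id f ◦₀ .id g) (.id (f ⋆₀ g))
  | id_comp₁_id {f g} : f.WF → g.WF → f.cod = g.dom → Cong3 K (.id f ◦₁ .id g) (.id (f ⋆₁ g))
  | comp₂_inv {A} : A.WF K → Cong3 K (A ◦₂ A.inv) (.id A.src)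
  | inv_comp₂ {A} : A.WF K → Cong3 K (A.inv ◦₂ A) (.id A.tgt)
  | natL {A} : A.WF K →
      Cong3 K ((A ◦₀ I) ◦₁ .id (tauL A.src.cod)) (.id (tauL A.src.dom) ◦₁ (I ◦₀ A))
  | natR {A} : A.WF K →
      Cong3 K ((I ◦₀ A) ◦₁ .id (tauR A.src.cod)) (.id (tauR A.src.dom) ◦₁ (A ◦₀ I))
  | fourCell {A B} : FourCell A B → Cong3 K A B
  | collapse {A} : K A → A.WF K → Cong3 K A (.id A.src)

end

/-- With nothing collapsed, `Cong2` and `Cong3` are the equalities of 2-cells and of 3-cells in the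
track 3-prop of braided monoidal categories. -/
def NoCell : T3 → Prop := fun _ => False

/-- The 3-cells of monoidal categories, in the track 3-prop of braided monoidal categories.
Collapsing them gives the quotient of the latter by the former. -/
def MonCell : T3 → Prop := fun A => A.WF NoCell ∧ A.IsMon

/-! Basic facts: sources and targets of equal 3-cells are equal. -/

open T2 in
theorem tauL_facts (n : ℕ) : (tauL n).WF ∧ (tauL n).dom = n + 1 ∧ (tauL n).cod = n + 1 := by
  induction n with
  | zero => exact ⟨trivial, rfl, rfl⟩
  | succ n ih =>
    obtain ⟨h, h', h''⟩ := ih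
    refine ⟨⟨⟨trivial, trivial⟩, ⟨h, trivial⟩, ?_⟩, rfl, ?_⟩
    · change n + 2 = (tauL n).dom + 1
      omega
    · change (tauL n).cod + 1 = _
      omega

open T2 in
theorem tauR_facts (n : ℕ) : (tauR n).WF ∧ (tauR n).dom = n + 1 ∧ (tauR n).cod = n + 1 := by
  induction n with
  | zero => exact ⟨trivial, rfl, rfl⟩
  | succ n ih =>
    obtain ⟨h, h', h''⟩ := ih
    refine ⟨⟨⟨trivial, trivial⟩, ⟨trivial, h⟩, ?_⟩, ?_, ?_⟩
    · change 2 + n = 1 + (tauR n).dom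
      omega
    · change 2 + n = _
      omega
    · change 1 + (tauR n).cod = _
      omega

theorem T3.WF.facts {K : T3 → Prop} {A : T3} (h : A.WF K) :
    A.src.WF ∧ A.tgt.WF ∧ A.src.dom = A.tgt.dom ∧ A.src.cod = A.tgt.cod := by
  induction A with
  | gen g => cases g <;> simp [T3.src, T3.tgt, T3.bdry, Term.WF, Term.dom, Term.cod, T2.mu, T2.eta,
      T2.tau, T2.one, brSig]
  | id f => exact ⟨h, h, rfl, rfl⟩
  | tens A B hA hB =>
    obtain ⟨a1, a2, a3, a4⟩ := hA h.1
    obtain ⟨b1, b2, b3, b4⟩ := hB h.2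
    exact ⟨⟨a1, b1⟩, ⟨a2, b2⟩, congrArg₂ (· + ·) a3 b3, congrArg₂ (· + ·) a4 b4⟩
  | comp₁ A B hA hB =>
    obtain ⟨a1, a2, a3, a4⟩ := hA h.1
    obtain ⟨b1, b2, b3, b4⟩ := hB h.2.1
    exact ⟨⟨a1, b1, h.2.2⟩, ⟨a2, b2, a4.symm.trans (h.2.2.trans b3)⟩, a3, b4⟩
  | comp₂ A B hA hB =>
    obtain ⟨a1, a2, a3, a4⟩ := hA h.1
    obtain ⟨b1, b2, b3, b4⟩ := hB h.2.1
    exact ⟨a1, b2, a3.trans (h.2.2.dom_eq.trans b3), a4.trans (h.2.2.cod_eq.trans b4)⟩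
  | inv A hA =>
    obtain ⟨a1, a2, a3, a4⟩ := hA h
    exact ⟨a2, a1, a3.symm, a4.symm⟩

section

variable {S : Sig} {R : Term S → Term S → Prop} {f g h : Term S}

theorem Cong.whisker_right (n : ℕ) (hf : f.WF) (hg : g.WF) (hh : h.WF) (e : f.cod = g.dom)
    (e' : g.cod + n = h.dom) :
    Cong R (((f ⋆₁ g) ⋆₀ .id n) ⋆₁ h) ((f ⋆₀ .id n) ⋆₁ ((g ⋆₀ .id n) ⋆₁ h)) := by
  have hfg : (f ⋆₁ g).WF := ⟨hf, hg, e⟩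
  have hn : (Term.id n : Term S).WF := trivial
  have k : Cong R ((f ⋆₁ g) ⋆₀ .id n) ((f ⋆₀ .id n) ⋆₁ (g ⋆₀ .id n)) :=
    (Cong.tens (.refl hfg) (Cong.id_comp (f := .id n) trivial).symm).trans
      (.interchange hf hg hn hn e rfl)
  exact (k.comp (.refl hh) e').trans (Cong.comp_assoc (f := f ⋆₀ .id n) (g := g ⋆₀ .id n)
    ⟨hf, trivial⟩ ⟨hg, trivial⟩ hh (congrArg (· + n) e) e')

theorem Cong.whisker_left (n : ℕ) (hf : f.WF) (hg : g.WF) (hh : h.WF) (e : f.cod = g.dom)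
    (e' : n + g.cod = h.dom) :
    Cong R ((.id n ⋆₀ (f ⋆₁ g)) ⋆₁ h) ((.id n ⋆₀ f) ⋆₁ ((.id n ⋆₀ g) ⋆₁ h)) := by
  have hfg : (f ⋆₁ g).WF := ⟨hf, hg, e⟩
  have hn : (Term.id n : Term S).WF := trivial
  have k : Cong R (.id n ⋆₀ (f ⋆₁ g)) ((.id n ⋆₀ f) ⋆₁ (.id n ⋆₀ g)) :=
    (Cong.tens (Cong.id_comp (f := .id n) trivial).symm (.refl hfg)).trans
      (.interchange hn hn hf hg rfl e)
  exact (k.comp (.refl hh) e').trans (Cong.comp_assoc (f := .id n ⋆₀ f) (g := .id n ⋆₀ g)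
    ⟨trivial, hf⟩ ⟨trivial, hg⟩ hh (congrArg (n + ·) e) e')

end

open T2 in
theorem tauL_one {K : T3 → Prop} : Cong2 K (tauL 1) tau :=
  (Cong.comp (Cong.id_tens (f := tau) trivial) (.id_tens_id 1 1) rfl).trans (Cong.comp_id (f := tau) trivial)

open T2 in
theorem tauR_one {K : T3 → Prop} : Cong2 K (tauR 1) tau :=
  (Cong.comp (Cong.tens_id (f := tau) trivial) (.id_tens_id 1 1) rfl).trans (Cong.comp_id (f := tau) trivial)

open T2 T3 in
theorem FourCell.parallel {K : T3 → Prop} {A B : T3} (h : FourCell A B) :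
    A.WF K ∧ B.WF K ∧ Cong2 K A.src B.src ∧ Cong2 K A.tgt B.tgt := by
  have o : one.WF := trivial
  have wm : mu.WF := trivial
  have we : eta.WF := trivial
  have wt : tau.WF := trivial
  have e1 : (eta ⋆₀ one).WF := ⟨trivial, trivial⟩
  have f1 : (one ⋆₀ eta).WF := ⟨trivial, trivial⟩
  have m2 : (mu ⋆₀ .id 2).WF := ⟨trivial, trivial⟩
  have w2 : (.id 2 ⋆₀ mu).WF := ⟨trivial, trivial⟩
  have m1 : (mu ⋆₀ one).WF := ⟨trivial, trivial⟩
  have w1 : (one ⋆₀ mu).WF := ⟨trivial, trivial⟩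
  have mm : ((mu ⋆₀ one) ⋆₁ mu).WF := ⟨m1, trivial, rfl⟩
  have ww : ((one ⋆₀ mu) ⋆₁ mu).WF := ⟨w1, trivial, rfl⟩
  have t1 : (tau ⋆₀ one).WF := ⟨trivial, trivial⟩
  have s1 : (one ⋆₀ tau).WF := ⟨trivial, trivial⟩
  have tm : (tau ⋆₁ mu).WF := ⟨trivial, trivial, rfl⟩
  cases h with
  | aleph =>
    have c1 : Cong2 K ((((one ⋆₀ mu) ⋆₁ mu) ⋆₀ one) ⋆₁ mu)
        ((one ⋆₀ mu ⋆₀ one) ⋆₁ ((mu ⋆₀ one) ⋆₁ mu)) :=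
      .whisker_right 1 w1 wm wm rfl rfl
    have c2 : Cong2 K ((one ⋆₀ mu ⋆₀ one) ⋆₁ ((one ⋆₀ mu) ⋆₁ mu))
        ((one ⋆₀ ((mu ⋆₀ one) ⋆₁ mu)) ⋆₁ mu) :=
      (Cong.comp (.tens_assoc o wm o) (.refl ww) rfl).trans
        (Cong.whisker_left 1 m1 wm wm rfl rfl).symm
    have c3 : Cong2 K ((mu ⋆₀ .id 2) ⋆₁ ((one ⋆₀ mu) ⋆₁ mu))
        ((.id 2 ⋆₀ mu) ⋆₁ ((mu ⋆₀ one) ⋆₁ mu)) := by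
      have k1 : Cong2 K ((mu ⋆₀ .id 2) ⋆₁ (one ⋆₀ mu)) (mu ⋆₀ mu) :=
        (Cong.interchange (f := mu) (f' := one) (g := .id 2) (g' := mu) trivial trivial trivial
          trivial rfl rfl).symm.trans (.tens (Cong.comp_id (f := mu) trivial)
            (Cong.id_comp (f := mu) trivial))
      have k2 : Cong2 K ((.id 2 ⋆₀ mu) ⋆₁ (mu ⋆₀ one)) (mu ⋆₀ mu) :=
        (Cong.interchange (f := .id 2) (f' := mu) (g := mu) (g' := one) trivial trivial trivial
          trivial rfl rfl).symm.trans (.tens (Cong.id_comp (f := mu) trivial)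
            (Cong.comp_id (f := mu) trivial))
      exact (Cong.comp_assoc m2 w1 wm rfl rfl).symm.trans
        (((k1.trans k2.symm).comp (.refl wm) rfl).trans
          (Cong.comp_assoc w2 m1 wm rfl rfl))
    refine ⟨⟨⟨⟨⟨trivial, trivial⟩, trivial, rfl⟩, ⟨⟨⟨trivial, trivial⟩, trivial⟩, trivial, rfl⟩, c1⟩,
      ⟨⟨trivial, trivial⟩, trivial, rfl⟩, c2⟩, ⟨⟨⟨trivial, trivial⟩, trivial, rfl⟩,
      ⟨⟨trivial, trivial⟩, trivial, rfl⟩, c3⟩, ?_, ?_⟩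
    · exact (Cong.whisker_right 1 m1 wm wm rfl rfl).trans
        (.comp ((Cong.tens_assoc wm o o).trans
          (.tens (.refl wm) (.id_tens_id 1 1))) (.refl mm) rfl)
    · exact (Cong.whisker_left 1 w1 wm wm rfl rfl).trans
        (.comp ((Cong.tens_assoc o o wm).symm.trans
          (.tens (.id_tens_id 1 1) (.refl wm))) (.refl ww) rfl)
  | beth =>
    have c1 : Cong2 K ((one ⋆₀ eta ⋆₀ one) ⋆₁ ((one ⋆₀ mu) ⋆₁ mu))
        ((one ⋆₀ ((eta ⋆₀ one) ⋆₁ mu)) ⋆₁ mu) :=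
      (Cong.comp (.tens_assoc o we o) (.refl ww) rfl).trans
        (Cong.whisker_left 1 e1 wm wm rfl rfl).symm
    exact ⟨⟨⟨⟨⟨trivial, trivial⟩, trivial⟩, trivial, rfl⟩, ⟨⟨trivial, trivial⟩, trivial, rfl⟩, c1⟩,
      ⟨⟨trivial, trivial⟩, trivial, rfl⟩,
      (Cong.whisker_right 1 f1 wm wm rfl rfl).symm,
      .refl ⟨⟨trivial, trivial⟩, trivial, rfl⟩⟩
  | daleth₁ =>
    have c1 : Cong2 K ((one ⋆₀ tau) ⋆₁ (mu ⋆₀ one) ⋆₁ mu)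
        ((one ⋆₀ tau) ⋆₁ ((mu ⋆₀ one) ⋆₁ mu)) :=
      .comp_assoc s1 m1 wm rfl rfl
    have c2 : Cong2 K ((one ⋆₀ tau) ⋆₁ ((one ⋆₀ mu) ⋆₁ mu)) ((one ⋆₀ (tau ⋆₁ mu)) ⋆₁ mu) :=
      (Cong.whisker_left 1 wt wm wm rfl rfl).symm
    have c3 : Cong2 K ((one ⋆₀ tau) ⋆₁ (tau ⋆₀ one) ⋆₁ ((one ⋆₀ mu) ⋆₁ mu))
        ((mu ⋆₀ one) ⋆₁ (tau ⋆₁ mu)) := by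
      have n1 : Cong2 K ((mu ⋆₀ one) ⋆₁ tauL 1) (tauL 2 ⋆₁ (one ⋆₀ mu)) :=
        .of (.natL mu) ⟨m1, (tauL_facts 1).1, rfl⟩ ⟨(tauL_facts 2).1, w1, rfl⟩ rfl rfl
      have n2 : Cong2 K (tauL 2) ((one ⋆₀ tau) ⋆₁ (tau ⋆₀ one)) :=
        .comp (.refl s1) (.tens tauL_one (.refl o)) rfl
      have n3 : Cong2 K ((one ⋆₀ tau) ⋆₁ (tau ⋆₀ one) ⋆₁ (one ⋆₀ mu)) ((mu ⋆₀ one) ⋆₁ tau) :=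
        (n2.symm.comp (.refl w1) rfl).trans (n1.symm.trans (.comp (.refl m1) tauL_one rfl))
      exact (Cong.comp_assoc (f := (one ⋆₀ tau) ⋆₁ (tau ⋆₀ one)) ⟨s1, t1, rfl⟩ w1 wm rfl rfl).symm.trans
        ((n3.comp (.refl wm) rfl).trans (.comp_assoc m1 wt wm rfl rfl))
    refine ⟨⟨⟨⟨⟨⟨trivial, trivial⟩, ⟨trivial, trivial⟩, rfl⟩, trivial, rfl⟩,
      ⟨⟨trivial, trivial⟩, trivial, rfl⟩, c1⟩, ⟨⟨trivial, trivial⟩, trivial, rfl⟩, c2⟩,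
      ⟨⟨⟨⟨⟨trivial, trivial⟩, ⟨trivial, trivial⟩, rfl⟩, trivial, rfl⟩,
      ⟨⟨trivial, trivial⟩, trivial, rfl⟩, c3⟩, trivial, .refl mm⟩, ?_, .refl ww⟩
    exact (Cong.comp_assoc (g := (tau ⋆₁ mu) ⋆₀ one) s1 ⟨tm, o⟩ wm rfl rfl).trans
      ((Cong.comp (.refl s1) (.whisker_right 1 wt wm wm rfl rfl) rfl).trans
        (Cong.comp_assoc s1 t1 mm rfl rfl).symm)
  | daleth₂ =>
    have c1 : Cong2 K (((tau ⋆₁ mu) ⋆₀ one) ⋆₁ mu) ((tau ⋆₀ one) ⋆₁ ((mu ⋆₀ one) ⋆₁ mu)) :=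
      .whisker_right 1 wt wm wm rfl rfl
    have c2 : Cong2 K ((tau ⋆₀ one) ⋆₁ ((one ⋆₀ mu) ⋆₁ mu))
        ((tau ⋆₀ one) ⋆₁ (one ⋆₀ mu) ⋆₁ mu) :=
      (Cong.comp_assoc t1 w1 wm rfl rfl).symm
    have c3 : Cong2 K ((one ⋆₀ mu) ⋆₁ (tau ⋆₁ mu))
        ((tau ⋆₀ one) ⋆₁ (one ⋆₀ tau) ⋆₁ ((mu ⋆₀ one) ⋆₁ mu)) := by
      have n1 : Cong2 K ((one ⋆₀ mu) ⋆₁ tauR 1) (tauR 2 ⋆₁ (mu ⋆₀ one)) :=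
        .of (.natR mu) ⟨w1, (tauR_facts 1).1, rfl⟩ ⟨(tauR_facts 2).1, m1, rfl⟩ rfl rfl
      have n2 : Cong2 K (tauR 2) ((tau ⋆₀ one) ⋆₁ (one ⋆₀ tau)) :=
        .comp (.refl t1) (.tens (.refl o) tauR_one) rfl
      have n3 : Cong2 K ((tau ⋆₀ one) ⋆₁ (one ⋆₀ tau) ⋆₁ (mu ⋆₀ one)) ((one ⋆₀ mu) ⋆₁ tau) :=
        (n2.symm.comp (.refl m1) rfl).trans (n1.symm.trans (.comp (.refl w1) tauR_one rfl))
      exact ((Cong.comp_assoc (f := (tau ⋆₀ one) ⋆₁ (one ⋆₀ tau)) ⟨t1, s1, rfl⟩ m1 wm rfl rfl).symm.trans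
        ((n3.comp (.refl wm) rfl).trans (.comp_assoc w1 wt wm rfl rfl))).symm
    refine ⟨⟨⟨⟨⟨trivial, trivial⟩, trivial, rfl⟩, ⟨⟨trivial, trivial⟩, trivial, rfl⟩, c1⟩,
      ⟨⟨⟨trivial, trivial⟩, ⟨trivial, trivial⟩, rfl⟩, trivial, rfl⟩, c2⟩,
      ⟨⟨trivial, ⟨⟨trivial, trivial⟩, trivial, rfl⟩, .refl ww⟩,
      ⟨⟨⟨trivial, trivial⟩, ⟨trivial, trivial⟩, rfl⟩, trivial, rfl⟩, c3⟩, .refl mm, ?_⟩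
    exact (Cong.comp_assoc (g := one ⋆₀ (tau ⋆₁ mu)) t1 ⟨o, tm⟩ wm rfl rfl).trans
      ((Cong.comp (.refl t1) (.whisker_left 1 wt wm wm rfl rfl) rfl).trans
        (Cong.comp_assoc t1 s1 ww rfl rfl).symm)

theorem Cong3.parallel {K : T3 → Prop} {A B : T3} (h : Cong3 K A B) :
    A.WF K ∧ B.WF K ∧ Cong2 K A.src B.src ∧ Cong2 K A.tgt B.tgt := by
  induction h with
  | refl h => exact ⟨h, h, .refl h.facts.1, .refl h.facts.2.1⟩
  | symm _ ih => exact ⟨ih.2.1, ih.1, ih.2.2.1.symm, ih.2.2.2.symm⟩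
  | trans _ _ h k => exact ⟨h.1, k.2.1, h.2.2.1.trans k.2.2.1, h.2.2.2.trans k.2.2.2⟩
  | id h => exact ⟨h.wf_left, h.wf_right, h, h⟩
  | tens _ _ h k => exact ⟨⟨h.1, k.1⟩, ⟨h.2.1, k.2.1⟩, h.2.2.1.tens k.2.2.1, h.2.2.2.tens k.2.2.2⟩
  | comp₁ _ _ e h k =>
    exact ⟨⟨h.1, k.1, e⟩, ⟨h.2.1, k.2.1, h.2.2.1.cod_eq.symm.trans (e.trans k.2.2.1.dom_eq)⟩,
      h.2.2.1.comp k.2.2.1 e,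
      h.2.2.2.comp k.2.2.2 (h.1.facts.2.2.2.symm.trans (e.trans k.1.facts.2.2.1))⟩
  | comp₂ _ _ e h k =>
    exact ⟨⟨h.1, k.1, e⟩, ⟨h.2.1, k.2.1, h.2.2.2.symm.trans (e.trans k.2.2.1)⟩, h.2.2.1, k.2.2.2⟩
  | inv _ h => exact ⟨h.1, h.2.1, h.2.2.2, h.2.2.1⟩
  | tens_assoc a b c =>
    exact ⟨⟨⟨a, b⟩, c⟩, ⟨a, b, c⟩, .tens_assoc a.facts.1 b.facts.1 c.facts.1,
      .tens_assoc a.facts.2.1 b.facts.2.1 c.facts.2.1⟩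
  | id_tens a => exact ⟨⟨trivial, a⟩, a, .id_tens a.facts.1, .id_tens a.facts.2.1⟩
  | tens_id a => exact ⟨⟨a, trivial⟩, a, .tens_id a.facts.1, .tens_id a.facts.2.1⟩
  | comp₁_assoc a b c e e' =>
    exact ⟨⟨⟨a, b, e⟩, c, e'⟩, ⟨a, ⟨b, c, e'⟩, e⟩, .comp_assoc a.facts.1 b.facts.1 c.facts.1 e e',
      .comp_assoc a.facts.2.1 b.facts.2.1 c.facts.2.1
        (a.facts.2.2.2.symm.trans (e.trans b.facts.2.2.1))
        (b.facts.2.2.2.symm.trans (e'.trans c.facts.2.2.1))⟩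
  | @id_comp₁ A a =>
    refine ⟨⟨trivial, a, rfl⟩, a, .id_comp a.facts.1, ?_⟩
    have := Cong.id_comp (R := Rel2 K) a.facts.2.1
    rw [← a.facts.2.2.1] at this
    exact this
  | @comp₁_id A a =>
    refine ⟨⟨a, trivial, rfl⟩, a, .comp_id a.facts.1, ?_⟩
    have := Cong.comp_id (R := Rel2 K) a.facts.2.1
    rw [← a.facts.2.2.2] at this
    exact this
  | comp₂_assoc a b c e e' =>
    exact ⟨⟨⟨a, b, e⟩, c, e'⟩, ⟨a, ⟨b, c, e'⟩, e⟩, .refl a.facts.1, .refl c.facts.2.1⟩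
  | id_comp₂ a => exact ⟨⟨a.facts.1, a, .refl a.facts.1⟩, a, .refl a.facts.1, .refl a.facts.2.1⟩
  | comp₂_id a => exact ⟨⟨a, a.facts.2.1, .refl a.facts.2.1⟩, a, .refl a.facts.1, .refl a.facts.2.1⟩
  | exchange₀₁ a b c d e e' =>
    exact ⟨⟨⟨a, b, e⟩, ⟨c, d, e'⟩⟩, ⟨⟨a, c⟩, ⟨b, d⟩, congrArg₂ (· + ·) e e'⟩,
      .interchange a.facts.1 b.facts.1 c.facts.1 d.facts.1 e e',
      .interchange a.facts.2.1 b.facts.2.1 c.facts.2.1 d.facts.2.1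
        (a.facts.2.2.2.symm.trans (e.trans b.facts.2.2.1))
        (c.facts.2.2.2.symm.trans (e'.trans d.facts.2.2.1))⟩
  | exchange₀₂ a b c d e e' =>
    exact ⟨⟨⟨a, b, e⟩, ⟨c, d, e'⟩⟩, ⟨⟨a, c⟩, ⟨b, d⟩, e.tens e'⟩,
      .refl ⟨a.facts.1, c.facts.1⟩, .refl ⟨b.facts.2.1, d.facts.2.1⟩⟩
  | exchange₁₂ a b c d e e' u =>
    have u' := a.facts.2.2.2.symm.trans (u.trans c.facts.2.2.1)
    have u'' := e.cod_eq.symm.trans (u'.trans e'.dom_eq)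
    exact ⟨⟨⟨a, b, e⟩, ⟨c, d, e'⟩, u⟩, ⟨⟨a, c, u⟩, ⟨b, d, u''⟩, e.comp e' u'⟩,
      .refl ⟨a.facts.1, c.facts.1, u⟩, .refl ⟨b.facts.2.1, d.facts.2.1,
        b.facts.2.2.2.symm.trans (u''.trans d.facts.2.2.1)⟩⟩
  | id_tens_id a b => exact ⟨⟨a, b⟩, ⟨a, b⟩, .refl ⟨a, b⟩, .refl ⟨a, b⟩⟩
  | id_comp₁_id a b e => exact ⟨⟨a, b, e⟩, ⟨a, b, e⟩, .refl ⟨a, b, e⟩, .refl ⟨a, b, e⟩⟩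
  | comp₂_inv a =>
    exact ⟨⟨a, a, .refl a.facts.2.1⟩, a.facts.1, .refl a.facts.1, .refl a.facts.1⟩
  | inv_comp₂ a =>
    exact ⟨⟨a, a, .refl a.facts.1⟩, a.facts.2.1, .refl a.facts.2.1, .refl a.facts.2.1⟩
  | @natL A a =>
    have h := tauL_facts A.src.cod
    have k := tauL_facts A.src.dom
    have e1 : (A.src ⋆₀ T2.one).cod = (T2.tauL A.src.cod).dom := by rw [h.2.1]; rfl
    have e2 : (T2.tauL A.src.dom).cod = (T2.one ⋆₀ A.src).dom := by rw [k.2.2, add_comm]; rfl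
    have e3 : (A.tgt ⋆₀ T2.one).cod = (T2.tauL A.tgt.cod).dom := by
      rw [(tauL_facts A.tgt.cod).2.1]; rfl
    have e4 : (T2.tauL A.tgt.dom).cod = (T2.one ⋆₀ A.tgt).dom := by
      rw [(tauL_facts A.tgt.dom).2.2, add_comm]; rfl
    refine ⟨⟨⟨a, trivial⟩, h.1, e1⟩, ⟨k.1, ⟨trivial, a⟩, e2⟩,
      .of (.natL A.src) ⟨⟨a.facts.1, trivial⟩, h.1, e1⟩ ⟨k.1, ⟨trivial, a.facts.1⟩, e2⟩ ?_ ?_, ?_⟩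
    · exact k.2.1.symm
    · exact h.2.2.trans (add_comm _ _)
    · have : Cong2 K ((A.tgt ⋆₀ T2.one) ⋆₁ T2.tauL A.tgt.cod)
          (T2.tauL A.tgt.dom ⋆₁ (T2.one ⋆₀ A.tgt)) :=
        .of (.natL A.tgt) ⟨⟨a.facts.2.1, trivial⟩, (tauL_facts _).1, e3⟩
          ⟨(tauL_facts _).1, ⟨trivial, a.facts.2.1⟩, e4⟩ (tauL_facts _).2.1.symm
          ((tauL_facts _).2.2.trans (add_comm _ _))
      rw [← a.facts.2.2.1, ← a.facts.2.2.2] at this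
      exact this
  | @natR A a =>
    have h := tauR_facts A.src.cod
    have k := tauR_facts A.src.dom
    have e1 : (T2.one ⋆₀ A.src).cod = (T2.tauR A.src.cod).dom := by
      rw [h.2.1]; simp only [Term.cod, T2.one]; omega
    have e2 : (T2.tauR A.src.dom).cod = (A.src ⋆₀ T2.one).dom := by rw [k.2.2]; rfl
    have e3 : (T2.one ⋆₀ A.tgt).cod = (T2.tauR A.tgt.cod).dom := by
      rw [(tauR_facts A.tgt.cod).2.1]; simp only [Term.cod, T2.one]; omega
    have e4 : (T2.tauR A.tgt.dom).cod = (A.tgt ⋆₀ T2.one).dom := by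
      rw [(tauR_facts A.tgt.dom).2.2]; rfl
    refine ⟨⟨⟨trivial, a⟩, h.1, e1⟩, ⟨k.1, ⟨a, trivial⟩, e2⟩,
      .of (.natR A.src) ⟨⟨trivial, a.facts.1⟩, h.1, e1⟩ ⟨k.1, ⟨a.facts.1, trivial⟩, e2⟩ ?_ ?_, ?_⟩
    · exact (Nat.add_comm _ _).trans k.2.1.symm
    · exact h.2.2
    · have : Cong2 K ((T2.one ⋆₀ A.tgt) ⋆₁ T2.tauR A.tgt.cod)
          (T2.tauR A.tgt.dom ⋆₁ (A.tgt ⋆₀ T2.one)) :=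
        .of (.natR A.tgt) ⟨⟨trivial, a.facts.2.1⟩, (tauR_facts _).1, e3⟩
          ⟨(tauR_facts _).1, ⟨a.facts.2.1, trivial⟩, e4⟩
          ((Nat.add_comm _ _).trans (tauR_facts _).2.1.symm) (tauR_facts _).2.2
      rw [← a.facts.2.2.1, ← a.facts.2.2.2] at this
      exact this
  | fourCell h => exact h.parallel
  | @collapse A hA a =>
    exact ⟨a, a.facts.1, .refl a.facts.1, (Cong.of (.collapse A hA) a.facts.1 a.facts.2.1
      a.facts.2.2.1 a.facts.2.2.2).symm⟩

/-! ## The underlying category of the initial algebra -/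

namespace Initial

open T2 T3

variable {K : T3 → Prop}

/-- The relation `f ≈ σ ⋆₁ f`, for permutations `σ`, on 2-cells. -/
def ObEq (K : T3 → Prop) (f g : T2) : Prop :=
  ∃ σ : T2, IsPerm σ ∧ σ.WF ∧ σ.cod = g.dom ∧ Cong2 K f (σ ⋆₁ g)

/-- The congruence on 3-cells, compatible with the composition `◦₂`, generated by
`σ ⋆₁ A ≈ A` for permutations `σ`. -/
inductive CellEq (K : T3 → Prop) : T3 → T3 → Prop
  | of_cong {A B} : Cong3 K A B → CellEq K A B
  | perm {σ A} : IsPerm σ → σ.WF → A.WF K → σ.cod = A.src.dom → CellEq K (.id σ ◦₁ A) A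
  | symm {A B} : CellEq K A B → CellEq K B A
  | trans {A B C} : CellEq K A B → CellEq K B C → CellEq K A C
  | comp {A A' B B'} : CellEq K A A' → CellEq K B B' → Cong2 K A.tgt B.src →
      Cong2 K A'.tgt B'.src → CellEq K (A ◦₂ B) (A' ◦₂ B')

theorem perm_dom {σ : T2} (h : IsPerm σ) (w : σ.WF) : σ.dom = σ.cod := by
  induction σ with
  | gen g => cases g <;> first | rfl | exact h.elim
  | id n => rfl
  | tens f g hf hg => exact congrArg₂ (· + ·) (hf h.1 w.1) (hg h.2 w.2)
  | comp f g hf hg => exact (hf h.1 w.1).trans (w.2.2.trans (hg h.2 w.2.1))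

theorem perm_inv {σ : T2} (h : IsPerm σ) (w : σ.WF) :
    ∃ τ : T2, IsPerm τ ∧ τ.WF ∧ τ.cod = σ.dom ∧ Cong2 K (τ ⋆₁ σ) (.id σ.cod) := by
  induction σ with
  | gen g =>
    cases g with
    | mu => exact h.elim
    | eta => exact h.elim
    | tau => exact ⟨tau, trivial, trivial, rfl,
        .of .symmetry ⟨trivial, trivial, rfl⟩ trivial rfl rfl⟩
  | id n => exact ⟨.id n, trivial, trivial, rfl, Cong.id_comp (f := .id n) trivial⟩
  | tens f g hf hg =>
    obtain ⟨f', p, q, r, s⟩ := hf h.1 w.1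
    obtain ⟨g', p', q', r', s'⟩ := hg h.2 w.2
    exact ⟨f' ⋆₀ g', ⟨p, p'⟩, ⟨q, q'⟩, congrArg₂ (· + ·) r r',
      (Cong.interchange q w.1 q' w.2 r r').symm.trans ((s.tens s').trans (.id_tens_id _ _))⟩
  | comp f g hf hg =>
    obtain ⟨f', p, q, r, s⟩ := hf h.1 w.1
    obtain ⟨g', p', q', r', s'⟩ := hg h.2 w.2.1
    have e : g'.cod = f'.dom := by
      rw [r', ← w.2.2]; exact s.dom_eq.symm
    refine ⟨g' ⋆₁ f', ⟨p', p⟩, ⟨q', q, e⟩, r, ?_⟩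
    have k1 : Cong2 K (f' ⋆₁ (f ⋆₁ g)) g := by
      refine (Cong.comp_assoc q w.1 w.2.1 r w.2.2).symm.trans
        ((s.comp (.refl w.2.1) w.2.2).trans ?_)
      rw [w.2.2]
      exact .id_comp w.2.1
    exact (Cong.comp_assoc q' q w e r).trans (((Cong.refl q').comp k1 e).trans s')

theorem ObEq.of_cong {f g : T2} (h : Cong2 K f g) : ObEq K f g :=
  ⟨.id g.dom, trivial, trivial, rfl, h.trans (Cong.id_comp h.wf_right).symm⟩

theorem ObEq.wf {f g : T2} (h : ObEq K f g) : f.WF ∧ g.WF := by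
  obtain ⟨σ, p, q, r, s⟩ := h
  exact ⟨s.wf_left, s.wf_right.2.1⟩

theorem ObEq.dom_eq {f g : T2} (h : ObEq K f g) : f.dom = g.dom := by
  obtain ⟨σ, p, q, r, s⟩ := h
  exact s.dom_eq.trans ((perm_dom p q).trans r)

theorem ObEq.cod_eq {f g : T2} (h : ObEq K f g) : f.cod = g.cod := by
  obtain ⟨σ, p, q, r, s⟩ := h
  exact s.cod_eq

theorem ObEq.trans {f g h : T2} (a : ObEq K f g) (b : ObEq K g h) : ObEq K f h := by
  obtain ⟨σ, p, q, r, s⟩ := a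
  obtain ⟨τ, p', q', r', s'⟩ := b
  have e : σ.cod = τ.dom := r.trans s'.dom_eq
  exact ⟨σ ⋆₁ τ, ⟨p, p'⟩, ⟨q, q', e⟩, r', s.trans (((Cong.refl q).comp s' r).trans
    (Cong.comp_assoc q q' s'.wf_right.2.1 e r').symm)⟩

theorem ObEq.symm {f g : T2} (a : ObEq K f g) : ObEq K g f := by
  obtain ⟨σ, p, q, r, s⟩ := a
  obtain ⟨τ, p', q', r', s'⟩ := perm_inv (K := K) p q
  have wg := s.wf_right.2.1
  refine ⟨τ, p', q', r'.trans s.dom_eq.symm, ?_⟩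
  have k : Cong2 K (τ ⋆₁ σ ⋆₁ g) g := by
    refine (s'.comp (.refl wg) r).trans ?_
    rw [r]
    exact .id_comp wg
  exact k.symm.trans ((Cong.comp_assoc q' q wg r' r).trans
    ((Cong.refl q').comp s.symm r'))

theorem CellEq.facts {A B : T3} (h : CellEq K A B) :
    A.WF K ∧ B.WF K ∧ ObEq K A.src B.src ∧ ObEq K A.tgt B.tgt := by
  induction h with
  | of_cong h =>
    exact ⟨h.parallel.1, h.parallel.2.1, .of_cong h.parallel.2.2.1, .of_cong h.parallel.2.2.2⟩
  | perm p q w e =>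
    exact ⟨⟨q, w, e⟩, w, ⟨_, p, q, e, .refl ⟨q, w.facts.1, e⟩⟩,
      ⟨_, p, q, e.trans w.facts.2.2.1, .refl ⟨q, w.facts.2.1, e.trans w.facts.2.2.1⟩⟩⟩
  | symm _ h => exact ⟨h.2.1, h.1, h.2.2.1.symm, h.2.2.2.symm⟩
  | trans _ _ h k => exact ⟨h.1, k.2.1, h.2.2.1.trans k.2.2.1, h.2.2.2.trans k.2.2.2⟩
  | comp _ _ e e' h k => exact ⟨⟨h.1, k.1, e⟩, ⟨h.2.1, k.2.1, e'⟩, h.2.2.1, k.2.2.2⟩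

theorem CellEq.refl {A : T3} (h : A.WF K) : CellEq K A A := .of_cong (.refl h)

theorem ObEq.id {f g : T2} (h : ObEq K f g) : CellEq K (.id f) (.id g) := by
  obtain ⟨σ, p, q, r, s⟩ := h
  have wg : g.WF := s.wf_right.2.1
  exact (CellEq.of_cong ((Cong3.id s).trans (Cong3.id_comp₁_id q wg r).symm)).trans
    (.perm p q wg r)

/-- The objects: algebraic 2-cells (those with target `1`) up to permutation. -/
def obSetoid (K : T3 → Prop) : Setoid {f : T2 // f.WF ∧ f.cod = 1} where
  r f g := ObEq K f.1 g.1
  iseqv := ⟨fun f => .of_cong (.refl f.2.1), fun h => h.symm, fun h k => h.trans k⟩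

/-- The morphisms: algebraic 3-cells (those with 1-target `1`) up to permutation. -/
def cellSetoid (K : T3 → Prop) : Setoid {A : T3 // A.WF K ∧ A.src.cod = 1} where
  r A B := CellEq K A.1 B.1
  iseqv := ⟨fun A => .refl A.2.1, fun h => h.symm, fun h k => h.trans k⟩

def Ob (K : T3 → Prop) : Type := Quotient (obSetoid K)
def Cell (K : T3 → Prop) : Type := Quotient (cellSetoid K)

def ob (K : T3 → Prop) (f : T2) (h : f.WF ∧ f.cod = 1) : Ob K := Quotient.mk (obSetoid K) ⟨f, h⟩

def cell (K : T3 → Prop) (A : T3) (h : A.WF K ∧ A.src.cod = 1) : Cell K :=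
  Quotient.mk (cellSetoid K) ⟨A, h⟩

theorem ob_eq {f g : T2} {hf : f.WF ∧ f.cod = 1} {hg : g.WF ∧ g.cod = 1} :
    ob K f hf = ob K g hg ↔ ObEq K f g :=
  ⟨fun h => Quotient.exact (s := obSetoid K) h, fun h => Quotient.sound (s := obSetoid K) h⟩

theorem cell_eq {A B : T3} {hA : A.WF K ∧ A.src.cod = 1} {hB : B.WF K ∧ B.src.cod = 1} :
    cell K A hA = cell K B hB ↔ CellEq K A B :=
  ⟨fun h => Quotient.exact (s := cellSetoid K) h, fun h => Quotient.sound (s := cellSetoid K) h⟩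

theorem exists_ob (x : Ob K) : ∃ f hf, x = ob K f hf := by
  induction x using Quotient.inductionOn with | h f => exact ⟨f.1, f.2, rfl⟩

theorem exists_cell (x : Cell K) : ∃ A hA, x = cell K A hA := by
  induction x using Quotient.inductionOn with | h f => exact ⟨f.1, f.2, rfl⟩

def src : Cell K → Ob K :=
  Quotient.map (fun A => ⟨A.1.src, A.2.1.facts.1, A.2.2⟩) fun _ _ h => (CellEq.facts h).2.2.1

def tgt : Cell K → Ob K :=
  Quotient.map (fun A => ⟨A.1.tgt, A.2.1.facts.2.1, A.2.1.facts.2.2.2.symm.trans A.2.2⟩)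
    fun _ _ h => (CellEq.facts h).2.2.2

def ident : Ob K → Cell K :=
  Quotient.map (fun f => ⟨.id f.1, f.2⟩) fun _ _ h => ObEq.id h

theorem exists_composable {A : T3} (hA : A.WF K ∧ A.src.cod = 1) (y : Cell K)
    (h : tgt (cell K A hA) = src y) : ∃ B hB, y = cell K B hB ∧ Cong2 K A.tgt B.src := by
  obtain ⟨B, hB, rfl⟩ := exists_cell y
  obtain ⟨σ, p, q, r, s⟩ : ObEq K A.tgt B.src := ob_eq.1 h
  exact ⟨.id σ ◦₁ B, ⟨⟨q, hB.1, r⟩, hB.2⟩, cell_eq.2 (CellEq.perm p q hB.1 r).symm, s⟩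

theorem exists_comp (x y : Cell K) (h : tgt x = src y) :
    ∃ z : Cell K, ∀ A B hA hB, x = cell K A hA → y = cell K B hB → Cong2 K A.tgt B.src →
      ∃ hAB, z = cell K (A ◦₂ B) hAB := by
  obtain ⟨A, hA, rfl⟩ := exists_cell x
  obtain ⟨B, hB, rfl, e⟩ := exists_composable hA y h
  refine ⟨cell K (A ◦₂ B) ⟨⟨hA.1, hB.1, e⟩, hA.2⟩, fun A' B' hA' hB' hx hy e' => ?_⟩
  rw [cell_eq] at hx hy
  exact ⟨⟨⟨hA'.1, hB'.1, e'⟩, hA'.2⟩, cell_eq.2 (.comp hx hy e e')⟩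

/-- The composite: if `A` and `B` are representatives (unique up to permutations, and chosen by
applying permutations) such that `tgt A = src B`, it is the class of `A ◦₂ B`. -/
noncomputable def comp (x y : Cell K) (h : tgt x = src y) : Cell K := (exists_comp x y h).choose

theorem comp_cell {A B : T3} (hA : A.WF K ∧ A.src.cod = 1) (hB : B.WF K ∧ B.src.cod = 1)
    (e : Cong2 K A.tgt B.src) (h : tgt (cell K A hA) = src (cell K B hB)) :
    comp (cell K A hA) (cell K B hB) h = cell K (A ◦₂ B) ⟨⟨hA.1, hB.1, e⟩, hA.2⟩ :=
  ((exists_comp _ _ h).choose_spec A B hA hB rfl rfl e).2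

/-! The product: `f ⊗ g = (f ⋆₀ g) ⋆₁ mu` on objects and `A ⊗ B = (A ⋆₀ B) ⋆₁ mu` on morphisms,
i.e. the functor that the algebra associates with `mu`. -/

/-- Algebraic 3-cells. -/
def Alg (K : T3 → Prop) (A : T3) : Prop := A.WF K ∧ A.src.cod = 1

def prod (A B : T3) : T3 := (A ◦₀ B) ◦₁ M

theorem Alg.prod {A B : T3} (hA : Alg K A) (hB : Alg K B) : Alg K (prod A B) :=
  ⟨⟨⟨hA.1, hB.1⟩, trivial, congrArg₂ (· + ·) hA.2 hB.2⟩, rfl⟩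

theorem prod_cong {A A' B B' : T3} (hA : Alg K A) (hB : Alg K B) (h : Cong3 K A A')
    (k : Cong3 K B B') : Cong3 K (prod A B) (prod A' B') :=
  (h.tens k).comp₁ (.refl trivial) (congrArg₂ (· + ·) hA.2 hB.2)

theorem prod_comp {A B C D : T3} (hA : Alg K A) (hB : Alg K B) (hC : Alg K C) (hD : Alg K D)
    (e : Cong2 K A.tgt B.src) (e' : Cong2 K C.tgt D.src) :
    Cong3 K (prod (A ◦₂ B) (C ◦₂ D)) (prod A C ◦₂ prod B D) := by
  have hM : M.WF K := trivial
  have u : (A ◦₀ C).src.cod = M.src.dom := congrArg₂ (· + ·) hA.2 hC.2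
  exact ((Cong3.exchange₀₂ hA.1 hB.1 hC.1 hD.1 e e').comp₁ (Cong3.comp₂_id (A := M) hM).symm
    u).trans (.exchange₁₂ ⟨hA.1, hC.1⟩ ⟨hB.1, hD.1⟩ hM hM (e.tens e') (.refl hM) u)

theorem CellEq.alg {A B : T3} (h : CellEq K A B) (hA : Alg K A) : Alg K B :=
  ⟨h.facts.2.1, h.facts.2.2.1.cod_eq.symm.trans hA.2⟩

theorem Alg.tgt {A : T3} (hA : Alg K A) : Alg K (.id A.tgt) :=
  ⟨hA.1.facts.2.1, hA.1.facts.2.2.2.symm.trans hA.2⟩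

theorem prod_comp_left {A B C : T3} (hA : Alg K A) (hB : Alg K B) (hC : Alg K C)
    (e : Cong2 K A.tgt B.src) :
    Cong3 K (prod (A ◦₂ B) C) (prod A C ◦₂ prod B (.id C.tgt)) :=
  have w : (A ◦₂ B).WF K := ⟨hA.1, hB.1, e⟩
  (prod_cong ⟨w, hA.2⟩ hC (.refl w) (.symm (.comp₂_id hC.1))).trans
    (prod_comp hA hB hC hC.tgt e (.refl hC.1.facts.2.1))

theorem prod_comp_right {A B C : T3} (hA : Alg K A) (hB : Alg K B) (hC : Alg K C)
    (e : Cong2 K A.tgt B.src) :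
    Cong3 K (prod C (A ◦₂ B)) (prod C A ◦₂ prod (.id C.tgt) B) :=
  have w : (A ◦₂ B).WF K := ⟨hA.1, hB.1, e⟩
  (prod_cong hC ⟨w, hA.2⟩ (.symm (.comp₂_id hC.1)) (.refl w)).trans
    (prod_comp hC hC.tgt hA hB (.refl hC.1.facts.2.1) e)

theorem prod_perm {σ τ : T2} {A B : T3} (p : IsPerm σ) (q : σ.WF) (r : σ.cod = A.src.dom)
    (p' : IsPerm τ) (q' : τ.WF) (r' : τ.cod = B.src.dom) (hA : Alg K A) (hB : Alg K B) :
    CellEq K (prod (.id σ ◦₁ A) (.id τ ◦₁ B)) (prod A B) := by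
  have u : (A ◦₀ B).src.cod = M.src.dom := congrArg₂ (· + ·) hA.2 hB.2
  have v : (σ ⋆₀ τ).cod = (A ◦₀ B).src.dom := congrArg₂ (· + ·) r r'
  have hM : M.WF K := trivial
  have w : (A ◦₀ B).WF K := ⟨hA.1, hB.1⟩
  have k1 : Cong3 K ((.id σ ◦₁ A) ◦₀ (.id τ ◦₁ B)) (.id (σ ⋆₀ τ) ◦₁ (A ◦₀ B)) :=
    (Cong3.exchange₀₁ (A := .id σ) (C := .id τ) q hA.1 q' hB.1 r r').trans
      (.comp₁ (.id_tens_id q q') (.refl w) v)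
  have k2 : Cong3 K (prod (.id σ ◦₁ A) (.id τ ◦₁ B)) (.id (σ ⋆₀ τ) ◦₁ prod A B) :=
    (k1.comp₁ (.refl hM) u).trans
      (Cong3.comp₁_assoc (A := .id (σ ⋆₀ τ)) ⟨q, q'⟩ ⟨hA.1, hB.1⟩ hM v u)
  exact (CellEq.of_cong k2).trans (.perm ⟨p, p'⟩ ⟨q, q'⟩ (hA.prod hB).1 v)

theorem CellEq.prod_left {A A' C : T3} (h : CellEq K A A') (hA : Alg K A) (hC : Alg K C) :
    CellEq K (prod A C) (prod A' C) := by
  induction h generalizing C with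
  | of_cong h => exact .of_cong (prod_cong hA hC h (.refl hC.1))
  | @perm σ A p q w e =>
    have hA' : Alg K A := ⟨w, hA.2⟩
    exact (CellEq.of_cong (prod_cong hA hC (.refl hA.1) (.symm (.id_comp₁ hC.1)))).trans
      (prod_perm p q e (τ := .id C.src.dom) trivial trivial rfl hA' hC)
  | symm h ih => exact (ih (h.symm.alg hA) hC).symm
  | trans h k ih ih' => exact (ih hA hC).trans (ih' (h.alg hA) hC)
  | @comp A A' B B' h k e e' ih ih' =>
    have hA' : Alg K A := ⟨hA.1.1, hA.2⟩
    have hB : Alg K B := ⟨hA.1.2.1, e.cod_eq.symm.trans (hA'.tgt).2⟩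
    refine (CellEq.of_cong (prod_comp_left hA' hB hC e)).trans
      ((CellEq.comp (ih hA' hC) (ih' hB hC.tgt) ?_ ?_).trans
      (.of_cong (prod_comp_left (h.alg hA') (k.alg hB) hC e').symm))
    · exact (e.tens (.refl hC.1.facts.2.1)).comp (.refl trivial)
        (congrArg₂ (· + ·) hA'.tgt.2 hC.tgt.2)
    · exact (e'.tens (.refl hC.1.facts.2.1)).comp (.refl trivial)
        (congrArg₂ (· + ·) (h.alg hA').tgt.2 hC.tgt.2)

theorem CellEq.prod_right {A A' C : T3} (h : CellEq K A A') (hA : Alg K A) (hC : Alg K C) :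
    CellEq K (prod C A) (prod C A') := by
  induction h generalizing C with
  | of_cong h => exact .of_cong (prod_cong hC hA (.refl hC.1) h)
  | @perm σ A p q w e =>
    have hA' : Alg K A := ⟨w, hA.2⟩
    exact (CellEq.of_cong (prod_cong hC hA (.symm (.id_comp₁ hC.1)) (.refl hA.1))).trans
      (prod_perm (σ := .id C.src.dom) trivial trivial rfl p q e hC hA')
  | symm h ih => exact (ih (h.symm.alg hA) hC).symm
  | trans h k ih ih' => exact (ih hA hC).trans (ih' (h.alg hA) hC)
  | @comp A A' B B' h k e e' ih ih' =>
    have hA' : Alg K A := ⟨hA.1.1, hA.2⟩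
    have hB : Alg K B := ⟨hA.1.2.1, e.cod_eq.symm.trans (hA'.tgt).2⟩
    refine (CellEq.of_cong (prod_comp_right hA' hB hC e)).trans
      ((CellEq.comp (ih hA' hC) (ih' hB hC.tgt) ?_ ?_).trans
      (.of_cong (prod_comp_right (h.alg hA') (k.alg hB) hC e').symm))
    · exact (Cong.tens (.refl hC.1.facts.2.1) e).comp (.refl trivial)
        (congrArg₂ (· + ·) hC.tgt.2 hA'.tgt.2)
    · exact (Cong.tens (.refl hC.1.facts.2.1) e').comp (.refl trivial)
        (congrArg₂ (· + ·) hC.tgt.2 (h.alg hA').tgt.2)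

theorem CellEq.prod {A A' B B' : T3} (h : CellEq K A A') (k : CellEq K B B') (hA : Alg K A)
    (hB : Alg K B) : CellEq K (prod A B) (prod A' B') :=
  (h.prod_left hA hB).trans (k.prod_right hB (h.alg hA))

theorem ObEq.prod {f f' g g' : T2} (h : ObEq K f f') (k : ObEq K g g') (hf : f.cod = 1)
    (hg : g.cod = 1) : ObEq K ((f ⋆₀ g) ⋆₁ mu) ((f' ⋆₀ g') ⋆₁ mu) :=
  (h.id.prod k.id ⟨h.wf.1, hf⟩ ⟨k.wf.1, hg⟩).facts.2.2.1

def tens : Cell K → Cell K → Cell K :=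
  Quotient.map₂ (fun A B => ⟨prod A.1 B.1, Alg.prod A.2 B.2⟩)
    fun A _ h B _ k => CellEq.prod h k A.2 B.2

def obTens : Ob K → Ob K → Ob K :=
  Quotient.map₂ (fun f g => ⟨(f.1 ⋆₀ g.1) ⋆₁ mu,
      ⟨⟨f.2.1, g.2.1⟩, trivial, congrArg₂ (· + ·) f.2.2 g.2.2⟩, rfl⟩)
    fun f _ h g _ k => ObEq.prod h k f.2.2 g.2.2

/-! From now on, the 3-cells of monoidal categories are collapsed. -/

theorem collapse_gen (g : BrGen3) (h : (T3.gen g).IsMon) :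
    Cong2 MonCell (T3.gen g).src (T3.gen g).tgt := by
  have w : (T3.gen g).WF MonCell := trivial
  exact .of (.collapse (.gen g) ⟨trivial, h⟩) w.facts.1 w.facts.2.1 w.facts.2.2.1 w.facts.2.2.2

theorem comp₁_one {A : T3} (hA : Alg K A) : Cong3 K (A ◦₁ I) A := by
  have := Cong3.comp₁_id hA.1
  rw [hA.2] at this
  exact this

theorem prod_mul_left {X C : T3} (hX : X.WF K) (e : X.src.cod = 2) (hC : Alg K C) :
    Cong3 K (prod (X ◦₁ M) C) ((X ◦₀ C) ◦₁ .id ((mu ⋆₀ one) ⋆₁ mu)) := by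
  have hM : M.WF K := trivial
  have hI : I.WF K := trivial
  have wm : mu.WF := trivial
  have wo : one.WF := trivial
  have w : (X ◦₁ M).WF K := ⟨hX, hM, e⟩
  have w' : (X ◦₀ C).WF K := ⟨hX, hC.1⟩
  have k1 : Cong3 K ((X ◦₁ M) ◦₀ C) ((X ◦₀ C) ◦₁ (M ◦₀ I)) :=
    (Cong3.tens (.refl w) (comp₁_one hC).symm).trans
      (.exchange₀₁ hX hM hC.1 hI e hC.2)
  have k2 : Cong3 K ((M ◦₀ I) ◦₁ M) (.id ((mu ⋆₀ one) ⋆₁ mu)) :=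
    ((Cong3.id_tens_id wm wo).comp₁ (.refl hM) rfl).trans
      (.id_comp₁_id (f := mu ⋆₀ one) ⟨wm, wo⟩ wm rfl)
  have u : (X ◦₀ C).src.cod = 3 := congrArg₂ (· + ·) e hC.2
  exact (k1.comp₁ (.refl hM) (congrArg (1 + ·) hC.2)).trans ((Cong3.comp₁_assoc (A := X ◦₀ C) (B := M ◦₀ I)
    ⟨hX, hC.1⟩ ⟨hM, hI⟩ hM u rfl).trans ((Cong3.refl w').comp₁ k2 u))

theorem prod_mul_right {X C : T3} (hX : X.WF K) (e : X.src.cod = 2) (hC : Alg K C) :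
    Cong3 K (prod C (X ◦₁ M)) ((C ◦₀ X) ◦₁ .id ((one ⋆₀ mu) ⋆₁ mu)) := by
  have hM : M.WF K := trivial
  have hI : I.WF K := trivial
  have wm : mu.WF := trivial
  have wo : one.WF := trivial
  have w : (X ◦₁ M).WF K := ⟨hX, hM, e⟩
  have w' : (C ◦₀ X).WF K := ⟨hC.1, hX⟩
  have k1 : Cong3 K (C ◦₀ (X ◦₁ M)) ((C ◦₀ X) ◦₁ (I ◦₀ M)) :=
    (Cong3.tens (comp₁_one hC).symm (.refl w)).trans
      (.exchange₀₁ hC.1 hI hX hM hC.2 e)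
  have k2 : Cong3 K ((I ◦₀ M) ◦₁ M) (.id ((one ⋆₀ mu) ⋆₁ mu)) :=
    ((Cong3.id_tens_id wo wm).comp₁ (.refl hM) rfl).trans
      (.id_comp₁_id (f := one ⋆₀ mu) ⟨wo, wm⟩ wm rfl)
  have u : (C ◦₀ X).src.cod = 3 := congrArg₂ (· + ·) hC.2 e
  exact (k1.comp₁ (.refl hM) (congrArg (· + 1) hC.2)).trans ((Cong3.comp₁_assoc (A := C ◦₀ X) (B := I ◦₀ M)
    ⟨hC.1, hX⟩ ⟨hI, hM⟩ hM u rfl).trans ((Cong3.refl w').comp₁ k2 u))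

theorem prod_assoc {A B C : T3} (hA : Alg MonCell A) (hB : Alg MonCell B) (hC : Alg MonCell C) :
    Cong3 MonCell (prod (prod A B) C) (prod A (prod B C)) :=
  (prod_mul_left (X := A ◦₀ B) ⟨hA.1, hB.1⟩ (congrArg₂ (· + ·) hA.2 hB.2) hC).trans
    (((Cong3.tens_assoc hA.1 hB.1 hC.1).comp₁ (.id (collapse_gen .alpha trivial))
      (congrArg₂ (· + ·) (congrArg₂ (· + ·) hA.2 hB.2) hC.2)).trans
    (prod_mul_right (X := B ◦₀ C) ⟨hB.1, hC.1⟩ (congrArg₂ (· + ·) hB.2 hC.2) hA).symm)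

theorem eta_prod {A : T3} (hA : Alg MonCell A) : Cong3 MonCell (prod E A) A := by
  have hM : M.WF MonCell := trivial
  have hI : I.WF MonCell := trivial
  have hE : E.WF MonCell := trivial
  have hZ : (T3.id (.id 0)).WF MonCell := trivial
  have k1 : Cong3 MonCell (E ◦₀ A) (A ◦₁ (E ◦₀ I)) :=
    (Cong3.tens (Cong3.id_comp₁ hE).symm (comp₁_one hA).symm).trans
      ((Cong3.exchange₀₁ (A := .id (.id 0)) hZ hE hA.1 hI rfl hA.2).trans
        (.comp₁ (.id_tens hA.1) (.refl ⟨hE, hI⟩) ((Nat.zero_add _).trans hA.2)))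
  have k2 : Cong3 MonCell ((E ◦₀ I) ◦₁ M) I :=
    ((Cong3.id_tens_id (f := eta) (g := one) trivial trivial).comp₁ (.refl hM) rfl).trans
      ((Cong3.id_comp₁_id (f := eta ⋆₀ one) (g := mu) ⟨trivial, trivial⟩ trivial rfl).trans
        (.id (collapse_gen .lambda trivial)))
  exact (k1.comp₁ (.refl hM) (congrArg (1 + ·) hA.2)).trans ((Cong3.comp₁_assoc (B := E ◦₀ I) hA.1 ⟨hE, hI⟩ hM hA.2
    rfl).trans (((Cong3.refl hA.1).comp₁ k2 hA.2).trans (comp₁_one hA)))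

theorem prod_eta {A : T3} (hA : Alg MonCell A) : Cong3 MonCell (prod A E) A := by
  have hM : M.WF MonCell := trivial
  have hI : I.WF MonCell := trivial
  have hE : E.WF MonCell := trivial
  have hZ : (T3.id (.id 0)).WF MonCell := trivial
  have k1 : Cong3 MonCell (A ◦₀ E) (A ◦₁ (I ◦₀ E)) :=
    (Cong3.tens (comp₁_one hA).symm (Cong3.id_comp₁ hE).symm).trans
      ((Cong3.exchange₀₁ (C := .id (.id 0)) hA.1 hI hZ hE hA.2 rfl).trans
        (.comp₁ (.tens_id hA.1) (.refl ⟨hI, hE⟩) hA.2))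
  have k2 : Cong3 MonCell ((I ◦₀ E) ◦₁ M) I :=
    ((Cong3.id_tens_id (f := one) (g := eta) trivial trivial).comp₁ (.refl hM) rfl).trans
      ((Cong3.id_comp₁_id (f := one ⋆₀ eta) (g := mu) ⟨trivial, trivial⟩ trivial rfl).trans
        (.id (collapse_gen .rho trivial)))
  exact (k1.comp₁ (.refl hM) (congrArg (· + 1) hA.2)).trans ((Cong3.comp₁_assoc (B := I ◦₀ E) hA.1 ⟨hI, hE⟩ hM hA.2
    rfl).trans (((Cong3.refl hA.1).comp₁ k2 hA.2).trans (comp₁_one hA)))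

/-- Objects form a monoid, with unit `eta` and product `(f ⋆₀ g) ⋆₁ mu`. -/
@[reducible] def obAddMonoid : AddMonoid (Ob MonCell) where
  add := obTens
  zero := ob MonCell eta ⟨trivial, rfl⟩
  add_assoc x y z := by
    obtain ⟨f, hf, rfl⟩ := exists_ob x
    obtain ⟨g, hg, rfl⟩ := exists_ob y
    obtain ⟨h, hh, rfl⟩ := exists_ob z
    exact ob_eq.2 (.of_cong
      (prod_assoc (A := .id f) (B := .id g) (C := .id h) hf hg hh).parallel.2.2.1)
  zero_add x := by
    obtain ⟨f, hf, rfl⟩ := exists_ob x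
    exact ob_eq.2 (.of_cong (eta_prod (A := .id f) hf).parallel.2.2.1)
  add_zero x := by
    obtain ⟨f, hf, rfl⟩ := exists_ob x
    exact ob_eq.2 (.of_cong (prod_eta (A := .id f) hf).parallel.2.2.1)
  nsmul := @nsmulRec _ ⟨ob MonCell eta ⟨trivial, rfl⟩⟩ ⟨obTens⟩

end Initial

open T2 T3 Initial in
/-- The underlying category of the initial algebra of the quotient, by the 3-cells of monoidal
categories, of the track 3-prop of braided monoidal categories, with its strict monoidal
structure. -/
noncomputable def BOne : TwoMonoid where
  C1 := Ob MonCell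
  C2 := Cell MonCell
  addMonoid := obAddMonoid
  src := src
  tgt := tgt
  id := ident
  comp := comp
  tens := tens
  src_id x := by
    obtain ⟨f, hf, rfl⟩ := exists_ob x
    rfl
  tgt_id x := by
    obtain ⟨f, hf, rfl⟩ := exists_ob x
    rfl
  src_comp x y h := by
    obtain ⟨A, hA, rfl⟩ := exists_cell x
    obtain ⟨B, hB, rfl, e⟩ := exists_composable hA y h
    rw [comp_cell hA hB e]; rfl
  tgt_comp x y h := by
    obtain ⟨A, hA, rfl⟩ := exists_cell x
    obtain ⟨B, hB, rfl, e⟩ := exists_composable hA y h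
    rw [comp_cell hA hB e]; rfl
  src_tens x y := by
    obtain ⟨A, hA, rfl⟩ := exists_cell x
    obtain ⟨B, hB, rfl⟩ := exists_cell y
    rfl
  tgt_tens x y := by
    obtain ⟨A, hA, rfl⟩ := exists_cell x
    obtain ⟨B, hB, rfl⟩ := exists_cell y
    rfl
  id_comp x := by
    obtain ⟨A, hA, rfl⟩ := exists_cell x
    exact (comp_cell (A := .id A.src) ⟨hA.1.facts.1, hA.2⟩ hA (.refl hA.1.facts.1) rfl).trans
      (cell_eq.2 (.of_cong (.id_comp₂ hA.1)))
  comp_id x := by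
    obtain ⟨A, hA, rfl⟩ := exists_cell x
    exact (comp_cell (B := .id A.tgt) hA (Alg.tgt hA) (.refl hA.1.facts.2.1) rfl).trans
      (cell_eq.2 (.of_cong (.comp₂_id hA.1)))
  comp_assoc x y z h k := by
    obtain ⟨A, hA, rfl⟩ := exists_cell x
    obtain ⟨B, hB, rfl, e⟩ := exists_composable hA y h
    obtain ⟨C, hC, rfl, e'⟩ := exists_composable hB z k
    simp only [comp_cell hA hB e h, comp_cell hB hC e' k]
    exact (comp_cell (A := A ◦₂ B) ⟨⟨hA.1, hB.1, e⟩, hA.2⟩ hC e' _).trans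
      ((cell_eq.2 (.of_cong (.comp₂_assoc hA.1 hB.1 hC.1 e e'))).trans
      (comp_cell (B := B ◦₂ C) hA ⟨⟨hB.1, hC.1, e'⟩, hB.2⟩ e _).symm)
  id_tens_id x y := by
    obtain ⟨f, hf, rfl⟩ := exists_ob x
    obtain ⟨g, hg, rfl⟩ := exists_ob y
    have u : (f ⋆₀ g).cod = 2 := congrArg₂ (· + ·) hf.2 hg.2
    have hM : M.WF MonCell := trivial
    exact cell_eq.2 (.of_cong (((Cong3.id_tens_id hf.1 hg.1).comp₁ (.refl hM) u).trans
      (Cong3.id_comp₁_id (f := f ⋆₀ g) (g := mu) ⟨hf.1, hg.1⟩ trivial u)))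
  interchange x y z w h k := by
    obtain ⟨A, hA, rfl⟩ := exists_cell x
    obtain ⟨B, hB, rfl, e⟩ := exists_composable hA y h
    obtain ⟨C, hC, rfl⟩ := exists_cell z
    obtain ⟨D, hD, rfl, e'⟩ := exists_composable hC w k
    simp only [comp_cell hA hB e h, comp_cell hC hD e' k]
    refine (cell_eq.2 (.of_cong (prod_comp hA hB hC hD e e'))).trans
      (comp_cell (A := prod A C) (B := prod B D) (Alg.prod hA hC) (Alg.prod hB hD) ?_ _).symm
    exact (e.tens e').comp (.refl trivial)
      (congrArg₂ (· + ·) (Alg.tgt hA).2 (Alg.tgt hC).2)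
  tens_assoc x y z := by
    obtain ⟨A, hA, rfl⟩ := exists_cell x
    obtain ⟨B, hB, rfl⟩ := exists_cell y
    obtain ⟨C, hC, rfl⟩ := exists_cell z
    exact cell_eq.2 (.of_cong (prod_assoc hA hB hC))
  id_zero_tens x := by
    obtain ⟨A, hA, rfl⟩ := exists_cell x
    exact cell_eq.2 (.of_cong (eta_prod hA))
  tens_id_zero x := by
    obtain ⟨A, hA, rfl⟩ := exists_cell x
    exact cell_eq.2 (.of_cong (prod_eta hA))

/-- The morphisms of `BOne` given by `β` and by its inverse. -/
def betaCell : BOne.C2 := Initial.cell MonCell T3.β ⟨trivial, rfl⟩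
def betaInvCell : BOne.C2 := Initial.cell MonCell T3.β.inv ⟨trivial, rfl⟩

/-- The object of `BOne` given by an algebraic 2-cell `f : n ⇒ 1`. -/
def algOb (f : T2) (h : f.WF ∧ f.cod = 1) : BOne.C1 := Initial.ob MonCell f h

/-!
The isomorphism is obtained from two maps between the morphisms of `BOne` and braids.

*From braids to `BOne`.* In the quotient by the 3-cells of monoidal categories the two hexagons
lose their occurrences of `α` (`Initial.hexagon_left_cong`, `Initial.hexagon_right_cong`), and a
permutation of the inputs of an algebraic 3-cell is invisible. Hence the 3-cell `β`, with its inputs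
filled by two objects, is a braiding on the strict monoidal category `BOne`
(`BOne.braiding_natural`, `BOne.hexagon_left`, `BOne.hexagon_right`). Naturality of the braiding at
`β` itself is the braid relation (`BOne.beta_yang_baxter`), so sending the crossings to `β` and
`β⁻` defines a strict monoidal functor `BOne.ofBraid`. The order of compositions is reversed here
because the braid category that occurs is the opposite one.

*From `BOne` to braids.* The category of braids, with its standard braiding `Braids.cross`, is a
strict monoidal category in which the unit and associativity 3-cells are identities, hence a model:
a 2-cell `n ⇒ 1` acts on `n`-tuples of braids by a permuted sum (`Model.eval2`), a 3-cell acts by a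
natural transformation (`Model.eval3`), and equal 3-cells act in the same way
(`Model.eval3_cong`). Evaluating a 3-cell `n ⇒ 1` at the tuple `(1, …, 1)` of generating objects
gives a braid on `n` strands. A constant tuple is fixed by permutations, so that this braid depends
only on the class of the 3-cell in `BOne` (`Model.component_eq`); this defines `BOne.toBraid`.

*They are inverse to each other.* `BOne.toBraid_ofBraid` is checked on the generating braids. It
remains to see that every morphism of `BOne` comes from a braid (`BOne.isBraid`). For this one shows,
by induction on a 3-cell `A : f ⇛ g : n ⇒ m`, that whenever an `n`-tuple of algebraic 3-cells coming
from braids is put on the inputs of `A`, the result is, up to permutation, an `m`-tuple of algebraic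
3-cells coming from braids (`BOne.absorbs`). The symmetry only exchanges the members of a tuple
(`Initial.tens_tau`), and the case of `β` reduces to the braidings of two objects, which the
hexagons decompose into crossings (`BOne.isBraid_braiding`). The case of identities shows at the
same time that every object is a power of the generating one (`BOne.algOb_eq_nsmul`).
-/

/-! ### Total operations on the 2-cells of a strict monoidal category -/

namespace TwoMonoid

variable {M : TwoMonoid}

/-- The 2-cells form a monoid for the product of 2-cells, written additively. -/
instance : AddMonoid M.C2 where
  add := M.tens
  zero := M.id 0
  add_assoc := M.tens_assoc
  zero_add := M.id_zero_tens
  add_zero := M.tens_id_zero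
  nsmul := @nsmulRec _ ⟨M.id 0⟩ ⟨M.tens⟩

open Classical in
/-- The composition of 2-cells, written multiplicatively and made total: the product of two
2-cells that are not composable is the first one. -/
noncomputable instance : Mul M.C2 where
  mul x y := if h : M.tgt x = M.src y then M.comp x y h else x

theorem tens_eq_add (x y : M.C2) : M.tens x y = x + y := rfl

theorem comp_eq_mul {x y : M.C2} (h : M.tgt x = M.src y) : M.comp x y h = x * y :=
  (dif_pos h).symm

theorem src_add (x y : M.C2) : M.src (x + y) = M.src x + M.src y := M.src_tens x y

theorem tgt_add (x y : M.C2) : M.tgt (x + y) = M.tgt x + M.tgt y := M.tgt_tens x y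

theorem src_mul (x y : M.C2) : M.src (x * y) = M.src x := by
  by_cases h : M.tgt x = M.src y
  · rw [← comp_eq_mul h, M.src_comp]
  · exact congrArg M.src (dif_neg h)

theorem tgt_mul {x y : M.C2} (h : M.tgt x = M.src y) : M.tgt (x * y) = M.tgt y := by
  rw [← comp_eq_mul h, M.tgt_comp]

theorem id_mul {a : M.C1} {x : M.C2} (h : M.src x = a) : M.id a * x = x := by
  subst h
  rw [← comp_eq_mul (M.tgt_id _), M.id_comp]

theorem mul_id {a : M.C1} {x : M.C2} (h : M.tgt x = a) : x * M.id a = x := by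
  subst h
  rw [← comp_eq_mul (M.src_id _).symm, M.comp_id]

theorem mul_assoc_of {x y z : M.C2} (h : M.tgt x = M.src y) (k : M.tgt y = M.src z) :
    x * y * z = x * (y * z) := by
  have := M.comp_assoc x y z h k
  simpa only [comp_eq_mul] using this

theorem id_add_id (a b : M.C1) : M.id a + M.id b = M.id (a + b) := M.id_tens_id a b

theorem add_mul_add_of {x y z w : M.C2} (h : M.tgt x = M.src y) (k : M.tgt z = M.src w) :
    (x + z) * (y + w) = x * y + z * w := by
  have := M.interchange x y z w h k
  simp only [comp_eq_mul, tens_eq_add] at this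
  exact this.symm

/-- A 2-cell has at most one inverse. -/
theorem inverse_unique {x y z : M.C2} (hy' : M.tgt y = M.src x)
    (hz : M.src z = M.tgt x) (h : y * x = M.id (M.tgt x)) (k : x * z = M.id (M.src x)) :
    y = z := by
  rw [← mul_id hy', ← k, ← mul_assoc_of hy' hz.symm, h, id_mul hz]

end TwoMonoid

/-! ### Braids -/

/-- Braids, composed in the order of the opposite of the 2-pro of braids. -/
noncomputable def Braids : TwoMonoid := BrdPro.op

namespace Braids

open TwoMonoid

/-- The number of strands of a braid. -/
noncomputable def deg (x : Braids.C2) : ℕ := Braids.src x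

/-- The trivial braid on `n` strands. -/
noncomputable def strand (n : ℕ) : Braids.C2 := Braids.id (show ℕ from n)

noncomputable def pos : Braids.C2 := positiveCrossing
noncomputable def neg : Braids.C2 := negativeCrossing

/-- The class of a term. -/
noncomputable def mk (t : Term crossingSig) (h : t.WF) : Braids.C2 := Presented.mk Brd.Rel t h

theorem dom_eq_cod {t : Term crossingSig} (h : t.WF) : t.dom = t.cod := by
  induction t with
  | gen g => rfl
  | id n => rfl
  | tens f g hf hg => exact congrArg₂ (· + ·) (hf h.1) (hg h.2)
  | comp f g hf hg => exact (hf h.1).trans (h.2.2.trans (hg h.2.1))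

theorem exists_mk (x : Braids.C2) : ∃ t h, x = mk t h := Presented.exists_mk x

theorem deg_mk {t : Term crossingSig} (h : t.WF) : deg (mk t h) = t.dom := (dom_eq_cod h).symm

theorem tgt_eq (x : Braids.C2) : Braids.tgt x = Braids.src x := by
  obtain ⟨t, h, rfl⟩ := exists_mk x
  exact dom_eq_cod h

@[simp] theorem deg_add (x y : Braids.C2) : deg (x + y) = deg x + deg y := src_add x y
@[simp] theorem deg_mul (x y : Braids.C2) : deg (x * y) = deg x := src_mul x y
@[simp] theorem deg_strand (n : ℕ) : deg (strand n) = n := rfl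
@[simp] theorem deg_zero : deg 0 = 0 := rfl
@[simp] theorem deg_pos : deg pos = 2 := rfl
@[simp] theorem deg_neg : deg neg = 2 := rfl

theorem strand_zero : strand 0 = 0 := rfl

theorem composable {x y : Braids.C2} (h : deg x = deg y) : Braids.tgt x = Braids.src y :=
  (tgt_eq x).trans h

theorem strand_mul {n : ℕ} {x : Braids.C2} (h : deg x = n := by (try simp) <;> omega) :
    strand n * x = x := id_mul h

theorem mul_strand {n : ℕ} {x : Braids.C2} (h : deg x = n := by (try simp) <;> omega) :
    x * strand n = x :=
  mul_id ((tgt_eq x).trans h)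

theorem strand_add_strand (m n : ℕ) : strand m + strand n = strand (m + n) :=
  id_add_id (M := Braids) (show ℕ from m) (show ℕ from n)

theorem mul_assoc {x y z : Braids.C2} (h : deg x = deg y := by (try simp) <;> omega)
    (k : deg y = deg z := by (try simp) <;> omega) :
    x * y * z = x * (y * z) := mul_assoc_of (composable h) (composable k)

theorem add_mul_add {x y z w : Braids.C2} (h : deg x = deg y := by (try simp) <;> omega)
    (k : deg z = deg w := by (try simp) <;> omega) :
    (x + z) * (y + w) = x * y + z * w := add_mul_add_of (composable h) (composable k)

/-- Braids are composed in the opposite order of terms. -/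
theorem mk_mul {s t : Term crossingSig} (hs : s.WF) (ht : t.WF) (h : s.cod = t.dom) :
    mk t ht * mk s hs = mk (s ⋆₁ t) ⟨hs, ht, h⟩ :=
  (comp_eq_mul (M := Braids) (x := mk t ht) (y := mk s hs) h.symm).symm.trans
    (Presented.comp_mk hs ht h)

@[elab_as_elim]
theorem induction {p : Braids.C2 → Prop} (x : Braids.C2) (hpos : p pos) (hneg : p neg)
    (hstrand : ∀ n, p (strand n)) (hadd : ∀ x y, p x → p y → p (x + y))
    (hmul : ∀ x y, deg x = deg y → p x → p y → p (x * y)) : p x := by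
  obtain ⟨t, h, rfl⟩ := exists_mk x
  induction t with
  | gen g =>
    cases g
    · exact hpos
    · exact hneg
  | id n => exact hstrand n
  | tens f g hf hg => exact hadd _ _ (hf h.1) (hg h.2)
  | comp f g hf hg =>
    rw [← mk_mul h.1 h.2.1 h.2.2]
    refine hmul _ _ ?_ (hg h.2.1) (hf h.1)
    rw [deg_mk, deg_mk, dom_eq_cod h.1, h.2.2]

theorem pos_mul_neg : pos * neg = strand 2 :=
  (mk_mul (s := Brd.neg) (t := Brd.pos) trivial trivial rfl).trans
    (Presented.mk_eq.2 (.of .neg_pos ⟨trivial, trivial, rfl⟩ trivial rfl rfl))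

theorem neg_mul_pos : neg * pos = strand 2 :=
  (mk_mul (s := Brd.pos) (t := Brd.neg) trivial trivial rfl).trans
    (Presented.mk_eq.2 (.of .pos_neg ⟨trivial, trivial, rfl⟩ trivial rfl rfl))

theorem yang_baxter :
    (pos + strand 1) * ((strand 1 + pos) * (pos + strand 1)) =
      (strand 1 + pos) * ((pos + strand 1) * (strand 1 + pos)) := by
  have a : (Brd.pos ⋆₀ Brd.one).WF := ⟨trivial, trivial⟩
  have b : (Brd.one ⋆₀ Brd.pos).WF := ⟨trivial, trivial⟩
  have ha : pos + strand 1 = mk _ a := rfl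
  have hb : strand 1 + pos = mk _ b := rfl
  have h : Cong Brd.Rel (_ ⋆₁ _) (_ ⋆₁ _) :=
    .of .yang_baxter ⟨⟨a, b, rfl⟩, a, rfl⟩ ⟨⟨b, a, rfl⟩, b, rfl⟩ rfl rfl
  rw [ha, hb, mk_mul b a rfl, mk_mul a b rfl, mk_mul (s := _ ⋆₁ _) ⟨a, b, rfl⟩ a rfl,
    mk_mul (s := _ ⋆₁ _) ⟨b, a, rfl⟩ b rfl]
  exact Presented.mk_eq.2 h

/-! ### Inverses of braids -/

theorem exists_inverse (x : Braids.C2) :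
    ∃ y, deg y = deg x ∧ x * y = strand (deg x) ∧ y * x = strand (deg x) := by
  induction x using induction with
  | hpos => exact ⟨neg, rfl, pos_mul_neg, neg_mul_pos⟩
  | hneg => exact ⟨pos, rfl, neg_mul_pos, pos_mul_neg⟩
  | hstrand n => exact ⟨strand n, rfl, strand_mul rfl, strand_mul rfl⟩
  | hadd x y hx hy =>
    obtain ⟨x', d, h, k⟩ := hx
    obtain ⟨y', d', h', k'⟩ := hy
    refine ⟨x' + y', by simp [d, d'], ?_, ?_⟩
    · rw [add_mul_add d.symm d'.symm, h, h', strand_add_strand, deg_add]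
    · rw [add_mul_add d d', k, k', strand_add_strand, deg_add]
  | hmul x y e hx hy =>
    obtain ⟨x', d, h, k⟩ := hx
    obtain ⟨y', d', h', k'⟩ := hy
    refine ⟨y' * x', by simp [d', e], ?_, ?_⟩
    · rw [mul_assoc e (by simp [d']), ← mul_assoc d'.symm (by omega), h',
        strand_mul (by omega), h, deg_mul]
    · rw [mul_assoc (by omega) (by simp [d]), ← mul_assoc d e, k, strand_mul e.symm, k', deg_mul, e]

/-- The inverse braid. -/
noncomputable instance : Inv Braids.C2 where
  inv x := (exists_inverse x).choose

@[simp] theorem deg_inv (x : Braids.C2) : deg x⁻¹ = deg x := (exists_inverse x).choose_spec.1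

theorem mul_inv (x : Braids.C2) : x * x⁻¹ = strand (deg x) := (exists_inverse x).choose_spec.2.1

theorem inv_mul (x : Braids.C2) : x⁻¹ * x = strand (deg x) := (exists_inverse x).choose_spec.2.2

theorem inv_eq {x y : Braids.C2} (h : x * y = strand (deg x))
    (d : deg y = deg x := by (try simp) <;> omega) : x⁻¹ = y := by
  rw [← mul_strand (deg_inv x), ← h, ← mul_assoc (deg_inv x) d.symm, inv_mul, strand_mul d]

theorem inv_inv (x : Braids.C2) : x⁻¹⁻¹ = x :=
  inv_eq ((inv_mul x).trans (congrArg strand (deg_inv x).symm))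

theorem inv_strand (n : ℕ) : (strand n)⁻¹ = strand n := inv_eq (strand_mul rfl)

theorem inv_add (x y : Braids.C2) : (x + y)⁻¹ = x⁻¹ + y⁻¹ :=
  inv_eq (by rw [add_mul_add, mul_inv, mul_inv, strand_add_strand, deg_add])

theorem inv_mul_rev {x y : Braids.C2} (h : deg x = deg y) : (x * y)⁻¹ = y⁻¹ * x⁻¹ :=
  inv_eq (by rw [mul_assoc h, ← mul_assoc (x := y), mul_inv, strand_mul, mul_inv, deg_mul])

theorem strand_add_mul {n : ℕ} {x y : Braids.C2} (h : deg x = deg y := by (try simp) <;> omega) :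
    strand n + x * y = (strand n + x) * (strand n + y) := by
  rw [add_mul_add rfl h, strand_mul (n := n) rfl]

theorem mul_add_strand {n : ℕ} {x y : Braids.C2} (h : deg x = deg y := by (try simp) <;> omega) :
    x * y + strand n = (x + strand n) * (y + strand n) := by
  rw [add_mul_add h rfl, strand_mul (n := n) rfl]

/-- Braids on disjoint sets of strands commute. -/
theorem add_eq_mul {m n : ℕ} {x y : Braids.C2} (hx : deg x = m := by (try simp) <;> omega)
    (hy : deg y = n := by (try simp) <;> omega) :
    (x + strand n) * (strand m + y) = x + y := by
  rw [add_mul_add, mul_strand hx, strand_mul hy]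

theorem add_eq_mul' {m n : ℕ} {x y : Braids.C2} (hx : deg x = m := by (try simp) <;> omega)
    (hy : deg y = n := by (try simp) <;> omega) :
    (strand m + y) * (x + strand n) = x + y := by
  rw [add_mul_add, strand_mul hx, mul_strand hy]

/-! ### The braiding of the category of braids -/

/-- One strand passing over `n` strands. -/
noncomputable def crossOne : ℕ → Braids.C2
  | 0 => strand 1
  | n + 1 => (strand n + pos) * (crossOne n + strand 1)

/-- The braiding: `m` strands passing over `n` strands. -/
noncomputable def cross : ℕ → ℕ → Braids.C2
  | 0, n => strand n
  | m + 1, n => (cross m n + strand 1) * (strand m + crossOne n)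

@[simp] theorem deg_crossOne (n : ℕ) : deg (crossOne n) = n + 1 := by
  cases n <;> simp [crossOne]

@[simp] theorem deg_cross (m n : ℕ) : deg (cross m n) = m + n := by
  induction m with
  | zero => simp [cross]
  | succ m ih => simp [cross, ih]; omega

theorem crossOne_one : crossOne 1 = pos := by
  simp only [crossOne, strand_add_strand]
  rw [strand_zero, zero_add, mul_strand]

theorem cross_one (n : ℕ) : cross 1 n = crossOne n := by
  simp only [cross, strand_add_strand]
  rw [strand_zero, zero_add, strand_mul]

theorem cross_one_one : cross 1 1 = pos := by rw [cross_one, crossOne_one]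

theorem cross_zero_right (m : ℕ) : cross m 0 = strand m := by
  induction m with
  | zero => rfl
  | succ m ih => simp only [cross, ih, crossOne, strand_add_strand]; rw [strand_mul]

theorem crossOne_add (m n : ℕ) :
    crossOne (m + n) = (strand m + crossOne n) * (crossOne m + strand n) := by
  induction n with
  | zero => rw [crossOne, strand_zero, add_zero, add_zero, strand_add_strand, strand_mul]
  | succ n ih =>
    rw [← add_assoc, crossOne, ih, crossOne, mul_add_strand, strand_add_mul, mul_assoc,
      ← strand_add_strand m n, ← strand_add_strand n 1]
    simp only [add_assoc]

theorem cross_add_left (m m' n : ℕ) :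
    cross (m + m') n = (cross m n + strand m') * (strand m + cross m' n) := by
  induction m' with
  | zero => rw [cross, strand_zero, add_zero, add_zero, strand_add_strand, mul_strand]
  | succ m' ih =>
    rw [← add_assoc, cross, ih, cross, mul_add_strand, strand_add_mul,
      add_assoc, strand_add_strand, mul_assoc, ← add_assoc,
      ← add_assoc, strand_add_strand]

theorem cross_add_right (m n n' : ℕ) :
    cross m (n + n') = (strand n + cross m n') * (cross m n + strand n') := by
  induction m with
  | zero => simp only [cross, strand_add_strand]; rw [strand_mul]
  | succ m ih =>
    have e : cross m n + strand n' + strand 1 = cross m n + strand (n' + 1) := by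
      rw [add_assoc, strand_add_strand]
    have e' : strand m + (strand n + crossOne n') = strand (m + n) + crossOne n' := by
      rw [← add_assoc, strand_add_strand]
    have k : (cross m n + strand (n' + 1)) * (strand (m + n) + crossOne n') =
        (strand (n + m) + crossOne n') * (cross m n + strand (1 + n')) := by
      rw [add_eq_mul, add_comm n m, add_comm 1 n',
        add_eq_mul']
    have lhs : cross (m + 1) (n + n') = (strand n + cross m n' + strand 1) *
        ((strand (n + m) + crossOne n') * (cross m n + strand (1 + n'))) *
        (strand m + (crossOne n + strand n')) := by
      rw [cross, ih, crossOne_add, mul_add_strand, strand_add_mul,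
        e, e', mul_assoc,
        ← mul_assoc (x := cross m n + _), k,
        ← mul_assoc]
    have r1 : strand n + cross (m + 1) n' =
        (strand n + cross m n' + strand 1) * (strand (n + m) + crossOne n') := by
      rw [cross, strand_add_mul, ← add_assoc, ← add_assoc, strand_add_strand]
    have r2 : cross (m + 1) n + strand n' =
        (cross m n + strand (1 + n')) * (strand m + (crossOne n + strand n')) := by
      rw [cross, mul_add_strand, add_assoc, add_assoc, strand_add_strand]
    rw [lhs, r1, r2]
    rw [mul_assoc, mul_assoc,
      mul_assoc]

/-- If a square with invertible vertical sides commutes, so does the square of the inverses. -/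
theorem inverse_natural {a b a' b' c : Braids.C2} {n : ℕ} (h : a * c = c * b)
    (ha : a' * a = strand n) (hb : b * b' = strand n)
    (da : deg a = n := by (try simp) <;> omega) (db : deg b = n := by (try simp) <;> omega)
    (da' : deg a' = n := by (try simp) <;> omega) (db' : deg b' = n := by (try simp) <;> omega)
    (dc : deg c = n := by (try simp) <;> omega) : a' * c = c * b' := by
  rw [← mul_strand (x := a' * c) (n := n), ← hb, ← mul_assoc, mul_assoc (x := a'), ← h,
    ← mul_assoc (x := a'), ha, strand_mul dc]

theorem crossOne_natural (y : Braids.C2) :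
    (y + strand 1) * crossOne (deg y) = crossOne (deg y) * (strand 1 + y) := by
  have key : (pos + strand 1) * crossOne 2 = crossOne 2 * (strand 1 + pos) := by
    rw [crossOne, crossOne_one, mul_assoc]
    exact yang_baxter
  induction y using induction with
  | hpos => exact key
  | hneg =>
    refine inverse_natural (n := 3) key ?_ ?_
    · rw [← mul_add_strand, neg_mul_pos, strand_add_strand]
    · rw [← strand_add_mul, pos_mul_neg, strand_add_strand]
  | hstrand n =>
    rw [strand_add_strand, strand_add_strand, strand_mul, mul_strand]
  | hadd x y hx hy =>
    have h1 : (x + (y + strand 1)) * (strand (deg x) + crossOne (deg y)) =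
        (strand (deg x) + crossOne (deg y)) * (x + (strand 1 + y)) := by
      rw [add_mul_add, hy, add_mul_add, strand_mul, mul_strand]
    have h2 : (x + strand 1 + y) * (crossOne (deg x) + strand (deg y)) =
        (crossOne (deg x) + strand (deg y)) * (strand 1 + x + y) := by
      rw [add_mul_add, hx, add_mul_add, strand_mul, mul_strand]
    rw [deg_add, crossOne_add, ← mul_assoc, add_assoc, h1, mul_assoc, ← add_assoc x, h2,
      ← mul_assoc, add_assoc (strand 1)]
  | hmul x y e hx hy =>
    rw [deg_mul, mul_add_strand e, mul_assoc, e, hy, ← mul_assoc, ← e, hx,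
      mul_assoc, strand_add_mul e]

/-- The braiding is natural in its lower argument. -/
theorem cross_natural_right (m : ℕ) (y : Braids.C2) :
    (y + strand m) * cross m (deg y) = cross m (deg y) * (strand m + y) := by
  induction m with
  | zero => rw [cross, strand_zero, add_zero, zero_add, mul_strand, strand_mul]
  | succ m ih =>
    rw [cross, ← strand_add_strand, ← add_assoc, ← mul_assoc,
      ← mul_add_strand, ih, mul_add_strand,
      mul_assoc, add_assoc, ← strand_add_mul,
      crossOne_natural, strand_add_mul,
      ← mul_assoc, add_assoc]

theorem cross_natural_pos (n : ℕ) :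
    (strand n + pos) * cross 2 n = cross 2 n * (pos + strand n) := by
  induction n with
  | zero =>
    rw [cross_zero_right, strand_zero, zero_add, add_zero, strand_mul, mul_strand]
  | succ n ih =>
    have k : cross 2 1 = (pos + strand 1) * (strand 1 + pos) := by
      rw [cross, cross_one_one, crossOne_one]
    have key : (strand 1 + pos) * cross 2 1 = cross 2 1 * (pos + strand 1) := by
      rw [k, mul_assoc]
      exact yang_baxter.symm
    rw [cross_add_right, ← strand_add_strand, add_assoc, ← mul_assoc,
      ← strand_add_mul, key, strand_add_mul, mul_assoc,
      ← add_assoc, ← mul_add_strand, ih, mul_add_strand,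
      ← mul_assoc, add_assoc]

/-- The braiding is natural in its upper argument. -/
theorem cross_natural_left (n : ℕ) (x : Braids.C2) :
    (strand n + x) * cross (deg x) n = cross (deg x) n * (x + strand n) := by
  induction x using induction with
  | hpos => exact cross_natural_pos n
  | hneg =>
    refine inverse_natural (n := n + 2) (cross_natural_pos n) ?_ ?_
    · rw [← strand_add_mul, neg_mul_pos, strand_add_strand]
    · rw [← mul_add_strand, pos_mul_neg, strand_add_strand, add_comm]
  | hstrand k =>
    rw [strand_add_strand, strand_add_strand, strand_mul, mul_strand]
  | hadd x y hx hy =>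
    have h1 : (strand n + x + y) * (cross (deg x) n + strand (deg y)) =
        (cross (deg x) n + strand (deg y)) * (x + strand n + y) := by
      rw [add_mul_add, hx, add_mul_add, strand_mul, mul_strand]
    have h2 : (x + (strand n + y)) * (strand (deg x) + cross (deg y) n) =
        (strand (deg x) + cross (deg y) n) * (x + (y + strand n)) := by
      rw [add_mul_add, hy, add_mul_add, strand_mul, mul_strand]
    rw [deg_add, cross_add_left, ← mul_assoc, ← add_assoc, h1, mul_assoc, add_assoc x, h2,
      ← mul_assoc, add_assoc x]
  | hmul x y e hx hy =>
    rw [deg_mul, strand_add_mul e, mul_assoc, e, hy,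
      ← mul_assoc, ← e, hx,
      mul_assoc, mul_add_strand e]

theorem cross_natural (x y : Braids.C2) :
    (y + x) * cross (deg x) (deg y) = cross (deg x) (deg y) * (x + y) := by
  rw [← add_eq_mul (x := y) (y := x) rfl rfl, mul_assoc,
    cross_natural_left, ← mul_assoc, cross_natural_right,
    mul_assoc, add_eq_mul']

end Braids

/-! ### Evaluation of 2-cells in a monoid -/

namespace Model

open T2 T3 Braids

variable {M N : Type}

/-- Two maps of lists side by side, the first one applied to the first `m` entries. -/
def par (m : ℕ) (F G : List M → List M) (u : List M) : List M := F (u.take m) ++ G (u.drop m)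

theorem par_append {m : ℕ} (F G : List M → List M) {u v : List M} (h : u.length = m) :
    par m F G (u ++ v) = F u ++ G v := by
  subst h
  simp [par]

theorem par_assoc (m n : ℕ) (F G H : List M → List M) (u : List M) :
    par (m + n) (par m F G) H u = par m F (par n G H) u := by
  simp [par, List.take_take, List.drop_take, List.drop_drop]

theorem par_comp {m m' : ℕ} {F F' G G' : List M → List M} {u : List M}
    (h : (F (u.take m)).length = m') :
    par m (fun v => F' (F v)) (fun v => G' (G v)) u = par m' F' G' (par m F G u) :=
  (par_append F' G' h).symm

theorem par_id {m : ℕ} (F : List M → List M) {u : List M} (h : u.length = m) :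
    par m F (fun v => v) u = F u := by
  subst h
  simp [par]

theorem id_par (F : List M → List M) (u : List M) : par 0 (fun v => v) F u = F u := by
  simp [par]

theorem par_congr {m n : ℕ} {F F' G G' : List M → List M} {u : List M} (h : u.length = m + n)
    (hF : ∀ v, v.length = m → F v = F' v) (hG : ∀ v, v.length = n → G v = G' v) :
    par m F G u = par m F' G' u := by
  rw [par, par, hF _ (by simp; omega), hG _ (by simp; omega)]

/-- The action of a 2-cell on tuples of elements of a monoid: every monoid is an algebra over the
prop of 2-cells. Meaningful on tuples of the right length. -/
def eval2 [AddMonoid M] : T2 → List M → List M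
  | .gen BrGen2.mu => fun u => [u.sum]
  | .gen BrGen2.eta => fun u => [u.sum]
  | .gen BrGen2.tau => List.reverse
  | .id _ => fun u => u
  | .tens f g => par f.dom (eval2 f) (eval2 g)
  | .comp f g => fun u => eval2 g (eval2 f u)

variable [AddMonoid M] [AddMonoid N]

theorem eval2_map (φ : M →+ N) (f : T2) (u : List M) :
    eval2 f (u.map φ) = (eval2 f u).map φ := by
  induction f generalizing u with
  | gen g => cases g <;> simp [eval2, map_list_sum]
  | id n => rfl
  | tens f g hf hg => simp [eval2, par, ← List.map_take, ← List.map_drop, hf, hg]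
  | comp f g hf hg => simp [eval2, hf, hg]

theorem length_eval2 {f : T2} (w : f.WF) {u : List M} (h : u.length = f.dom) :
    (eval2 f u).length = f.cod := by
  induction f generalizing u with
  | gen g => cases g <;> first | rfl | exact List.length_reverse.trans h
  | id n => exact h
  | tens f g hf hg =>
    have h : u.length = f.dom + g.dom := h
    simp only [eval2, par, List.length_append]
    rw [hf w.1 (by simp; omega), hg w.2 (by simp; omega)]
    rfl
  | comp f g hf hg => exact hg w.2.1 ((hf w.1 h).trans w.2.2)

theorem eval2_tauL {n : ℕ} {u : List M} (h : u.length = n) (x : M) :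
    eval2 (tauL n) (u ++ [x]) = x :: u := by
  induction n generalizing u with
  | zero => rw [List.length_eq_zero_iff.1 h]; rfl
  | succ n ih =>
    obtain ⟨v, y, rfl⟩ : ∃ v y, u = v ++ [y] :=
      ⟨u.dropLast, u.getLast (by rintro rfl; simp at h), (List.dropLast_append_getLast _).symm⟩
    have hv : v.length = n := by simpa using h
    have e1 : eval2 (.id n ⋆₀ tau : T2) (v ++ [y] ++ [x]) = v ++ [x] ++ [y] := by
      rw [List.append_assoc]
      exact (par_append _ _ (v := [y, x]) hv).trans (by simp [eval2, tau])
    have e2 : eval2 (tauL n ⋆₀ one : T2) (v ++ [x] ++ [y]) = x :: (v ++ [y]) :=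
      (par_append _ _ (by simp [(tauL_facts n).2.1, hv])).trans (by rw [ih hv]; rfl)
    exact (congrArg _ e1).trans e2

theorem eval2_tauR {n : ℕ} {u : List M} (h : u.length = n) (x : M) :
    eval2 (tauR n) (x :: u) = u ++ [x] := by
  induction n generalizing u with
  | zero => rw [List.length_eq_zero_iff.1 h]; rfl
  | succ n ih =>
    obtain ⟨y, v, rfl⟩ : ∃ y v, u = y :: v := List.exists_cons_of_length_eq_add_one h
    have hv : v.length = n := by simpa using h
    have e1 : eval2 (tau ⋆₀ .id n : T2) (x :: y :: v) = y :: x :: v := rfl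
    have e2 : eval2 (one ⋆₀ tauR n : T2) (y :: x :: v) = y :: (v ++ [x]) :=
      congrArg (y :: ·) (ih hv)
    exact (congrArg _ e1).trans e2

/-- The source and the target of the 3-cells in `K` act in the same way on tuples of elements
of `M`. -/
def Collapses (M : Type) [AddMonoid M] (K : T3 → Prop) : Prop :=
  ∀ A, K A → ∀ u : List M, u.length = A.src.dom → eval2 A.src u = eval2 A.tgt u

theorem eval2_rel {K : T3 → Prop} (hK : Collapses M K) {f g : T2} (h : Rel2 K f g)
    (wf : f.WF) (wg : g.WF) {u : List M} (hu : u.length = f.dom) : eval2 f u = eval2 g u := by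
  cases h with
  | symmetry => simp [eval2, tau]
  | yang_baxter =>
    obtain ⟨x, y, z, rfl⟩ := List.length_eq_three.1 hu
    rfl
  | natL f =>
    have hu : u.length = f.dom + 1 := hu
    obtain ⟨v, y, rfl⟩ : ∃ v y, u = v ++ [y] :=
      ⟨u.dropLast, u.getLast (by rintro rfl; simp at hu), (List.dropLast_append_getLast _).symm⟩
    have hv : v.length = f.dom := by simpa using hu
    have e1 : eval2 (f ⋆₀ one) (v ++ [y]) = eval2 f v ++ [y] := par_append _ _ hv
    have e2 : eval2 (one ⋆₀ f) (y :: v) = y :: eval2 f v := rfl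
    exact (congrArg _ e1).trans ((eval2_tauL (length_eval2 wf.1.1 hv) y).trans
      (e2.symm.trans (congrArg _ (eval2_tauL hv y).symm)))
  | natR f =>
    have hu : u.length = 1 + f.dom := hu
    obtain ⟨y, v, rfl⟩ : ∃ y v, u = y :: v :=
      List.exists_cons_of_length_eq_add_one (hu.trans (add_comm _ _))
    have hv : v.length = f.dom := by simp at hu; omega
    have e1 : eval2 (one ⋆₀ f) (y :: v) = y :: eval2 f v := rfl
    have e2 : eval2 (f ⋆₀ one) (v ++ [y]) = eval2 f v ++ [y] := par_append _ _ hv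
    exact (congrArg _ e1).trans ((eval2_tauR (length_eval2 wf.1.2 hv) y).trans
      (e2.symm.trans (congrArg _ (eval2_tauR hv y).symm)))
  | collapse A hA => exact hK A hA u hu

theorem eval2_cong {K : T3 → Prop} (hK : Collapses M K) {f g : T2} (h : Cong2 K f g)
    {u : List M} (hu : u.length = f.dom) : eval2 f u = eval2 g u := by
  induction h generalizing u with
  | of r wf wg _ _ => exact eval2_rel hK r wf wg hu
  | refl _ => rfl
  | symm h ih => exact (ih (hu.trans h.dom_eq.symm)).symm
  | trans h _ ih ih' => exact (ih hu).trans (ih' (hu.trans h.dom_eq))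
  | @tens f f' g g' h k ih ih' =>
    have hu : u.length = f.dom + g.dom := hu
    simp only [eval2]
    rw [← h.dom_eq]
    exact par_congr hu (fun v hv => ih hv) (fun v hv => ih' hv)
  | @comp f f' g g' h k e ih ih' =>
    have hu : u.length = f.dom := hu
    simp only [eval2]
    rw [← ih hu, ih' ((length_eval2 h.wf_left hu).trans e)]
  | tens_assoc _ _ _ => exact par_assoc _ _ _ _ _ _
  | id_tens _ => exact id_par _ _
  | tens_id _ => exact par_id _ hu
  | id_tens_id m n => simp [eval2, par]
  | comp_assoc => rfl
  | id_comp _ => rfl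
  | comp_id _ => rfl
  | @interchange f f' g g' wf _ _ _ e _ =>
    have hu : u.length = f.dom + g.dom := hu
    have hv : (u.take f.dom).length = f.dom := by simp; omega
    exact par_comp (F' := eval2 f') (G := eval2 g) (G' := eval2 g') ((length_eval2 wf hv).trans e)

theorem eval2_mon {K : T3 → Prop} (hK : Collapses M K) {A : T3} (w : A.WF K) (hA : A.IsMon)
    {u : List M} (hu : u.length = A.src.dom) : eval2 A.src u = eval2 A.tgt u := by
  induction A generalizing u with
  | gen g =>
    cases g with
    | alpha =>
      obtain ⟨x, y, z, rfl⟩ := List.length_eq_three.1 hu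
      simp [T3.src, T3.tgt, bdry, eval2, par, mu, one, brSig, Term.dom, add_assoc]
    | lambda =>
      obtain ⟨x, rfl⟩ := List.length_eq_one_iff.1 hu
      simp [T3.src, T3.tgt, bdry, eval2, par, mu, one, eta, brSig, Term.dom]
    | rho =>
      obtain ⟨x, rfl⟩ := List.length_eq_one_iff.1 hu
      simp [T3.src, T3.tgt, bdry, eval2, par, mu, one, eta, brSig, Term.dom]
    | beta => exact hA.elim
  | id f => rfl
  | tens A B ih ih' =>
    have hu : u.length = A.src.dom + B.src.dom := hu
    refine (par_congr hu (fun v hv => ih w.1 hA.1 hv) (fun v hv => ih' w.2 hA.2 hv)).trans ?_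
    rw [w.1.facts.2.2.1]
    rfl
  | comp₁ A B ih ih' =>
    exact (congrArg _ (ih w.1 hA.1 hu)).trans (ih' w.2.1 hA.2
      ((length_eval2 w.1.facts.2.1 (Eq.trans hu w.1.facts.2.2.1)).trans
        (w.1.facts.2.2.2.symm.trans w.2.2)))
  | comp₂ A B ih ih' =>
    have hu : u.length = A.src.dom := hu
    have hu' := hu.trans w.1.facts.2.2.1
    exact (ih w.1 hA.1 hu).trans ((eval2_cong hK w.2.2 hu').trans
      (ih' w.2.1 hA.2 (hu'.trans w.2.2.dom_eq)))
  | inv A ih => exact (ih w hA (Eq.trans hu (T3.WF.facts (A := A) w).2.2.1.symm)).symm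

theorem collapses_noCell : Collapses M NoCell := fun _ h => h.elim

theorem collapses_monCell : Collapses M MonCell := fun _ h _ hu =>
  eval2_mon collapses_noCell h.1 h.2 hu

/-- In a commutative monoid, the source and the target of every 3-cell act in the same way. -/
theorem eval2_src_eq_tgt {M : Type} [AddCommMonoid M] {A : T3} (w : A.WF MonCell) {u : List M}
    (hu : u.length = A.src.dom) : eval2 A.src u = eval2 A.tgt u := by
  induction A generalizing u with
  | gen g =>
    cases g with
    | beta =>
      obtain ⟨x, y, rfl⟩ := List.length_eq_two.1 hu
      simp [T3.src, T3.tgt, bdry, eval2, tau, mu, add_comm]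
    | _ => exact eval2_mon collapses_monCell w trivial hu
  | id f => rfl
  | tens A B ih ih' =>
    have hu : u.length = A.src.dom + B.src.dom := hu
    refine (par_congr hu (fun v hv => ih w.1 hv) (fun v hv => ih' w.2 hv)).trans ?_
    rw [w.1.facts.2.2.1]
    rfl
  | comp₁ A B ih ih' =>
    exact (congrArg _ (ih w.1 hu)).trans (ih' w.2.1
      ((length_eval2 w.1.facts.2.1 (Eq.trans hu w.1.facts.2.2.1)).trans
        (w.1.facts.2.2.2.symm.trans w.2.2)))
  | comp₂ A B ih ih' =>
    have hu : u.length = A.src.dom := hu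
    have hu' := hu.trans w.1.facts.2.2.1
    exact (ih w.1 hu).trans ((eval2_cong collapses_monCell w.2.2 hu').trans
      (ih' w.2.1 (hu'.trans w.2.2.dom_eq)))
  | inv A ih => exact (ih w (Eq.trans hu (T3.WF.facts (A := A) w).2.2.1.symm)).symm

/-- Permutations fix constant tuples. -/
theorem eval2_perm {σ : T2} (p : IsPerm σ) (w : σ.WF) (x : M) :
    eval2 σ (List.replicate σ.dom x) = List.replicate σ.dom x := by
  induction σ with
  | gen g =>
    cases g with
    | tau => rfl
    | _ => exact p.elim
  | id n => rfl
  | tens f g hf hg =>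
    simp only [eval2, Term.dom, List.replicate_add]
    rw [par_append _ _ (by simp), hf p.1 w.1, hg p.2 w.2]
  | comp f g hf hg =>
    simp only [eval2, Term.dom]
    rw [hf p.1 w.1, Initial.perm_dom p.1 w.1, w.2.2, hg p.2 w.2.1]

end Model

/-! ### Tuples of braids -/

namespace Model

open T2 T3 Braids

/-- The number of strands, as a homomorphism of monoids. -/
noncomputable def degHom : Braids.C2 →+ ℕ where
  toFun := deg
  map_zero' := deg_zero
  map_add' := deg_add

/-- The identity of the source of a braid, as a homomorphism of monoids. -/
noncomputable def strandHom : Braids.C2 →+ Braids.C2 where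
  toFun x := strand (deg x)
  map_zero' := rfl
  map_add' x y := by rw [deg_add, strand_add_strand]

/-- Inverses, as a homomorphism of monoids. -/
noncomputable def invHom : Braids.C2 →+ Braids.C2 where
  toFun x := x⁻¹
  map_zero' := inv_strand 0
  map_add' := inv_add

/-- The composable pairs of braids. -/
noncomputable def composablePairs : AddSubmonoid (Braids.C2 × Braids.C2) where
  carrier := {p | deg p.1 = deg p.2}
  zero_mem' := rfl
  add_mem' {p q} hp hq := by
    have hp : deg p.1 = deg p.2 := hp
    have hq : deg q.1 = deg q.2 := hq
    simp [hp, hq]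

/-- Composition is a homomorphism of monoids on composable pairs: this is the interchange law. -/
noncomputable def mulHom : composablePairs →+ Braids.C2 where
  toFun p := p.1.1 * p.1.2
  map_zero' := strand_mul (n := 0) rfl
  map_add' p q := add_mul_add p.2 q.2

@[simp] theorem degHom_apply (x : Braids.C2) : degHom x = deg x := rfl
@[simp] theorem strandHom_apply (x : Braids.C2) : strandHom x = strand (deg x) := rfl
@[simp] theorem invHom_apply (x : Braids.C2) : invHom x = x⁻¹ := rfl
@[simp] theorem mulHom_apply (p : composablePairs) : mulHom p = p.1.1 * p.1.2 := rfl

/-- The numbers of strands of a tuple of braids. -/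
noncomputable def degs (u : List Braids.C2) : List ℕ := u.map degHom

/-- Entrywise composition of tuples of braids. -/
noncomputable def vmul (u v : List Braids.C2) : List Braids.C2 := List.zipWith (· * ·) u v

/-- Entrywise inverses. -/
noncomputable def vinv (u : List Braids.C2) : List Braids.C2 := u.map invHom

/-- The tuple of identities with the same numbers of strands. -/
noncomputable def vid (u : List Braids.C2) : List Braids.C2 := u.map strandHom

theorem length_eq {u v : List Braids.C2} (h : degs u = degs v) : u.length = v.length := by
  simpa [degs] using congrArg List.length h

@[simp] theorem length_vid (u : List Braids.C2) : (vid u).length = u.length := List.length_map ..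
@[simp] theorem length_vinv (u : List Braids.C2) : (vinv u).length = u.length := List.length_map ..

theorem length_vmul {u v : List Braids.C2} (h : degs u = degs v) :
    (vmul u v).length = u.length := by simp [vmul, length_eq h]

@[simp] theorem degs_vid (u : List Braids.C2) : degs (vid u) = degs u := by
  simp [degs, vid]

@[simp] theorem degs_vinv (u : List Braids.C2) : degs (vinv u) = degs u := by
  simp [degs, vinv]

theorem degs_append (u v : List Braids.C2) : degs (u ++ v) = degs u ++ degs v := by simp [degs]

theorem exists_pairs {u v : List Braids.C2} (h : degs u = degs v) :
    ∃ w : List composablePairs, u = w.map (fun p => p.1.1) ∧ v = w.map (fun p => p.1.2) := by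
  induction u generalizing v with
  | nil =>
    have : v = [] := List.length_eq_zero_iff.1 (length_eq h).symm
    exact ⟨[], rfl, this⟩
  | cons x u ih =>
    obtain ⟨y, v, rfl⟩ := List.exists_cons_of_length_eq_add_one (length_eq h).symm
    simp only [degs, List.map_cons, List.cons.injEq] at h
    obtain ⟨w, rfl, rfl⟩ := ih h.2
    exact ⟨⟨(x, y), h.1⟩ :: w, rfl, rfl⟩

theorem vmul_pairs (w : List composablePairs) :
    vmul (w.map (fun p => p.1.1)) (w.map (fun p => p.1.2)) = w.map mulHom := by
  simp [vmul]

@[simp] theorem degs_vmul {u v : List Braids.C2} (h : degs u = degs v) :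
    degs (vmul u v) = degs u := by
  obtain ⟨w, rfl, rfl⟩ := exists_pairs h
  rw [vmul_pairs]
  simp [degs]

theorem vmul_assoc {u v w : List Braids.C2} (h : degs u = degs v) (k : degs v = degs w) :
    vmul (vmul u v) w = vmul u (vmul v w) := by
  induction u generalizing v w with
  | nil => rfl
  | cons x u ih =>
    obtain ⟨y, v, rfl⟩ := List.exists_cons_of_length_eq_add_one (length_eq h).symm
    obtain ⟨z, w, rfl⟩ := List.exists_cons_of_length_eq_add_one (length_eq k).symm
    simp only [degs, List.map_cons, List.cons.injEq] at h k
    exact congrArg₂ List.cons (mul_assoc h.1 k.1) (ih h.2 k.2)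

@[simp] theorem vid_vmul_self (u : List Braids.C2) : vmul (vid u) u = u := by
  induction u with
  | nil => rfl
  | cons x u ih => exact congrArg₂ List.cons (strand_mul rfl) ih

@[simp] theorem vmul_vid_self (u : List Braids.C2) : vmul u (vid u) = u := by
  induction u with
  | nil => rfl
  | cons x u ih => exact congrArg₂ List.cons (mul_strand rfl) ih

theorem vid_eq {u v : List Braids.C2} (h : degs u = degs v) : vid u = vid v := by
  have k (u) : vid u = (degs u).map strand := by simp [vid, degs]
  rw [k, k, h]

theorem vid_vmul {u v : List Braids.C2} (h : degs u = degs v) : vmul (vid u) v = v := by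
  rw [vid_eq h, vid_vmul_self]

theorem vmul_vid {u v : List Braids.C2} (h : degs u = degs v) : vmul u (vid v) = u := by
  rw [← vid_eq h, vmul_vid_self]

theorem vmul_vinv (u : List Braids.C2) : vmul u (vinv u) = vid u := by
  induction u with
  | nil => rfl
  | cons x u ih => exact congrArg₂ List.cons (mul_inv x) ih

theorem vinv_vmul_self (u : List Braids.C2) : vmul (vinv u) u = vid u := by
  induction u with
  | nil => rfl
  | cons x u ih => exact congrArg₂ List.cons (inv_mul x) ih

@[simp] theorem vinv_vinv (u : List Braids.C2) : vinv (vinv u) = u := by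
  simp [vinv, Function.comp_def, Braids.inv_inv]

@[simp] theorem vinv_vid (u : List Braids.C2) : vinv (vid u) = vid u := by
  simp [vinv, vid, inv_strand]

@[simp] theorem vid_vid (u : List Braids.C2) : vid (vid u) = vid u := vid_eq (degs_vid u)

theorem vinv_vmul {u v : List Braids.C2} (h : degs u = degs v) :
    vinv (vmul u v) = vmul (vinv v) (vinv u) := by
  induction u generalizing v with
  | nil => cases v <;> rfl
  | cons x u ih =>
    obtain ⟨y, v, rfl⟩ := List.exists_cons_of_length_eq_add_one (length_eq h).symm
    simp only [degs, List.map_cons, List.cons.injEq] at h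
    exact congrArg₂ List.cons (inv_mul_rev h.1) (ih h.2)

theorem vmul_append {u u' v v' : List Braids.C2} (h : degs u = degs u') :
    vmul (u ++ v) (u' ++ v') = vmul u u' ++ vmul v v' :=
  List.zipWith_append (length_eq h)

theorem degs_take {u : List Braids.C2} (n : ℕ) : degs (u.take n) = (degs u).take n := by
  simp [degs, List.map_take]

theorem degs_drop {u : List Braids.C2} (n : ℕ) : degs (u.drop n) = (degs u).drop n := by
  simp [degs, List.map_drop]

/-! 2-cells act functorially on tuples of braids. -/

theorem degs_eval2 (f : T2) (u : List Braids.C2) : degs (eval2 f u) = eval2 f (degs u) :=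
  (eval2_map degHom f u).symm

theorem eval2_vid (f : T2) (u : List Braids.C2) : eval2 f (vid u) = vid (eval2 f u) :=
  eval2_map strandHom f u

theorem eval2_vinv (f : T2) (u : List Braids.C2) : eval2 f (vinv u) = vinv (eval2 f u) :=
  eval2_map invHom f u

/-- Functoriality: `mulHom` is a homomorphism of monoids, so that 2-cells commute with it. -/
theorem eval2_vmul (f : T2) {u v : List Braids.C2} (h : degs u = degs v) :
    eval2 f (vmul u v) = vmul (eval2 f u) (eval2 f v) := by
  obtain ⟨w, rfl, rfl⟩ := exists_pairs h
  have h1 := eval2_map ((AddMonoidHom.fst _ _).comp composablePairs.subtype) f w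
  have h2 := eval2_map ((AddMonoidHom.snd _ _).comp composablePairs.subtype) f w
  have h3 := eval2_map mulHom f w
  rw [vmul_pairs, h3]
  exact (vmul_pairs _).symm.trans (congrArg₂ vmul h1.symm h2.symm)

/-! ### Evaluation of 3-cells -/

/-- The action of the braiding, on pairs. The value on other tuples is irrelevant. -/
noncomputable def evalBeta : List Braids.C2 → List Braids.C2
  | [x, y] => [(y + x) * cross (deg x) (deg y)]
  | u => u

/-- A 3-cell `A : f ⇛ g` gives a natural transformation between the functors `eval2 f` and
`eval2 g`. It is encoded by its action on tuples `u` of morphisms: `eval3 A u` is the diagonal of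
the naturality square at `u`, and the components are the values at tuples of identities. In this
encoding `◦₁` is the composition of maps. -/
noncomputable def eval3 : T3 → List Braids.C2 → List Braids.C2
  | .gen BrGen3.beta => evalBeta
  | .gen g => eval2 (T3.gen g).src
  | .id f => eval2 f
  | .tens A B => par A.src.dom (eval3 A) (eval3 B)
  | .comp₁ A B => fun u => eval3 B (eval3 A u)
  | .comp₂ A B => fun u => vmul (eval3 A u) (eval3 B (vid u))
  | .inv A => fun u => vinv (eval3 A (vinv u))

/-- The numbers of strands are computed by the source of a 3-cell, or equally by its target, because
addition of natural numbers is commutative. -/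
theorem degs_eval3 {A : T3} (w : A.WF MonCell) {u : List Braids.C2} (hu : u.length = A.src.dom) :
    degs (eval3 A u) = eval2 A.src (degs u) := by
  induction A generalizing u with
  | gen g =>
    cases g with
    | beta =>
      obtain ⟨x, y, rfl⟩ := List.length_eq_two.1 hu
      simp [eval3, evalBeta, degs, T3.src, bdry, eval2, tau, mu]
    | _ => exact degs_eval2 _ _
  | id f => exact degs_eval2 _ _
  | tens A B ih ih' =>
    have hu : u.length = A.src.dom + B.src.dom := hu
    simp only [eval3, par, degs_append]
    rw [ih w.1 (by simp; omega), ih' w.2 (by simp; omega), degs_take, degs_drop]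
    rfl
  | comp₁ A B ih ih' =>
    have h := ih w.1 hu
    have hl : (eval3 A u).length = A.src.cod := by
      have := length_eval2 (M := ℕ) w.1.facts.1 (u := degs u) ((List.length_map ..).trans hu)
      rw [← this, ← h]
      simp [degs]
    refine (ih' w.2.1 (hl.trans w.2.2)).trans ?_
    rw [h]
    rfl
  | comp₂ A B ih ih' =>
    have hu : u.length = A.src.dom := hu
    have hu' : u.length = A.tgt.dom := hu.trans w.1.facts.2.2.1
    have hd : (degs u).length = A.src.dom := (List.length_map ..).trans hu
    have h := ih w.1 hu
    have h' := ih' w.2.1 (u := vid u) ((length_vid u).trans (hu'.trans w.2.2.dom_eq))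
    have e : degs (eval3 A u) = degs (eval3 B (vid u)) := by
      rw [h, h', degs_vid, eval2_src_eq_tgt w.1 hd]
      exact eval2_cong collapses_monCell w.2.2 (hd.trans w.1.facts.2.2.1)
    simp only [eval3]
    rw [degs_vmul e, h]
    rfl
  | inv A ih =>
    have hu' : u.length = A.src.dom := Eq.trans hu (T3.WF.facts (A := A) w).2.2.1.symm
    simp only [eval3, degs_vinv]
    rw [ih w (by simpa using hu'), degs_vinv]
    exact eval2_src_eq_tgt (A := A) w ((List.length_map ..).trans hu')

theorem length_eval3 {A : T3} (w : A.WF MonCell) {u : List Braids.C2} (hu : u.length = A.src.dom) :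
    (eval3 A u).length = A.src.cod := by
  rw [← length_eval2 (M := ℕ) w.facts.1 (u := degs u) ((List.length_map ..).trans hu),
    ← degs_eval3 w hu]
  simp [degs]

theorem degs_eval3_tgt {A : T3} (w : A.WF MonCell) {u : List Braids.C2}
    (hu : u.length = A.src.dom) : degs (eval3 A u) = eval2 A.tgt (degs u) :=
  (degs_eval3 w hu).trans (eval2_src_eq_tgt w ((List.length_map ..).trans hu))

theorem degs_eval3_congr {A : T3} (w : A.WF MonCell) {u v : List Braids.C2}
    (hu : u.length = A.src.dom) (h : degs u = degs v) : degs (eval3 A u) = degs (eval3 A v) := by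
  rw [degs_eval3 w hu, degs_eval3 w ((length_eq h).symm.trans hu), h]

theorem eval2_cong_mon {M : Type} [AddMonoid M] {f g : T2} (h : Cong2 MonCell f g) {u : List M}
    (hu : u.length = f.dom) : eval2 f u = eval2 g u := eval2_cong collapses_monCell h hu

/-- The naturality of the transformation given by a 3-cell. -/
theorem eval3_vmul {A : T3} (w : A.WF MonCell) {u v : List Braids.C2} (hu : u.length = A.src.dom)
    (h : degs u = degs v) :
    eval3 A (vmul u v) = vmul (eval3 A u) (eval2 A.tgt v) ∧
      eval3 A (vmul u v) = vmul (eval2 A.src u) (eval3 A v) := by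
  induction A generalizing u v with
  | gen g =>
    have hv := (length_eq h).symm.trans hu
    have hw := (length_vmul h).trans hu
    cases g with
    | beta =>
      obtain ⟨x, y, rfl⟩ := List.length_eq_two.1 hu
      obtain ⟨x', y', rfl⟩ := List.length_eq_two.1 hv
      simp only [degs, List.map_cons, List.cons.injEq] at h
      have h1 : deg x = deg x' := h.1
      have h2 : deg y = deg y' := h.2.1
      have k1 : eval3 (.gen .beta) (vmul [x, y] [x', y']) =
        [(y * y' + x * x') * cross (deg (x * x')) (deg (y * y'))] := rfl
      have k2 : vmul (eval3 (.gen .beta) [x, y]) (eval2 mu [x', y']) =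
        [(y + x) * cross (deg x) (deg y) * (x' + (y' + 0))] := rfl
      have k3 : vmul (eval2 (tau ⋆₁ mu) [x, y]) (eval3 (.gen .beta) [x', y']) =
        [(y + (x + 0)) * ((y' + x') * cross (deg x') (deg y'))] := rfl
      have e : (y * y' + x * x') * cross (deg (x * x')) (deg (y * y')) =
          (y + (x + 0)) * ((y' + x') * cross (deg x') (deg y')) := by
        rw [deg_mul, deg_mul, h1, h2, add_zero, ← add_mul_add, Braids.mul_assoc]
      refine ⟨k1.trans (Eq.trans ?_ k2.symm), k1.trans (Eq.trans ?_ k3.symm)⟩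
      · rw [e, cross_natural, h1, h2, add_zero, add_zero, ← Braids.mul_assoc]
      · rw [e]
    | _ =>
      refine ⟨?_, eval2_vmul _ h⟩
      exact (eval2_vmul _ h).trans (congrArg _ (eval2_mon collapses_monCell w trivial hv))
  | id f => exact ⟨eval2_vmul _ h, eval2_vmul _ h⟩
  | tens A B ih ih' =>
    have hu : u.length = A.src.dom + B.src.dom := hu
    obtain ⟨i1, i2⟩ := ih w.1 (u := u.take A.src.dom) (v := v.take A.src.dom) (by simp; omega)
      (by rw [degs_take, degs_take, h])
    obtain ⟨j1, j2⟩ := ih' w.2 (u := u.drop A.src.dom) (v := v.drop A.src.dom) (by simp; omega)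
      (by rw [degs_drop, degs_drop, h])
    have e : eval3 (A ◦₀ B) (vmul u v) =
        eval3 A (vmul (u.take A.src.dom) (v.take A.src.dom)) ++
          eval3 B (vmul (u.drop A.src.dom) (v.drop A.src.dom)) := by
      simp [eval3, par, vmul, List.take_zipWith, List.drop_zipWith]
    have a1 : degs (u.take A.src.dom) = degs (v.take A.src.dom) := by
      rw [degs_take, degs_take, h]
    have a2 : (u.take A.src.dom).length = A.src.dom := by simp; omega
    refine ⟨e.trans ?_, e.trans ?_⟩
    · rw [i1, j1, ← vmul_append]
      · simp only [eval3, T3.tgt, bdry, eval2, par]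
        rw [← show A.src.dom = A.bdry.2.dom from w.1.facts.2.2.1]
      · rw [degs_eval3_tgt w.1 a2, degs_eval2, a1]
    · rw [i2, j2, ← vmul_append]
      · rfl
      · rw [degs_eval3 w.1 ((length_eq a1).symm.trans a2), degs_eval2, a1]
  | comp₁ A B ih ih' =>
    have hu : u.length = A.src.dom := hu
    have hv : v.length = A.src.dom := (length_eq h).symm.trans hu
    obtain ⟨i1, i2⟩ := ih w.1 hu h
    simp only [eval3]
    constructor
    · rw [i1]
      exact (ih' w.2.1 ((length_eval3 w.1 hu).trans w.2.2)
        (by rw [degs_eval3_tgt w.1 hu, degs_eval2, h])).1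
    · rw [i2]
      exact (ih' w.2.1 ((length_eval2 w.1.facts.1 hu).trans w.2.2)
        (by rw [degs_eval3 w.1 hv, degs_eval2, h])).2
  | comp₂ A B ih ih' =>
    have hu : u.length = A.src.dom := hu
    have hv : v.length = A.src.dom := (length_eq h).symm.trans hu
    have d := w.1.facts.2.2.1.trans w.2.2.dom_eq
    have hv' : v.length = B.src.dom := hv.trans d
    have e0 : degs (vid v) = degs v := degs_vid v
    have e1 : vid (vmul u v) = vid v := vid_eq ((degs_vmul h).trans h)
    have e2 : vid u = vid v := vid_eq h
    have st (z : List Braids.C2) (hz : z.length = A.src.dom) : eval2 A.tgt z = eval2 B.src z :=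
      eval2_cong_mon w.2.2 (hz.trans w.1.facts.2.2.1)
    have dB : degs (eval3 B (vid v)) = eval2 B.src (degs v) := by
      rw [degs_eval3 w.2.1 ((length_vid v).trans hv'), degs_vid]
    have dA : degs (eval3 A v) = eval2 B.src (degs v) := by
      rw [degs_eval3_tgt w.1 hv, ← degs_eval2, st v hv, degs_eval2]
    have dA' : degs (eval3 A u) = eval2 B.src (degs v) := by
      rw [degs_eval3_congr w.1 hu h, dA]
    obtain ⟨i1, i2⟩ := ih w.1 hu h
    simp only [eval3, e1, e2]
    constructor
    · have j1 := (ih' w.2.1 (u := v) (v := vid v) hv' e0.symm).2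
      have j2 := (ih' w.2.1 (u := vid v) (v := v) ((length_vid v).trans hv') e0).1
      rw [vmul_vid_self] at j1
      rw [vid_vmul_self] at j2
      rw [i1, vmul_assoc (dA'.trans (by rw [st v hv, degs_eval2]))
          (by rw [st v hv, degs_eval2, dB]),
        st v hv, ← j1, j2, vmul_assoc (dA'.trans dB.symm)]
      · rfl
      · rw [degs_eval3_tgt w.2.1 ((length_vid v).trans hv'), degs_vid, degs_eval2]
        rfl
    · rw [i2, vmul_assoc _ (dA.trans dB.symm)]
      · rfl
      · rw [degs_eval2, degs_eval3 w.1 hv, h]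
  | inv A ih =>
    have w : A.WF MonCell := w
    have hu : u.length = A.src.dom := Eq.trans hu w.facts.2.2.1.symm
    have hv : v.length = A.src.dom := (length_eq h).symm.trans hu
    have hu' : (vinv u).length = A.src.dom := (length_vinv u).trans hu
    have hv' : (vinv v).length = A.src.dom := (length_vinv v).trans hv
    have h' : degs (vinv v) = degs (vinv u) := by rw [degs_vinv, degs_vinv, h]
    obtain ⟨i1, i2⟩ := ih w hv' h'
    simp only [eval3]
    rw [vinv_vmul h]
    constructor
    · rw [i2, vinv_vmul, eval2_vinv, vinv_vinv]
      · rfl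
      · rw [degs_eval3 w hu', degs_eval2, h']
    · rw [i1, vinv_vmul, eval2_vinv, vinv_vinv]
      · rfl
      · rw [degs_eval3_tgt w hv', degs_eval2, h']

end Model

/-! ### Invariance of the evaluation -/

namespace Model

open T2 T3 Braids

/-- The 3-cells of monoidal categories give identity transformations. -/
theorem eval3_mon {A : T3} (w : A.WF MonCell) (hA : A.IsMon) {u : List Braids.C2}
    (hu : u.length = A.src.dom) : eval3 A u = eval2 A.src u := by
  induction A generalizing u with
  | gen g =>
    cases g with
    | beta => exact hA.elim
    | _ => rfl
  | id f => rfl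
  | tens A B ih ih' =>
    have hu : u.length = A.src.dom + B.src.dom := hu
    exact par_congr hu (fun v hv => ih w.1 hA.1 hv) (fun v hv => ih' w.2 hA.2 hv)
  | comp₁ A B ih ih' =>
    have h := ih w.1 hA.1 hu
    have h' := ih' w.2.1 hA.2 ((length_eval3 w.1 hu).trans w.2.2)
    rw [h] at h'
    simp only [eval3]
    rw [h, h']
    rfl
  | comp₂ A B ih ih' =>
    have hu : u.length = A.src.dom := hu
    have hu' : u.length = A.tgt.dom := hu.trans w.1.facts.2.2.1
    simp only [eval3]
    rw [ih w.1 hA.1 hu, ih' w.2.1 hA.2 ((length_vid u).trans (hu'.trans w.2.2.dom_eq)),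
      ← eval2_cong_mon w.2.2 ((length_vid u).trans hu'),
      ← eval2_mon collapses_monCell w.1 hA.1 ((length_vid u).trans hu), eval2_vid,
      vmul_vid_self]
    rfl
  | inv A ih =>
    have hu : u.length = A.src.dom := Eq.trans hu (T3.WF.facts (A := A) w).2.2.1.symm
    simp only [eval3]
    rw [ih w hA ((length_vinv u).trans hu), eval2_vinv, vinv_vinv]
    exact eval2_mon (A := A) collapses_monCell w hA hu

/-- The first hexagon. -/
theorem hexagon_left (x y z : Braids.C2) :
    ((z + x) * cross (deg x) (deg z) + y) * (strand (deg x) + cross (deg y) (deg z)) =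
      (z + x + y) * cross (deg x + deg y) (deg z) := by
  have h : (z + x + y) * (cross (deg x) (deg z) + strand (deg y)) =
      (z + x) * cross (deg x) (deg z) + y := by rw [add_mul_add, mul_strand]
  rw [cross_add_left, ← Braids.mul_assoc, h]

/-- The second hexagon. -/
theorem hexagon_right (x y z : Braids.C2) :
    ((y + x) * cross (deg x) (deg y) + z)⁻¹ * (strand (deg y) + cross (deg x) (deg z))⁻¹ =
      (x⁻¹ + (y⁻¹ + z⁻¹)) * (cross (deg x) (deg y + deg z))⁻¹ := by
  have h : (cross (deg x) (deg y) + strand (deg z)) * (x + y + z) =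
      (y + x) * cross (deg x) (deg y) + z := by
    rw [add_mul_add, strand_mul, cross_natural]
  rw [← inv_mul_rev (by simp; omega), cross_add_right, ← inv_add, ← inv_add,
    ← inv_mul_rev (by simp; omega), ← add_assoc, Braids.mul_assoc, h]

theorem eval3_fourCell {A B : T3} (h : FourCell A B) {u : List Braids.C2}
    (hu : u.length = A.src.dom) : eval3 A u = eval3 B u := by
  obtain ⟨wA, wB, hs, -⟩ := h.parallel (K := MonCell)
  have mon (hA : A.IsMon) (hB : B.IsMon) : eval3 A u = eval3 B u := by
    rw [eval3_mon wA hA hu, eval3_mon wB hB (Eq.trans hu hs.dom_eq), eval2_cong_mon hs hu]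
  cases h with
  | aleph => exact mon (by repeat' constructor) (by repeat' constructor)
  | beth => exact mon (by repeat' constructor) (by repeat' constructor)
  | daleth₁ =>
    obtain ⟨x, y, z, rfl⟩ := List.length_eq_three.1 hu
    -- the diagonals of both sides at a triple; the trivial braids come from the identity 3-cells
    -- and from `◦₂`, which evaluates its second factor at identities
    have k1 : eval3 (((I ◦₀ T) ◦₁ (β ◦₀ I) ◦₁ M) ◦₂ ((I ◦₀ T) ◦₁ α) ◦₂ ((I ◦₀ β) ◦₁ M)) [x, y, z] =
        [((z + x) * cross (deg x) (deg z) + (y + 0)) *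
          (strand (deg x) + (strand (deg z) + 0) + (strand (deg y) + 0)) *
          (strand (deg x) +
            ((strand (deg z) + strand (deg y)) * cross (deg y) (deg z) + 0))] := rfl
    have k2 : eval3 (((I ◦₀ T) ◦₁ (T ◦₀ I) ◦₁ α) ◦₂ ((M ◦₀ I) ◦₁ β) ◦₂ α) [x, y, z] =
        [(z + (x + 0) + (y + 0)) *
          ((strand (deg z) + (strand (deg x) + (strand (deg y) + 0))) *
            cross (deg (strand (deg x) + (strand (deg y) + 0))) (deg z)) *
          (strand (deg x) + (strand (deg y) + 0) + (strand (deg z) + 0))] := rfl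
    refine k1.trans (Eq.trans ?_ k2.symm)
    simp only [add_zero, strand_add_strand, deg_strand]
    rw [mul_strand, mul_strand (n := _ + deg z), strand_mul, strand_mul, hexagon_left]
  | daleth₂ =>
    obtain ⟨x, y, z, rfl⟩ := List.length_eq_three.1 hu
    have k1 : eval3 (((β ◦₀ I) ◦₁ M).inv ◦₂ ((T ◦₀ I) ◦₁ α) ◦₂ ((T ◦₀ I) ◦₁ (I ◦₀ β) ◦₁ M).inv)
        [x, y, z] =
        [((y⁻¹ + x⁻¹) * cross (deg x⁻¹) (deg y⁻¹) + (z⁻¹ + 0))⁻¹ *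
          (strand (deg y) + (strand (deg x) + 0) + (strand (deg z) + 0)) *
          ((strand (deg y))⁻¹ + (((strand (deg z))⁻¹ + (strand (deg x))⁻¹) *
            cross (deg (strand (deg x))⁻¹) (deg (strand (deg z))⁻¹) + 0))⁻¹] := rfl
    have k2 : eval3 (α ◦₂ ((I ◦₀ M) ◦₁ β).inv ◦₂ ((T ◦₀ I) ◦₁ (I ◦₀ T) ◦₁ α)) [x, y, z] =
        [(x + (y + 0) + (z + 0)) *
          (((strand (deg y))⁻¹ + ((strand (deg z))⁻¹ + 0) + (strand (deg x))⁻¹) *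
            cross (deg (strand (deg x))⁻¹)
              (deg ((strand (deg y))⁻¹ + ((strand (deg z))⁻¹ + 0))))⁻¹ *
          (strand (deg y) + (strand (deg z) + 0) + (strand (deg x) + 0))] := rfl
    refine k1.trans (Eq.trans ?_ k2.symm)
    have h := hexagon_right x⁻¹ y⁻¹ z⁻¹
    simp only [Braids.inv_inv, deg_inv] at h
    simp only [add_zero, inv_strand, strand_add_strand, deg_strand, deg_inv]
    rw [mul_strand, mul_strand (n := _ + deg x), strand_mul, strand_mul, h, add_assoc]

/-- The evaluation of 3-cells only depends on their class. -/
theorem eval3_cong {A B : T3} (h : Cong3 MonCell A B) {u : List Braids.C2}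
    (hu : u.length = A.src.dom) : eval3 A u = eval3 B u := by
  induction h generalizing u with
  | refl _ => rfl
  | symm h ih => exact (ih (hu.trans h.parallel.2.2.1.dom_eq.symm)).symm
  | trans h _ ih ih' => exact (ih hu).trans (ih' (hu.trans h.parallel.2.2.1.dom_eq))
  | id h => exact eval2_cong_mon h hu
  | @tens A A' B B' h k ih ih' =>
    have hu : u.length = A.src.dom + B.src.dom := hu
    simp only [eval3]
    rw [← h.parallel.2.2.1.dom_eq]
    exact par_congr hu (fun v hv => ih hv) (fun v hv => ih' hv)
  | @comp₁ A A' B B' h k e ih ih' =>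
    simp only [eval3]
    rw [← ih hu, ih' ((length_eval3 h.parallel.1 hu).trans e)]
  | @comp₂ A A' B B' h k e ih ih' =>
    simp only [eval3]
    rw [← ih hu, ih' ((length_vid u).trans
      (Eq.trans hu (h.parallel.1.facts.2.2.1.trans e.dom_eq)))]
  | @inv A A' h ih =>
    have hu : u.length = A.src.dom := Eq.trans hu h.parallel.1.facts.2.2.1.symm
    simp only [eval3]
    rw [ih ((length_vinv u).trans hu)]
  | tens_assoc _ _ _ => exact par_assoc _ _ _ _ _ _
  | id_tens _ => exact id_par _ _
  | tens_id _ => exact par_id _ hu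
  | comp₁_assoc => rfl
  | id_comp₁ _ => rfl
  | comp₁_id _ => rfl
  | @comp₂_assoc A B C a b c e e' =>
    have hu : u.length = A.src.dom := hu
    have hu1 : (vid u).length = A.tgt.dom := ((length_vid u).trans hu).trans a.facts.2.2.1
    have hu2 : (vid u).length = B.src.dom := hu1.trans e.dom_eq
    have hu3 : (vid u).length = C.src.dom := hu2.trans (b.facts.2.2.1.trans e'.dom_eq)
    have d1 : degs (eval3 A u) = degs (eval3 B (vid u)) := by
      rw [degs_eval3_tgt a hu, degs_eval3 b hu2, ← degs_eval2, ← degs_eval2, ← eval2_cong_mon e hu1,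
        degs_eval2, degs_eval2, degs_vid]
    have d2 : degs (eval3 B (vid u)) = degs (eval3 C (vid u)) := by
      rw [degs_eval3_tgt b hu2, degs_eval3 c hu3, ← degs_eval2, ← degs_eval2,
        ← eval2_cong_mon e' (hu2.trans b.facts.2.2.1)]
    simp only [eval3, vid_vid]
    exact vmul_assoc d1 d2
  | @id_comp₂ A a =>
    have h := (eval3_vmul a hu (degs_vid u).symm).2
    rw [vmul_vid_self] at h
    exact h.symm
  | @comp₂_id A a =>
    simp only [eval3]
    rw [eval2_vid, vmul_vid]
    rw [degs_eval3_tgt a hu, degs_eval2]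
  | @exchange₀₁ A B C D a b c d e e' =>
    have hu : u.length = A.src.dom + C.src.dom := hu
    have hv : (u.take A.src.dom).length = A.src.dom := by simp; omega
    exact par_comp (F' := eval3 B) (G := eval3 C) (G' := eval3 D) ((length_eval3 a hv).trans e)
  | @exchange₀₂ A B C D a b c d e e' =>
    have hu : u.length = A.src.dom + C.src.dom := hu
    have hv : (u.take A.src.dom).length = A.src.dom := by simp; omega
    have hv' : (vid (u.take A.src.dom)).length = B.src.dom :=
      ((length_vid _).trans hv).trans (a.facts.2.2.1.trans e.dom_eq)
    have h1 : (vid u).take B.src.dom = vid (u.take A.src.dom) := by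
      rw [← e.dom_eq, ← a.facts.2.2.1, vid, vid, List.map_take]
    have h2 : (vid u).drop B.src.dom = vid (u.drop A.src.dom) := by
      rw [← e.dom_eq, ← a.facts.2.2.1, vid, vid, List.map_drop]
    simp only [eval3, par, h1, h2]
    refine (vmul_append ?_).symm
    change degs (eval3 A (u.take A.src.dom)) = degs (eval3 B (vid (u.take A.src.dom)))
    rw [degs_eval3_tgt a hv, degs_eval3 b hv', degs_vid, ← degs_eval2, ← degs_eval2,
      eval2_cong_mon e (hv.trans a.facts.2.2.1)]
  | @exchange₁₂ A B C D a b c d e e' f =>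
    have hu : u.length = A.src.dom := hu
    have hu1 : (vid u).length = B.src.dom :=
      ((length_vid u).trans hu).trans (a.facts.2.2.1.trans e.dom_eq)
    have hA : (eval3 A u).length = C.src.dom := (length_eval3 a hu).trans f
    have dAB : degs (eval3 A u) = degs (eval3 B (vid u)) := by
      rw [degs_eval3_tgt a hu, degs_eval3 b hu1, degs_vid, ← degs_eval2, ← degs_eval2,
        eval2_cong_mon e (hu.trans a.facts.2.2.1)]
    have hB : (eval3 B (vid u)).length = C.tgt.dom :=
      (length_eq dAB).symm.trans (hA.trans c.facts.2.2.1)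
    have hBD : (eval3 B (vid u)).length = D.src.dom := hB.trans e'.dom_eq
    have k1 := (eval3_vmul c hA dAB).1
    have k2 := (eval3_vmul d (v := vid (eval3 B (vid u))) hBD (degs_vid _).symm).2
    rw [vmul_vid_self] at k2
    simp only [eval3]
    rw [k1, k2, eval2_cong_mon e' hB,
      vid_eq ((degs_vmul dAB).trans dAB)]
    refine vmul_assoc ?_ ?_
    · rw [degs_eval3_tgt c hA, ← degs_eval2, ← eval2_cong_mon e' hB, degs_eval2, degs_eval2, dAB]
    · rw [degs_eval2, degs_eval3 d ((length_vid _).trans hBD), degs_vid]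
  | id_tens_id _ _ => rfl
  | id_comp₁_id _ _ _ => rfl
  | @comp₂_inv A a =>
    have hu : u.length = A.src.dom := hu
    have h := (eval3_vmul a hu (degs_vid u).symm).2
    rw [vmul_vid_self] at h
    simp only [eval3, vinv_vid]
    rw [h, vmul_assoc, vmul_vinv, vmul_vid]
    · rw [degs_eval2, degs_eval3 a ((length_vid u).trans hu), degs_vid]
    · rw [degs_eval2, degs_eval3 a ((length_vid u).trans hu), degs_vid]
    · rw [degs_vinv]
  | @inv_comp₂ A a =>
    have hu : u.length = A.src.dom := Eq.trans hu a.facts.2.2.1.symm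
    have hv : (vid u).length = A.src.dom := (length_vid u).trans hu
    have h := (eval3_vmul a hv (v := vinv u) (by simp)).1
    rw [vid_vmul (by simp)] at h
    simp only [eval3]
    have dd : degs (eval3 A (vid u)) = degs (eval2 A.tgt u) := by
      rw [degs_eval3_tgt a hv, degs_vid, degs_eval2]
    rw [h, eval2_vinv, vinv_vmul (by rw [degs_vinv, dd]), vinv_vinv, vmul_assoc, vinv_vmul_self,
      vmul_vid dd.symm]
    · rw [degs_vinv, dd]
    · rw [degs_vinv]
  | @natL A a =>
    have hu : u.length = A.src.dom + 1 := hu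
    obtain ⟨v, y, rfl⟩ : ∃ v y, u = v ++ [y] :=
      ⟨u.dropLast, u.getLast (by rintro rfl; simp at hu), (List.dropLast_append_getLast _).symm⟩
    have hv : v.length = A.src.dom := by simpa using hu
    have e1 : eval3 (A ◦₀ I) (v ++ [y]) = eval3 A v ++ [y] := par_append _ _ hv
    have e2 : eval3 (I ◦₀ A) (y :: v) = y :: eval3 A v := rfl
    exact (congrArg _ e1).trans ((eval2_tauL (length_eval3 a hv) y).trans
      (e2.symm.trans (congrArg _ (eval2_tauL hv y).symm)))
  | @natR A a =>
    have hu : u.length = 1 + A.src.dom := hu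
    obtain ⟨y, v, rfl⟩ : ∃ y v, u = y :: v :=
      List.exists_cons_of_length_eq_add_one (hu.trans (add_comm _ _))
    have hv : v.length = A.src.dom := by simp at hu; omega
    have e1 : eval3 (I ◦₀ A) (y :: v) = y :: eval3 A v := rfl
    have e2 : eval3 (A ◦₀ I) (v ++ [y]) = eval3 A v ++ [y] := par_append _ _ hv
    exact (congrArg _ e1).trans ((eval2_tauR (length_eval3 a hv) y).trans
      (e2.symm.trans (congrArg _ (eval2_tauR hv y).symm)))
  | fourCell h => exact eval3_fourCell h hu
  | @collapse A hA a => exact eval3_mon a hA.2 hu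

/-- The components at the tuple of generating objects. -/
noncomputable def component (A : T3) : List Braids.C2 :=
  eval3 A (List.replicate A.src.dom (strand 1))

theorem vid_replicate (n : ℕ) :
    vid (List.replicate n (strand 1)) = List.replicate n (strand 1) := by
  simp [vid]

theorem component_comp₂ {A B : T3} (hA : A.WF MonCell) (e : Cong2 MonCell A.tgt B.src) :
    component (A ◦₂ B) = vmul (component A) (component B) := by
  have h : component (A ◦₂ B) = vmul (component A)
    (eval3 B (vid (List.replicate A.src.dom (strand 1)))) := rfl
  rw [h, vid_replicate, hA.facts.2.2.1, e.dom_eq]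
  rfl

theorem component_prod {A B : T3} :
    component (Initial.prod A B) = [(component A ++ component B).sum] := by
  have h : component (Initial.prod A B) = [(par A.src.dom (eval3 A) (eval3 B)
    (List.replicate (A.src.dom + B.src.dom) (strand 1))).sum] := rfl
  rw [h, List.replicate_add, par_append _ _ List.length_replicate]
  rfl

/-- The components at the tuple of generating objects are invariant under permutations of this
tuple. -/
theorem component_eq {A B : T3} (h : Initial.CellEq MonCell A B) : component A = component B := by
  induction h with
  | of_cong h =>
    rw [component, eval3_cong h (List.length_replicate ..), h.parallel.2.2.1.dom_eq]
    rfl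
  | @perm σ A p q w e =>
    have h : component (.id σ ◦₁ A) = eval3 A (eval2 σ (List.replicate σ.dom (strand 1))) := rfl
    rw [h, eval2_perm p q, Initial.perm_dom p q, e]
    rfl
  | symm _ ih => exact ih.symm
  | trans _ _ ih ih' => exact ih.trans ih'
  | comp h k e e' ih ih' =>
    rw [component_comp₂ h.facts.1 e, component_comp₂ h.facts.2.1 e', ih, ih']

end Model

/-! ### Calculus of 3-cells up to permutation -/

namespace Initial

open T2 T3

variable {K : T3 → Prop}

theorem wf_id {f : T2} (h : f.WF) : (T3.id f).WF K := h

theorem wf_tens {A B : T3} (a : A.WF K) (b : B.WF K) : (A ◦₀ B).WF K := ⟨a, b⟩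

theorem wf_comp₁ {A B : T3} (a : A.WF K) (b : B.WF K) (d : A.src.cod = B.src.dom) :
    (A ◦₁ B).WF K := ⟨a, b, d⟩

theorem wf_comp₂ {A B : T3} (a : A.WF K) (b : B.WF K) (e : Cong2 K A.tgt B.src) :
    (A ◦₂ B).WF K := ⟨a, b, e⟩

theorem comp_id_of {A B : T3} (hA : A.WF K) (e : Cong2 K A.tgt B.src)
    (h : Cong3 K B (.id B.src)) : Cong3 K (A ◦₂ B) A :=
  ((Cong3.refl hA).comp₂ (h.trans (.id e.symm)) e).trans (.comp₂_id hA)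

theorem id_comp_of {A B : T3} (hB : B.WF K) (e : Cong2 K A.tgt B.src)
    (h : Cong3 K A (.id A.src)) : Cong3 K (A ◦₂ B) B :=
  (Cong3.comp₂ (h.trans (.id (h.parallel.2.2.2.symm.trans e))) (.refl hB) e).trans (.id_comp₂ hB)

theorem pre_comp₂ {e : T2} {A B : T3} (he : e.WF) (hA : A.WF K) (hB : B.WF K)
    (c : Cong2 K A.tgt B.src) (d : e.cod = A.src.dom) :
    Cong3 K (.id e ◦₁ (A ◦₂ B)) ((.id e ◦₁ A) ◦₂ (.id e ◦₁ B)) :=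
  have he' : (T3.id e).WF K := he
  (Cong3.comp₁ (Cong3.id_comp₂ he').symm (.refl (wf_comp₂ hA hB c)) d).trans
    (.exchange₁₂ he' he' hA hB (.refl he) c d)

/-- A horizontal composite, cut into whiskerings: first `A`, then `C`. -/
theorem comp₁_cut {A C : T3} (hA : A.WF K) (hC : C.WF K) (d : A.src.cod = C.src.dom) :
    Cong3 K (A ◦₁ C) ((A ◦₁ .id C.src) ◦₂ (.id A.tgt ◦₁ C)) :=
  (Cong3.comp₁ (Cong3.comp₂_id hA).symm (Cong3.id_comp₂ hC).symm d).trans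
    (.exchange₁₂ hA (wf_id hA.facts.2.1) (wf_id hC.facts.1) hC
      (.refl hA.facts.2.1) (.refl hC.facts.1) d)

/-- A horizontal composite, cut into whiskerings: first `C`, then `A`. -/
theorem comp₁_cut' {A C : T3} (hA : A.WF K) (hC : C.WF K) (d : A.src.cod = C.src.dom) :
    Cong3 K (A ◦₁ C) ((.id A.src ◦₁ C) ◦₂ (A ◦₁ .id C.tgt)) :=
  (Cong3.comp₁ (Cong3.id_comp₂ hA).symm (Cong3.comp₂_id hC).symm d).trans
    (.exchange₁₂ (wf_id hA.facts.1) hA hC (wf_id hC.facts.2.1)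
      (.refl hA.facts.1) (.refl hC.facts.2.1) d)

theorem comp₂_comp₁ {A B C : T3} (hA : A.WF K) (hB : B.WF K) (hC : C.WF K)
    (e : Cong2 K A.tgt B.src) (d : A.src.cod = C.src.dom) :
    Cong3 K ((A ◦₂ B) ◦₁ C) ((A ◦₁ C) ◦₂ (B ◦₁ .id C.tgt)) :=
  (Cong3.comp₁ (.refl (wf_comp₂ hA hB e)) (Cong3.comp₂_id hC).symm d).trans
    (.exchange₁₂ hA hB hC (wf_id hC.facts.2.1) e (.refl hC.facts.2.1) d)

theorem comp₂_tens {A B C : T3} (hA : A.WF K) (hB : B.WF K) (hC : C.WF K)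
    (e : Cong2 K A.tgt B.src) :
    Cong3 K ((A ◦₂ B) ◦₀ C) ((A ◦₀ C) ◦₂ (B ◦₀ .id C.tgt)) :=
  (Cong3.tens (.refl (wf_comp₂ hA hB e)) (Cong3.comp₂_id hC).symm).trans
    (.exchange₀₂ hA hB hC (wf_id hC.facts.2.1) e (.refl hC.facts.2.1))

theorem tens_comp₂ {A B C : T3} (hA : A.WF K) (hB : B.WF K) (hC : C.WF K)
    (e : Cong2 K A.tgt B.src) :
    Cong3 K (C ◦₀ (A ◦₂ B)) ((C ◦₀ A) ◦₂ (.id C.tgt ◦₀ B)) :=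
  (Cong3.tens (Cong3.comp₂_id hC).symm (.refl (wf_comp₂ hA hB e))).trans
    (.exchange₀₂ hC (wf_id hC.facts.2.1) hA hB (.refl hC.facts.2.1) e)

/-- A right inverse for `◦₂` is the inverse. -/
theorem inv_unique {A B : T3} (hA : A.WF K) (hB : B.WF K) (e : Cong2 K A.tgt B.src)
    (h : Cong3 K (A ◦₂ B) (.id A.src)) : Cong3 K A.inv B := by
  have hA' : A.inv.WF K := hA
  have a : Cong2 K A.inv.tgt A.src := .refl hA.facts.1
  exact (Cong3.comp₂_id hA').symm.trans
    (((Cong3.refl hA').comp₂ h.symm a).trans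
      ((Cong3.comp₂_assoc hA' hA hB a e).symm.trans
        (((Cong3.inv_comp₂ hA).comp₂ (.refl hB) e).trans
          (id_comp_of hB e (.refl hA.facts.2.1)))))

theorem pre_inv {e : T2} {A : T3} (he : e.WF) (hA : A.WF K) (d : e.cod = A.src.dom) :
    Cong3 K (.id e ◦₁ A).inv (.id e ◦₁ A.inv) :=
  have hA' : A.inv.WF K := hA
  inv_unique ⟨he, hA, d⟩ ⟨he, hA', d.trans hA.facts.2.2.1⟩
    (.refl ⟨he, hA.facts.2.1, d.trans hA.facts.2.2.1⟩)
    ((pre_comp₂ he hA hA' (.refl hA.facts.2.1) d).symm.trans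
      ((Cong3.comp₁ (.refl (wf_id he)) (.comp₂_inv hA) d).trans (.id_comp₁_id he hA.facts.1 d)))

theorem inv_tens {A B : T3} (hA : A.WF K) (hB : B.WF K) :
    Cong3 K (A ◦₀ B).inv (A.inv ◦₀ B.inv) :=
  have hA' : A.inv.WF K := hA
  have hB' : B.inv.WF K := hB
  inv_unique ⟨hA, hB⟩ ⟨hA', hB'⟩ (.refl ⟨hA.facts.2.1, hB.facts.2.1⟩)
    ((Cong3.exchange₀₂ hA hA' hB hB' (.refl hA.facts.2.1) (.refl hB.facts.2.1)).symm.trans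
      (((Cong3.comp₂_inv hA).tens (.comp₂_inv hB)).trans (.id_tens_id hA.facts.1 hB.facts.1)))

theorem inv_id {f : T2} (hf : f.WF) : Cong3 K (T3.id f).inv (.id f) :=
  have h : (T3.id f).WF K := hf
  inv_unique h h (.refl hf) (.id_comp₂ h)

theorem inv_comp {A B : T3} (hA : A.WF K) (hB : B.WF K) (e : Cong2 K A.tgt B.src) :
    Cong3 K (A ◦₂ B).inv (B.inv ◦₂ A.inv) := by
  have hA' : A.inv.WF K := hA
  have hB' : B.inv.WF K := hB
  have e' : Cong2 K B.inv.tgt A.inv.src := e.symm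
  have b : Cong2 K B.tgt B.inv.src := .refl hB.facts.2.1
  refine inv_unique ⟨hA, hB, e⟩ ⟨hB', hA', e'⟩ b ?_
  refine (Cong3.comp₂_assoc (C := B.inv ◦₂ A.inv) hA hB ⟨hB', hA', e'⟩ e b).trans
    (Cong3.trans (B := A ◦₂ A.inv) ((Cong3.refl hA).comp₂ ?_ e) (Cong3.comp₂_inv (A := A) hA))
  refine (Cong3.comp₂_assoc hB hB' hA' b e').symm.trans ?_
  exact ((Cong3.comp₂_inv hB).comp₂ (.refl hA') e').trans (id_comp_of hA' e' (.refl hB.facts.1))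

theorem pre_tens {σ : T2} {A C : T3} (q : σ.WF) (hA : A.WF K) (hC : C.WF K)
    (d : σ.cod = A.src.dom) :
    Cong3 K ((.id σ ◦₁ A) ◦₀ C) (.id (σ ⋆₀ .id C.src.dom) ◦₁ (A ◦₀ C)) := by
  have w : (T3.id σ ◦₁ A).WF K := ⟨q, hA, d⟩
  exact ((Cong3.refl w).tens (Cong3.id_comp₁ hC).symm).trans
    ((Cong3.exchange₀₁ (A := .id σ) (C := .id (.id C.src.dom)) q hA trivial hC d rfl).trans
      ((Cong3.id_tens_id (g := .id C.src.dom) q trivial).comp₁ (.refl (wf_tens hA hC))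
        (congrArg (· + C.src.dom) d)))

theorem tens_pre {σ : T2} {A C : T3} (q : σ.WF) (hA : A.WF K) (hC : C.WF K)
    (d : σ.cod = A.src.dom) :
    Cong3 K (C ◦₀ (.id σ ◦₁ A)) (.id (.id C.src.dom ⋆₀ σ) ◦₁ (C ◦₀ A)) := by
  have w : (T3.id σ ◦₁ A).WF K := ⟨q, hA, d⟩
  exact (Cong3.tens (Cong3.id_comp₁ hC).symm (.refl w)).trans
    ((Cong3.exchange₀₁ (A := .id (.id C.src.dom)) (C := .id σ) trivial hC q hA rfl d).trans
      ((Cong3.id_tens_id (f := .id C.src.dom) trivial q).comp₁ (.refl (wf_tens hC hA))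
        (congrArg (C.src.dom + ·) d)))

theorem CellEq.wf_left {A B : T3} (h : CellEq K A B) : A.WF K := h.facts.1
theorem CellEq.wf_right {A B : T3} (h : CellEq K A B) : B.WF K := h.facts.2.1
theorem CellEq.cod_eq {A B : T3} (h : CellEq K A B) : A.src.cod = B.src.cod :=
  h.facts.2.2.1.cod_eq

/-- Permutations act on the inputs of a 3-cell, so that equality up to permutation is compatible
with `◦₁` in the first factor. -/
theorem CellEq.comp₁ {A A' C : T3} (h : CellEq K A A') (hC : C.WF K)
    (d : A.src.cod = C.src.dom) : CellEq K (A ◦₁ C) (A' ◦₁ C) := by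
  induction h generalizing C with
  | of_cong h => exact .of_cong (h.comp₁ (.refl hC) d)
  | @perm σ A p q w e =>
    exact (CellEq.of_cong (Cong3.comp₁_assoc (A := .id σ) q w hC e d)).trans
      (.perm p q ⟨w, hC, d⟩ e)
  | symm h ih => exact (ih hC (h.cod_eq.trans d)).symm
  | trans h k ih ih' => exact (ih hC d).trans (ih' hC (h.cod_eq.symm.trans d))
  | @comp A A' B B' h k e e' ih ih' =>
    have hC' : (T3.id C.tgt).WF K := hC.facts.2.1
    have dA : A.src.cod = C.src.dom := d
    have dA' : A'.src.cod = C.src.dom := h.cod_eq.symm.trans d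
    have dB : B.src.cod = C.tgt.dom :=
      e.cod_eq.symm.trans (h.wf_left.facts.2.2.2.symm.trans (dA.trans hC.facts.2.2.1))
    refine (CellEq.of_cong (comp₂_comp₁ h.wf_left k.wf_left hC e dA)).trans
      ((CellEq.comp (ih hC dA) (ih' hC' dB) ?_ ?_).trans
        (.of_cong (comp₂_comp₁ h.wf_right k.wf_right hC e' dA').symm))
    · exact e.comp (.refl hC.facts.2.1) (e.cod_eq.trans dB)
    · exact e'.comp (.refl hC.facts.2.1) (e'.cod_eq.trans (k.cod_eq.symm.trans dB))

theorem CellEq.tens_right {A A' C : T3} (h : CellEq K A A') (hC : C.WF K) :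
    CellEq K (A ◦₀ C) (A' ◦₀ C) := by
  induction h generalizing C with
  | of_cong h => exact .of_cong (h.tens (.refl hC))
  | @perm σ A p q w e =>
    exact (CellEq.of_cong (pre_tens q w hC e)).trans
      (.perm ⟨p, trivial⟩ ⟨q, trivial⟩ ⟨w, hC⟩ (congrArg (· + C.src.dom) e))
  | symm h ih => exact (ih hC).symm
  | trans h k ih ih' => exact (ih hC).trans (ih' hC)
  | @comp A A' B B' h k e e' ih ih' =>
    have hC' : (T3.id C.tgt).WF K := hC.facts.2.1
    exact (CellEq.of_cong (comp₂_tens h.wf_left k.wf_left hC e)).trans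
      ((CellEq.comp (ih hC) (ih' hC') (e.tens (.refl hC')) (e'.tens (.refl hC'))).trans
        (.of_cong (comp₂_tens h.wf_right k.wf_right hC e').symm))

theorem CellEq.tens_left {A A' C : T3} (h : CellEq K A A') (hC : C.WF K) :
    CellEq K (C ◦₀ A) (C ◦₀ A') := by
  induction h generalizing C with
  | of_cong h => exact .of_cong ((Cong3.refl hC).tens h)
  | @perm σ A p q w e =>
    exact (CellEq.of_cong (tens_pre q w hC e)).trans
      (.perm ⟨trivial, p⟩ ⟨trivial, q⟩ ⟨hC, w⟩ (congrArg (C.src.dom + ·) e))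
  | symm h ih => exact (ih hC).symm
  | trans h k ih ih' => exact (ih hC).trans (ih' hC)
  | @comp A A' B B' h k e e' ih ih' =>
    have hC' : (T3.id C.tgt).WF K := hC.facts.2.1
    exact (CellEq.of_cong (tens_comp₂ h.wf_left k.wf_left hC e)).trans
      ((CellEq.comp (ih hC) (ih' hC') ((Cong.refl hC').tens e) ((Cong.refl hC').tens e')).trans
        (.of_cong (tens_comp₂ h.wf_right k.wf_right hC e').symm))

theorem CellEq.tens {A A' B B' : T3} (h : CellEq K A A') (k : CellEq K B B') :
    CellEq K (A ◦₀ B) (A' ◦₀ B') :=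
  (h.tens_right k.wf_left).trans (k.tens_left h.wf_right)

theorem CellEq.inv {A A' : T3} (h : CellEq K A A') : CellEq K A.inv A'.inv := by
  induction h with
  | of_cong h => exact .of_cong h.inv
  | @perm σ A p q w e =>
    exact (CellEq.of_cong (pre_inv q w e)).trans
      (.perm (A := A.inv) p q w (e.trans w.facts.2.2.1))
  | symm h ih => exact ih.symm
  | trans h k ih ih' => exact ih.trans ih'
  | @comp A A' B B' h k e e' ih ih' =>
    exact (CellEq.of_cong (inv_comp h.wf_left k.wf_left e)).trans
      ((CellEq.comp ih' ih e.symm e'.symm).trans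
        (.of_cong (inv_comp h.wf_right k.wf_right e').symm))

/-! The symmetry is natural up to permutation. -/

theorem isPerm_tauR (n : ℕ) : IsPerm (tauR n) := by
  induction n with
  | zero => trivial
  | succ n ih => exact ⟨⟨trivial, trivial⟩, trivial, ih⟩

/-- Naturality of the symmetry `tauR` turns `T` into a permutation of the inputs. -/
theorem one_tens_tau {B : T3} (hB : Alg K B) : CellEq K ((I ◦₀ B) ◦₁ T) (B ◦₀ I) := by
  have w : (I ◦₀ B).WF K := ⟨trivial, hB.1⟩
  have d : (I ◦₀ B).src.cod = 2 := congrArg (1 + ·) hB.2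
  have k := Cong3.natR hB.1
  rw [hB.2] at k
  refine (CellEq.of_cong (((Cong3.refl w).comp₁ (Cong3.id tauR_one).symm d).trans k)).trans ?_
  exact .perm (isPerm_tauR _) (tauR_facts _).1 ⟨hB.1, trivial⟩ (tauR_facts _).2.2

theorem tens_one_tau {A : T3} (hA : Alg K A) :
    Cong3 K ((A ◦₀ I) ◦₁ T) (.id (tauL A.src.dom) ◦₁ (I ◦₀ A)) := by
  have w : (A ◦₀ I).WF K := ⟨hA.1, trivial⟩
  have d : (A ◦₀ I).src.cod = 2 := congrArg (· + 1) hA.2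
  have k := Cong3.natL hA.1
  rw [hA.2] at k
  exact ((Cong3.refl w).comp₁ (Cong3.id tauL_one).symm d).trans k

/-- The exchange of `B` with `n` strands, one strand at a time. -/
theorem strands_tens_tauL {B : T3} (hB : Alg K B) (n : ℕ) :
    CellEq K ((.id (.id n) ◦₀ B) ◦₁ .id (tauL n)) (B ◦₀ .id (.id n)) := by
  induction n with
  | zero =>
    have d : (T3.id (.id 0) ◦₀ B).src.cod = 1 := (congrArg (0 + ·) hB.2)
    exact .of_cong (((Cong3.id_tens hB.1).comp₁ (.refl (A := I) trivial) d).trans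
      ((comp₁_one hB).trans (Cong3.tens_id hB.1).symm))
  | succ n ih =>
    have wn : (T3.id (.id n)).WF K := trivial
    have wI : I.WF K := trivial
    have wT : T.WF K := trivial
    have wL : (T3.id (tauL n)).WF K := (tauL_facts n).1
    have wIB : (I ◦₀ B).WF K := ⟨trivial, hB.1⟩
    have dIB : (I ◦₀ B).src.cod = 2 := congrArg (1 + ·) hB.2
    have w1 : (T3.id (.id n) ◦₀ (I ◦₀ B)).WF K := ⟨trivial, wIB⟩
    have d1 : (T3.id (.id n) ◦₀ (I ◦₀ B)).src.cod = n + 2 := congrArg (n + ·) dIB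
    have split : Cong3 K (.id (.id (n + 1))) (.id (.id n) ◦₀ I) :=
      ((Cong3.id_tens_id (f := .id n) (g := one) trivial trivial).trans
        (.id (.id_tens_id n 1))).symm
    have k0 : Cong3 K (.id (.id (n + 1)) ◦₀ B) (.id (.id n) ◦₀ (I ◦₀ B)) :=
      (split.tens (.refl hB.1)).trans (.tens_assoc wn wI hB.1)
    have k1 : Cong3 K (.id (tauL (n + 1)))
        ((.id (.id n) ◦₀ T) ◦₁ (.id (tauL n) ◦₀ I)) :=
      ((Cong3.comp₁ (Cong3.id_tens_id (f := .id n) (g := tau) trivial trivial)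
        (Cong3.id_tens_id (f := tauL n) (g := one) wL trivial)
        (congrArg (· + 1) (tauL_facts n).2.1.symm)).trans
          (Cong3.id_comp₁_id (f := .id n ⋆₀ tau) (g := tauL n ⋆₀ one) ⟨trivial, trivial⟩
            ⟨wL, trivial⟩
            (congrArg (· + 1) (tauL_facts n).2.1.symm))).symm
    have e1 : (T3.id (.id n) ◦₀ T).src.cod = (T3.id (tauL n) ◦₀ I).src.dom :=
      congrArg (· + 1) (tauL_facts n).2.1.symm
    have k2 : Cong3 K ((.id (.id (n + 1)) ◦₀ B) ◦₁ .id (tauL (n + 1)))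
        (((.id (.id n) ◦₀ (I ◦₀ B)) ◦₁ (.id (.id n) ◦₀ T)) ◦₁ (.id (tauL n) ◦₀ I)) :=
      (k0.comp₁ k1 ((congrArg (n + 1 + ·) hB.2).trans (tauL_facts (n + 1)).2.1.symm)).trans
        (Cong3.comp₁_assoc w1 (wf_tens wn wT) (wf_tens wL wI) d1 e1).symm
    have k3 : Cong3 K ((.id (.id n) ◦₀ (I ◦₀ B)) ◦₁ (.id (.id n) ◦₀ T))
        (.id (.id n) ◦₀ ((I ◦₀ B) ◦₁ T)) :=
      (Cong3.exchange₀₁ wn wn wIB wT rfl dIB).symm.trans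
        (.tens (Cong3.id_comp₁ (A := .id (.id n)) trivial) (.refl ⟨wIB, wT, dIB⟩))
    have k4 : CellEq K (.id (.id n) ◦₀ ((I ◦₀ B) ◦₁ T)) ((.id (.id n) ◦₀ B) ◦₀ I) :=
      ((one_tens_tau hB).tens_left wn).trans
        (.of_cong (Cong3.tens_assoc wn hB.1 wI).symm)
    have dB : (T3.id (.id n) ◦₀ B).src.cod = (T3.id (tauL n)).src.dom :=
      (congrArg (n + ·) hB.2).trans (tauL_facts n).2.1.symm
    have wnB : (T3.id (.id n) ◦₀ B).WF K := ⟨wn, hB.1⟩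
    have k5 : Cong3 K (((.id (.id n) ◦₀ B) ◦₀ I) ◦₁ (.id (tauL n) ◦₀ I))
        (((.id (.id n) ◦₀ B) ◦₁ .id (tauL n)) ◦₀ I) :=
      (Cong3.exchange₀₁ wnB wL wI wI dB rfl).symm.trans
        (.tens (.refl ⟨wnB, wL, dB⟩) (comp₁_one (A := I) ⟨wI, rfl⟩))
    refine (CellEq.of_cong k2).trans
      ((((CellEq.of_cong k3).trans k4).comp₁ (wf_tens wL wI) ?_).trans
        ((CellEq.of_cong k5).trans ((ih.tens_right wI).trans (.of_cong ?_))))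
    · exact e1
    · exact (Cong3.tens_assoc hB.1 wn wI).trans (.tens (.refl hB.1) split.symm)

/-- The symmetry exchanges two algebraic 3-cells, up to permutation. -/
theorem tens_tau {A B : T3} (hA : Alg K A) (hB : Alg K B) :
    CellEq K ((A ◦₀ B) ◦₁ T) (B ◦₀ A) := by
  have wI : I.WF K := trivial
  have wT : T.WF K := trivial
  have wn : (T3.id (.id A.src.dom)).WF K := trivial
  have wL : (T3.id (tauL A.src.dom)).WF K := (tauL_facts _).1
  have wIA : (I ◦₀ A).WF K := ⟨wI, hA.1⟩
  have wnB : (T3.id (.id A.src.dom) ◦₀ B).WF K := ⟨wn, hB.1⟩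
  have wAI : (A ◦₀ I).WF K := ⟨hA.1, wI⟩
  have dB : (T3.id (.id A.src.dom) ◦₀ B).src.cod = A.src.dom + 1 :=
    congrArg (A.src.dom + ·) hB.2
  have dL : (T3.id (.id A.src.dom) ◦₀ B).src.cod = (T3.id (tauL A.src.dom)).src.dom :=
    dB.trans (tauL_facts _).2.1.symm
  have dA : (A ◦₀ I).src.cod = T.src.dom := congrArg (· + 1) hA.2
  have e1 : (T3.id (tauL A.src.dom)).src.cod = (I ◦₀ A).src.dom :=
    (tauL_facts _).2.2.trans (add_comm _ _)
  have k1 : Cong3 K (A ◦₀ B) ((.id (.id A.src.dom) ◦₀ B) ◦₁ (A ◦₀ I)) :=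
    (Cong3.tens (Cong3.id_comp₁ hA.1).symm (comp₁_one hB).symm).trans
      (Cong3.exchange₀₁ wn hA.1 hB.1 wI rfl hB.2)
  have k2 : Cong3 K ((A ◦₀ B) ◦₁ T)
      (((.id (.id A.src.dom) ◦₀ B) ◦₁ .id (tauL A.src.dom)) ◦₁ (I ◦₀ A)) :=
    (k1.comp₁ (.refl wT) (congrArg₂ (· + ·) hA.2 hB.2)).trans
      ((Cong3.comp₁_assoc wnB wAI wT dB dA).trans
        (((Cong3.refl wnB).comp₁ (tens_one_tau hA) dB).trans
          (Cong3.comp₁_assoc wnB wL wIA dL e1).symm))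
  have k3 : Cong3 K ((B ◦₀ .id (.id A.src.dom)) ◦₁ (I ◦₀ A)) (B ◦₀ A) :=
    (Cong3.exchange₀₁ hB.1 wI wn hA.1 hB.2 rfl).symm.trans
      (.tens (comp₁_one hB) (.id_comp₁ hA.1))
  exact (CellEq.of_cong k2).trans (((strands_tens_tauL hB _).comp₁ wIA e1).trans (.of_cong k3))

end Initial

/-! ### The braiding of `BOne` -/

namespace Initial

open T2 T3

variable {K : T3 → Prop}

theorem inv_inv {A : T3} (hA : A.WF K) : Cong3 K A.inv.inv A :=
  inv_unique (A := A.inv) hA hA (.refl hA.facts.1) (.inv_comp₂ hA)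

theorem cong_of_inv {A B : T3} (h : Cong3 K A.inv B.inv) : Cong3 K A B :=
  (inv_inv (A := A) h.parallel.1).symm.trans (h.inv.trans (inv_inv (A := B) h.parallel.2.1))

/-- Three algebraic 3-cells put on the inputs of `(X ◦₀ I) ◦₁ Y`, where `X` has arity two. -/
theorem pre_left {F G H X Y : T3} (hF : Alg K F) (hG : Alg K G) (hH : Alg K H) (hX : X.WF K)
    (hY : Y.WF K) (dX : X.src.dom = 2) (cX : X.src.cod = 1) (dY : Y.src.dom = 2) :
    Cong3 K (((F ◦₀ G) ◦₀ H) ◦₁ ((X ◦₀ I) ◦₁ Y)) ((((F ◦₀ G) ◦₁ X) ◦₀ H) ◦₁ Y) := by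
  have wI : I.WF K := trivial
  have wFG := wf_tens hF.1 hG.1
  have dFG : (F ◦₀ G).src.cod = X.src.dom := (congrArg₂ (· + ·) hF.2 hG.2).trans dX.symm
  have dFGH : ((F ◦₀ G) ◦₀ H).src.cod = (X ◦₀ I).src.dom := congrArg₂ (· + ·) dFG hH.2
  have dXY : (X ◦₀ I).src.cod = Y.src.dom := (congrArg (· + 1) cX).trans dY.symm
  exact (Cong3.comp₁_assoc (wf_tens wFG hH.1) (wf_tens hX wI) hY dFGH dXY).symm.trans
    (((Cong3.exchange₀₁ wFG hX hH.1 wI dFG hH.2).symm.trans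
      (.tens (.refl (wf_comp₁ wFG hX dFG)) (comp₁_one hH))).comp₁ (.refl hY) dXY)

/-- Three algebraic 3-cells put on the inputs of `(I ◦₀ X) ◦₁ Y`, where `X` has arity two. -/
theorem pre_right {F G H X Y : T3} (hF : Alg K F) (hG : Alg K G) (hH : Alg K H) (hX : X.WF K)
    (hY : Y.WF K) (dX : X.src.dom = 2) (cX : X.src.cod = 1) (dY : Y.src.dom = 2) :
    Cong3 K ((F ◦₀ (G ◦₀ H)) ◦₁ ((I ◦₀ X) ◦₁ Y)) ((F ◦₀ ((G ◦₀ H) ◦₁ X)) ◦₁ Y) := by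
  have wI : I.WF K := trivial
  have wGH := wf_tens hG.1 hH.1
  have dGH : (G ◦₀ H).src.cod = X.src.dom := (congrArg₂ (· + ·) hG.2 hH.2).trans dX.symm
  have dFGH : (F ◦₀ (G ◦₀ H)).src.cod = (I ◦₀ X).src.dom := congrArg₂ (· + ·) hF.2 dGH
  have dXY : (I ◦₀ X).src.cod = Y.src.dom := (congrArg (1 + ·) cX).trans dY.symm
  exact (Cong3.comp₁_assoc (wf_tens hF.1 wGH) (wf_tens wI hX) hY dFGH dXY).symm.trans
    (((Cong3.exchange₀₁ hF.1 wI wGH hX hF.2 dGH).symm.trans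
      (.tens (comp₁_one hF) (.refl (wf_comp₁ wGH hX dGH)))).comp₁ (.refl hY) dXY)

/-- Exchange of the last two of three algebraic 3-cells. -/
theorem tens_one_tens_tau {F G H : T3} (hF : Alg K F) (hG : Alg K G) (hH : Alg K H) :
    CellEq K (((F ◦₀ G) ◦₀ H) ◦₁ (I ◦₀ T)) ((F ◦₀ H) ◦₀ G) := by
  have wI : I.WF K := trivial
  have wT : T.WF K := trivial
  have wGH := wf_tens hG.1 hH.1
  have dGH : (G ◦₀ H).src.cod = T.src.dom := congrArg₂ (· + ·) hG.2 hH.2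
  have d : ((F ◦₀ G) ◦₀ H).src.cod = 3 :=
    congrArg₂ (· + ·) (congrArg₂ (· + ·) hF.2 hG.2) hH.2
  have k : Cong3 K (((F ◦₀ G) ◦₀ H) ◦₁ (I ◦₀ T)) (F ◦₀ ((G ◦₀ H) ◦₁ T)) :=
    ((Cong3.tens_assoc hF.1 hG.1 hH.1).comp₁ (.refl (wf_tens wI wT)) d).trans
      ((Cong3.exchange₀₁ hF.1 wI wGH wT hF.2 dGH).symm.trans
        (.tens (comp₁_one hF) (.refl (wf_comp₁ wGH wT dGH))))
  exact (CellEq.of_cong k).trans (((tens_tau hG hH).tens_left hF.1).trans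
    (.of_cong (Cong3.tens_assoc hF.1 hH.1 hG.1).symm))

/-- Exchange of the first two of three algebraic 3-cells. -/
theorem tens_tau_tens_one {F G H : T3} (hF : Alg K F) (hG : Alg K G) (hH : Alg K H) :
    CellEq K (((F ◦₀ G) ◦₀ H) ◦₁ (T ◦₀ I)) (G ◦₀ (F ◦₀ H)) := by
  have wI : I.WF K := trivial
  have wT : T.WF K := trivial
  have wFG := wf_tens hF.1 hG.1
  have dFG : (F ◦₀ G).src.cod = T.src.dom := congrArg₂ (· + ·) hF.2 hG.2
  have k : Cong3 K (((F ◦₀ G) ◦₀ H) ◦₁ (T ◦₀ I)) (((F ◦₀ G) ◦₁ T) ◦₀ H) :=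
    (Cong3.exchange₀₁ wFG wT hH.1 wI dFG hH.2).symm.trans
      (.tens (.refl (wf_comp₁ wFG wT dFG)) (comp₁_one hH))
  exact (CellEq.of_cong k).trans (((tens_tau hF hG).tens_right hH.1).trans
    (.of_cong (Cong3.tens_assoc hG.1 hF.1 hH.1)))

/-! In the quotient, the 3-cell `α` disappears from the two hexagons. -/

theorem alpha_cong : Cong3 MonCell α (.id α.src) := .collapse ⟨trivial, trivial⟩ trivial

theorem pre_alpha {A : T3} {f : T2} (h : Cong3 MonCell A (.id f)) (d : A.src.cod = 3) :
    Cong3 MonCell (A ◦₁ α) (.id (A ◦₁ α).src) := by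
  have k : Cong3 MonCell (A ◦₁ α) (.id (f ⋆₁ α.src)) :=
    (h.comp₁ alpha_cong d).trans (.id_comp₁_id h.parallel.2.1
      (T3.WF.facts (K := MonCell) (A := α) trivial).1 (h.parallel.2.2.1.cod_eq.symm.trans d))
  exact k.trans (.id k.parallel.2.2.1.symm)

/-- The first hexagon, where every 3-cell built on `α` is an identity. -/
theorem hexagon_left_cong :
    Cong3 MonCell (((I ◦₀ T) ◦₁ (β ◦₀ I) ◦₁ M) ◦₂ ((I ◦₀ β) ◦₁ M)) ((M ◦₀ I) ◦₁ β) := by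
  have h : Cong3 MonCell _ _ := .fourCell .daleth₁
  have hw := h.parallel
  obtain ⟨⟨wP, wQ, c⟩, wR, c'⟩ := hw.1
  obtain ⟨⟨wS, wB, e⟩, wα, e'⟩ := hw.2.1
  have hQ : Cong3 MonCell ((I ◦₀ T) ◦₁ α) (.id ((I ◦₀ T) ◦₁ α).src) :=
    pre_alpha (Cong3.id_tens_id (f := one) (g := tau) trivial trivial) rfl
  have hS : Cong3 MonCell ((I ◦₀ T) ◦₁ (T ◦₀ I) ◦₁ α) (.id ((I ◦₀ T) ◦₁ (T ◦₀ I) ◦₁ α).src) :=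
    pre_alpha (((Cong3.id_tens_id (f := one) (g := tau) trivial trivial).comp₁
      (Cong3.id_tens_id (f := tau) (g := one) trivial trivial) rfl).trans
        (.id_comp₁_id (f := one ⋆₀ tau) (g := tau ⋆₀ one) ⟨trivial, trivial⟩
          ⟨trivial, trivial⟩ rfl)) rfl
  have a := c.trans (hQ.parallel.2.2.2.symm.trans c')
  exact (Cong3.comp₂ (comp_id_of wP c hQ).symm (.refl wR) a).trans
    (h.trans ((comp_id_of (A := _ ◦₂ _) ⟨wS, wB, e⟩ e' alpha_cong).trans (id_comp_of wB e hS)))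

/-- The second hexagon, where every 3-cell built on `α` is an identity and both sides are
inverted. -/
theorem hexagon_right_cong :
    Cong3 MonCell (((T ◦₀ I) ◦₁ (I ◦₀ β) ◦₁ M) ◦₂ ((β ◦₀ I) ◦₁ M)) ((I ◦₀ M) ◦₁ β) := by
  have h : Cong3 MonCell _ _ := .fourCell .daleth₂
  have hw := h.parallel
  obtain ⟨⟨wP, wQ, c⟩, wR, c'⟩ := hw.1
  obtain ⟨⟨wα, wB, e⟩, wS, e'⟩ := hw.2.1
  have hQ : Cong3 MonCell ((T ◦₀ I) ◦₁ α) (.id ((T ◦₀ I) ◦₁ α).src) :=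
    pre_alpha (Cong3.id_tens_id (f := tau) (g := one) trivial trivial) rfl
  have hS : Cong3 MonCell ((T ◦₀ I) ◦₁ (I ◦₀ T) ◦₁ α) (.id ((T ◦₀ I) ◦₁ (I ◦₀ T) ◦₁ α).src) :=
    pre_alpha (((Cong3.id_tens_id (f := tau) (g := one) trivial trivial).comp₁
      (Cong3.id_tens_id (f := one) (g := tau) trivial trivial) rfl).trans
        (.id_comp₁_id (f := tau ⋆₀ one) (g := one ⋆₀ tau) ⟨trivial, trivial⟩
          ⟨trivial, trivial⟩ rfl)) rfl
  have a := c.trans (hQ.parallel.2.2.2.symm.trans c')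
  have k : Cong3 MonCell (((β ◦₀ I) ◦₁ M).inv ◦₂ ((T ◦₀ I) ◦₁ (I ◦₀ β) ◦₁ M).inv)
      ((I ◦₀ M) ◦₁ β).inv :=
    (Cong3.comp₂ (comp_id_of wP c hQ).symm (.refl wR) a).trans
      (h.trans ((comp_id_of (A := α ◦₂ _) ⟨wα, wB, e⟩ e' hS).trans (id_comp_of wB e alpha_cong)))
  exact cong_of_inv ((inv_comp (A := _ ◦₁ _) (B := _ ◦₁ _) wR wP a.symm).trans k)

end Initial

namespace BOne

open TwoMonoid T2 T3 Initial

/-- The morphism of `BOne` given by an algebraic 3-cell. -/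
def mor (A : T3) (h : Alg MonCell A) : BOne.C2 := Initial.cell MonCell A h

theorem mor_eq {A B : T3} {hA : Alg MonCell A} {hB : Alg MonCell B} :
    mor A hA = mor B hB ↔ CellEq MonCell A B := cell_eq

theorem exists_mor (x : BOne.C2) : ∃ A h, x = mor A h := exists_cell x

theorem mor_add {A B : T3} (hA : Alg MonCell A) (hB : Alg MonCell B) :
    mor A hA + mor B hB = mor (prod A B) (hA.prod hB) := rfl

theorem mor_mul {A B : T3} (hA : Alg MonCell A) (hB : Alg MonCell B)
    (e : Cong2 MonCell A.tgt B.src) :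
    mor A hA * mor B hB = mor (A ◦₂ B) ⟨wf_comp₂ hA.1 hB.1 e, hA.2⟩ := by
  have h : BOne.tgt (mor A hA) = BOne.src (mor B hB) := ob_eq.2 (ObEq.of_cong e)
  exact (comp_eq_mul h).symm.trans (comp_cell hA hB e h)

theorem algOb_eq {f g : T2} {hf : f.WF ∧ f.cod = 1} {hg : g.WF ∧ g.cod = 1} :
    algOb f hf = algOb g hg ↔ ObEq MonCell f g := ob_eq

theorem exists_algOb (x : BOne.C1) : ∃ f h, x = algOb f h := exists_ob x

/-- The number of inputs of an object. -/
def dom : BOne.C1 →+ ℕ where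
  toFun := Quotient.lift (fun f => f.1.dom) fun _ _ h => ObEq.dom_eq h
  map_zero' := rfl
  map_add' x y := by
    obtain ⟨f, hf, rfl⟩ := exists_algOb x
    obtain ⟨g, hg, rfl⟩ := exists_algOb y
    rfl

theorem dom_algOb {f : T2} (h : f.WF ∧ f.cod = 1) : dom (algOb f h) = f.dom := rfl

/-- The generating object. -/
def gen : BOne.C1 := algOb one ⟨trivial, rfl⟩

theorem dom_nsmul_gen (n : ℕ) : dom (n • gen) = n := by
  rw [map_nsmul]
  exact Nat.mul_one n

theorem mor_inv_mul {A : T3} (hA : Alg MonCell A) (hA' : Alg MonCell A.inv) :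
    mor A.inv hA' * mor A hA = BOne.id (BOne.tgt (mor A hA)) := by
  exact (mor_mul hA' hA (.refl hA.1.facts.1)).trans (mor_eq.2 (.of_cong (.inv_comp₂ hA.1)))

theorem mor_mul_inv {A : T3} (hA : Alg MonCell A) (hA' : Alg MonCell A.inv) :
    mor A hA * mor A.inv hA' = BOne.id (BOne.src (mor A hA)) := by
  exact (mor_mul hA hA' (.refl hA.1.facts.2.1)).trans (mor_eq.2 (.of_cong (.comp₂_inv hA.1)))

theorem beta_alg {F G : T3} (hF : Alg MonCell F) (hG : Alg MonCell G) :
    Alg MonCell ((F ◦₀ G) ◦₁ β) :=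
  ⟨⟨⟨hF.1, hG.1⟩, trivial, congrArg₂ (· + ·) hF.2 hG.2⟩, rfl⟩

/-- The braiding of two objects, given by algebraic 2-cells. -/
def braiding (f g : T2) (hf : f.WF ∧ f.cod = 1) (hg : g.WF ∧ g.cod = 1) : BOne.C2 :=
  mor ((.id f ◦₀ .id g) ◦₁ β) (beta_alg hf hg)

theorem braiding_eq {f f' g g' : T2} {hf : f.WF ∧ f.cod = 1} {hg : g.WF ∧ g.cod = 1}
    {hf' : f'.WF ∧ f'.cod = 1} {hg' : g'.WF ∧ g'.cod = 1} (h : algOb f hf = algOb f' hf')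
    (k : algOb g hg = algOb g' hg') : braiding f g hf hg = braiding f' g' hf' hg' :=
  mor_eq.2 (((algOb_eq.1 h).id.tens (algOb_eq.1 k).id).comp₁ trivial
    (congrArg₂ (· + ·) hf.2 hg.2))

/-- Both sides are the 3-cell `(A ◦₀ B) ◦₁ β`, cut in the two possible ways. The symmetry in the
source of `β` exchanges the two factors on the left-hand side. -/
theorem braiding_natural {A B : T3} (hA : Alg MonCell A) (hB : Alg MonCell B) :
    (mor B hB + mor A hA) * braiding A.tgt B.tgt hA.tgt hB.tgt =
      braiding A.src B.src ⟨hA.1.facts.1, hA.2⟩ ⟨hB.1.facts.1, hB.2⟩ * (mor A hA + mor B hB) := by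
  have w := wf_tens hA.1 hB.1
  have wβ : β.WF MonCell := trivial
  have wM : M.WF MonCell := trivial
  have wT : T.WF MonCell := trivial
  have d : (A ◦₀ B).src.cod = 2 := congrArg₂ (· + ·) hA.2 hB.2
  have wX : ((A ◦₀ B) ◦₁ .id (tau ⋆₁ mu)).WF MonCell :=
    wf_comp₁ w (wf_id (f := tau ⋆₁ mu) ⟨trivial, trivial, rfl⟩) d
  have hX : CellEq MonCell ((A ◦₀ B) ◦₁ .id (tau ⋆₁ mu)) (prod B A) :=
    (CellEq.of_cong (((Cong3.refl w).comp₁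
      (Cong3.id_comp₁_id (f := tau) (g := mu) trivial trivial rfl).symm d).trans
        (Cong3.comp₁_assoc w wT wM d rfl).symm)).trans ((tens_tau hA hB).comp₁ wM rfl)
  have s : Cong3 MonCell (.id (A ◦₀ B).src) (.id A.src ◦₀ .id B.src) :=
    (Cong3.id_tens_id hA.1.facts.1 hB.1.facts.1).symm
  have t : Cong3 MonCell (.id (A ◦₀ B).tgt) (.id A.tgt ◦₀ .id B.tgt) :=
    (Cong3.id_tens_id hA.1.facts.2.1 hB.1.facts.2.1).symm
  have d' : (A ◦₀ B).tgt.cod = 2 := w.facts.2.2.2.symm.trans d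
  have sβ := s.comp₁ (.refl wβ) d
  have tβ := t.comp₁ (.refl wβ) d'
  have c1 := (comp₁_cut w wβ d).parallel.2.1.2.2
  have c2 := (comp₁_cut' w wβ d).parallel.2.1.2.2
  have e1 : mor B hB + mor A hA = mor ((A ◦₀ B) ◦₁ .id (tau ⋆₁ mu)) ⟨wX, rfl⟩ := mor_eq.2 hX.symm
  have e2 : braiding A.tgt B.tgt hA.tgt hB.tgt = mor (.id (A ◦₀ B).tgt ◦₁ β) ⟨tβ.parallel.1, rfl⟩ :=
    mor_eq.2 (.of_cong tβ.symm)
  have e3 : braiding A.src B.src ⟨hA.1.facts.1, hA.2⟩ ⟨hB.1.facts.1, hB.2⟩ =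
      mor (.id (A ◦₀ B).src ◦₁ β) ⟨sβ.parallel.1, rfl⟩ := mor_eq.2 (.of_cong sβ.symm)
  exact (congrArg₂ (· * ·) e1 e2).trans ((mor_mul _ _ c1).trans
    ((mor_eq.2 (.of_cong ((comp₁_cut w wβ d).symm.trans (comp₁_cut' w wβ d)))).trans
      ((mor_mul _ (hA.prod hB) c2).symm.trans (congrArg (· * _) e3.symm))))

/-- The braiding of a product with an object. -/
theorem hexagon_left {f g h : T2} (hf : f.WF ∧ f.cod = 1) (hg : g.WF ∧ g.cod = 1)
    (hh : h.WF ∧ h.cod = 1) :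
    braiding ((f ⋆₀ g) ⋆₁ mu) h ⟨⟨⟨hf.1, hg.1⟩, trivial, congrArg₂ (· + ·) hf.2 hg.2⟩, rfl⟩ hh =
      (braiding f h hf hh + BOne.id (algOb g hg)) *
        (BOne.id (algOb f hf) + braiding g h hg hh) := by
  have aF : Alg MonCell (.id f) := hf
  have aG : Alg MonCell (.id g) := hg
  have aH : Alg MonCell (.id h) := hh
  have wI : I.WF MonCell := trivial
  have wM : M.WF MonCell := trivial
  have wT : T.WF MonCell := trivial
  have wβ : β.WF MonCell := trivial
  have wfg : (f ⋆₀ g).WF := ⟨hf.1, hg.1⟩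
  have we : (f ⋆₀ g ⋆₀ h).WF := ⟨wfg, hh.1⟩
  have d : (f ⋆₀ g ⋆₀ h).cod = 3 := congrArg₂ (· + ·) (congrArg₂ (· + ·) hf.2 hg.2) hh.2
  have s : Cong3 MonCell (.id (f ⋆₀ g ⋆₀ h)) ((.id f ◦₀ .id g) ◦₀ .id h) :=
    ((Cong3.tens (.id_tens_id hf.1 hg.1) (.refl aH.1)).trans (.id_tens_id wfg hh.1)).symm
  obtain ⟨wP, wR, c⟩ := hexagon_left_cong.parallel.1
  have k0 := (pre_comp₂ we wP wR c d).symm.trans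
    ((Cong3.refl (wf_id we)).comp₁ hexagon_left_cong d)
  have k1 : Cong3 MonCell (.id (f ⋆₀ g ⋆₀ h) ◦₁ ((M ◦₀ I) ◦₁ β))
      ((.id ((f ⋆₀ g) ⋆₁ mu) ◦₀ .id h) ◦₁ β) :=
    ((s.comp₁ (.refl (wf_comp₁ (wf_tens wM wI) wβ rfl)) d).trans
      (pre_left aF aG aH wM wβ rfl rfl rfl)).trans
      (.comp₁ (.tens (((Cong3.id_tens_id hf.1 hg.1).comp₁ (.refl wM)
        (congrArg₂ (· + ·) hf.2 hg.2)).trans (.id_comp₁_id wfg trivial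
          (congrArg₂ (· + ·) hf.2 hg.2))) (.refl aH.1)) (.refl wβ) (congrArg (1 + ·) hh.2))
  have k2 : CellEq MonCell (.id (f ⋆₀ g ⋆₀ h) ◦₁ ((I ◦₀ T) ◦₁ (β ◦₀ I) ◦₁ M))
      (prod ((.id f ◦₀ .id h) ◦₁ β) (.id g)) := by
    have d' : ((T3.id f ◦₀ .id g) ◦₀ .id h).src.cod = (I ◦₀ T).src.dom := d
    have w' : ((T3.id f ◦₀ .id g) ◦₀ .id h).WF MonCell := ⟨⟨hf.1, hg.1⟩, hh.1⟩
    have wβM : ((β ◦₀ I) ◦₁ M).WF MonCell := wf_comp₁ (wf_tens wβ wI) wM rfl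
    have k : Cong3 MonCell (.id (f ⋆₀ g ⋆₀ h) ◦₁ ((I ◦₀ T) ◦₁ (β ◦₀ I) ◦₁ M))
        ((((.id f ◦₀ .id g) ◦₀ .id h) ◦₁ (I ◦₀ T)) ◦₁ ((β ◦₀ I) ◦₁ M)) :=
      (s.comp₁ (Cong3.comp₁_assoc (wf_tens wI wT) (wf_tens wβ wI) wM rfl rfl) d).trans
        (Cong3.comp₁_assoc w' (wf_tens wI wT) wβM d' rfl).symm
    exact (CellEq.of_cong k).trans (((tens_one_tens_tau aF aG aH).comp₁ wβM rfl).trans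
      (.of_cong (pre_left aF aH aG wβ wM rfl rfl rfl)))
  have k3 : Cong3 MonCell (.id (f ⋆₀ g ⋆₀ h) ◦₁ ((I ◦₀ β) ◦₁ M))
      (prod (.id f) ((.id g ◦₀ .id h) ◦₁ β)) :=
    ((s.trans (.tens_assoc aF.1 aG.1 aH.1)).comp₁
      (.refl (wf_comp₁ (wf_tens wI wβ) wM rfl)) d).trans (pre_right aF aG aH wβ wM rfl rfl rfl)
  have e1 : braiding f h hf hh + BOne.id (algOb g hg) =
      mor _ ⟨k2.wf_left, rfl⟩ := mor_eq.2 k2.symm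
  have e2 : BOne.id (algOb f hf) + braiding g h hg hh = mor _ ⟨k3.parallel.1, rfl⟩ :=
    mor_eq.2 (.of_cong k3.symm)
  exact (mor_eq.2 (.of_cong (k1.symm.trans k0.symm))).trans
    ((mor_mul _ _ k0.parallel.1.2.2).symm.trans (congrArg₂ (· * ·) e1.symm e2.symm))

/-- The braiding of an object with a product. -/
theorem hexagon_right {f g h : T2} (hf : f.WF ∧ f.cod = 1) (hg : g.WF ∧ g.cod = 1)
    (hh : h.WF ∧ h.cod = 1) :
    braiding f ((g ⋆₀ h) ⋆₁ mu) hf ⟨⟨⟨hg.1, hh.1⟩, trivial, congrArg₂ (· + ·) hg.2 hh.2⟩, rfl⟩ =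
      (BOne.id (algOb g hg) + braiding f h hf hh) *
        (braiding f g hf hg + BOne.id (algOb h hh)) := by
  have aF : Alg MonCell (.id f) := hf
  have aG : Alg MonCell (.id g) := hg
  have aH : Alg MonCell (.id h) := hh
  have wI : I.WF MonCell := trivial
  have wM : M.WF MonCell := trivial
  have wT : T.WF MonCell := trivial
  have wβ : β.WF MonCell := trivial
  have wfg : (f ⋆₀ g).WF := ⟨hf.1, hg.1⟩
  have wgh : (g ⋆₀ h).WF := ⟨hg.1, hh.1⟩
  have we : (f ⋆₀ g ⋆₀ h).WF := ⟨wfg, hh.1⟩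
  have d : (f ⋆₀ g ⋆₀ h).cod = 3 := congrArg₂ (· + ·) (congrArg₂ (· + ·) hf.2 hg.2) hh.2
  have s : Cong3 MonCell (.id (f ⋆₀ g ⋆₀ h)) ((.id f ◦₀ .id g) ◦₀ .id h) :=
    ((Cong3.tens (.id_tens_id hf.1 hg.1) (.refl aH.1)).trans (.id_tens_id wfg hh.1)).symm
  obtain ⟨wP, wR, c⟩ := hexagon_right_cong.parallel.1
  have k0 := (pre_comp₂ we wP wR c d).symm.trans
    ((Cong3.refl (wf_id we)).comp₁ hexagon_right_cong d)
  have k1 : Cong3 MonCell (.id (f ⋆₀ g ⋆₀ h) ◦₁ ((I ◦₀ M) ◦₁ β))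
      ((.id f ◦₀ .id ((g ⋆₀ h) ⋆₁ mu)) ◦₁ β) :=
    (((s.trans (.tens_assoc aF.1 aG.1 aH.1)).comp₁
      (.refl (wf_comp₁ (wf_tens wI wM) wβ rfl)) d).trans
      (pre_right aF aG aH wM wβ rfl rfl rfl)).trans
      (.comp₁ (.tens (.refl aF.1) (((Cong3.id_tens_id hg.1 hh.1).comp₁ (.refl wM)
        (congrArg₂ (· + ·) hg.2 hh.2)).trans (.id_comp₁_id wgh trivial
          (congrArg₂ (· + ·) hg.2 hh.2)))) (.refl wβ) (congrArg (· + 1) hf.2))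
  have k2 : CellEq MonCell (.id (f ⋆₀ g ⋆₀ h) ◦₁ ((T ◦₀ I) ◦₁ (I ◦₀ β) ◦₁ M))
      (prod (.id g) ((.id f ◦₀ .id h) ◦₁ β)) := by
    have d' : ((T3.id f ◦₀ .id g) ◦₀ .id h).src.cod = (T ◦₀ I).src.dom := d
    have w' : ((T3.id f ◦₀ .id g) ◦₀ .id h).WF MonCell := ⟨⟨hf.1, hg.1⟩, hh.1⟩
    have wβM : ((I ◦₀ β) ◦₁ M).WF MonCell := wf_comp₁ (wf_tens wI wβ) wM rfl
    have k : Cong3 MonCell (.id (f ⋆₀ g ⋆₀ h) ◦₁ ((T ◦₀ I) ◦₁ (I ◦₀ β) ◦₁ M))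
        ((((.id f ◦₀ .id g) ◦₀ .id h) ◦₁ (T ◦₀ I)) ◦₁ ((I ◦₀ β) ◦₁ M)) :=
      (s.comp₁ (Cong3.comp₁_assoc (wf_tens wT wI) (wf_tens wI wβ) wM rfl rfl) d).trans
        (Cong3.comp₁_assoc w' (wf_tens wT wI) wβM d' rfl).symm
    exact (CellEq.of_cong k).trans (((tens_tau_tens_one aF aG aH).comp₁ wβM rfl).trans
      (.of_cong (pre_right aG aF aH wβ wM rfl rfl rfl)))
  have k3 : Cong3 MonCell (.id (f ⋆₀ g ⋆₀ h) ◦₁ ((β ◦₀ I) ◦₁ M))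
      (prod ((.id f ◦₀ .id g) ◦₁ β) (.id h)) :=
    (s.comp₁ (.refl (wf_comp₁ (wf_tens wβ wI) wM rfl)) d).trans
      (pre_left aF aG aH wβ wM rfl rfl rfl)
  have e1 : BOne.id (algOb g hg) + braiding f h hf hh =
      mor _ ⟨k2.wf_left, rfl⟩ := mor_eq.2 k2.symm
  have e2 : braiding f g hf hg + BOne.id (algOb h hh) = mor _ ⟨k3.parallel.1, rfl⟩ :=
    mor_eq.2 (.of_cong k3.symm)
  exact (mor_eq.2 (.of_cong (k1.symm.trans k0.symm))).trans
    ((mor_mul _ _ k0.parallel.1.2.2).symm.trans (congrArg₂ (· * ·) e1.symm e2.symm))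

theorem betaCell_eq : betaCell = braiding one one ⟨trivial, rfl⟩ ⟨trivial, rfl⟩ :=
  mor_eq.2 (.of_cong (((Cong3.comp₁ ((Cong3.id_tens_id (f := one) (g := one) trivial trivial).trans
    (.id (.id_tens_id 1 1))) (.refl (A := β) trivial) rfl).trans
      (Cong3.id_comp₁ (A := β) trivial)).symm))

end BOne

/-! ### From braids to `BOne` -/

namespace BOne

open TwoMonoid T2 T3 Initial

theorem tauMu_wf : (tau ⋆₁ mu).WF ∧ (tau ⋆₁ mu).cod = 1 := ⟨⟨trivial, trivial, rfl⟩, rfl⟩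

theorem algOb_mu : algOb mu ⟨trivial, rfl⟩ = gen + gen :=
  algOb_eq.2 (.of_cong ((Cong.comp (.id_tens_id 1 1) (.refl (f := mu) trivial) rfl).trans
    (.id_comp (f := mu) trivial)).symm)

theorem algOb_tau_mu : algOb (tau ⋆₁ mu) tauMu_wf = gen + gen :=
  (algOb_eq.2 ⟨tau, trivial, trivial, rfl, .refl tauMu_wf.1⟩).trans algOb_mu

theorem src_beta : BOne.src betaCell = gen + gen := algOb_tau_mu

theorem tgt_beta : BOne.tgt betaCell = gen + gen := algOb_mu

theorem src_betaInv : BOne.src betaInvCell = gen + gen := algOb_mu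

theorem tgt_betaInv : BOne.tgt betaInvCell = gen + gen := algOb_tau_mu

theorem beta_mul_betaInv : betaCell * betaInvCell = BOne.id (gen + gen) :=
  (mor_mul_inv (A := β) ⟨trivial, rfl⟩ ⟨trivial, rfl⟩).trans (congrArg BOne.id src_beta)

theorem betaInv_mul_beta : betaInvCell * betaCell = BOne.id (gen + gen) :=
  (mor_inv_mul (A := β) ⟨trivial, rfl⟩ ⟨trivial, rfl⟩).trans (congrArg BOne.id tgt_beta)

/-- The naturality of the braiding at `β` itself, together with the hexagon, is the braid
relation. -/
theorem beta_yang_baxter :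
    (betaCell + BOne.id gen) * ((BOne.id gen + betaCell) * (betaCell + BOne.id gen)) =
      (BOne.id gen + betaCell) * ((betaCell + BOne.id gen) * (BOne.id gen + betaCell)) := by
  have h1 := hexagon_left (f := one) (g := one) (h := one) ⟨trivial, rfl⟩ ⟨trivial, rfl⟩
    ⟨trivial, rfl⟩
  rw [← betaCell_eq] at h1
  have h2 := braiding_natural (A := β) (B := I) ⟨trivial, rfl⟩ ⟨trivial, rfl⟩
  have e1 : braiding mu one ⟨trivial, rfl⟩ ⟨trivial, rfl⟩ = _ :=
    (braiding_eq (f' := (one ⋆₀ one) ⋆₁ mu) (g := one) (g' := one)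
      (hf' := ⟨⟨⟨trivial, trivial⟩, trivial, rfl⟩, rfl⟩)
      (hg := ⟨trivial, rfl⟩) (hg' := ⟨trivial, rfl⟩) algOb_mu rfl).trans h1
  have e2 : braiding (tau ⋆₁ mu) one tauMu_wf ⟨trivial, rfl⟩ = _ :=
    (braiding_eq (f' := (one ⋆₀ one) ⋆₁ mu) (g := one) (g' := one)
      (hf' := ⟨⟨⟨trivial, trivial⟩, trivial, rfl⟩, rfl⟩)
      (hg := ⟨trivial, rfl⟩) (hg' := ⟨trivial, rfl⟩) algOb_tau_mu rfl).trans h1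
  have h3 : (BOne.id gen + betaCell) * ((betaCell + BOne.id gen) * (BOne.id gen + betaCell)) =
      (betaCell + BOne.id gen) * (BOne.id gen + betaCell) * (betaCell + BOne.id gen) :=
    (congrArg ((BOne.id gen + betaCell) * ·) e1.symm).trans (h2.trans
      (congrArg (· * (betaCell + BOne.id gen)) e2))
  rw [h3, mul_assoc_of]
  · rw [tgt_add, src_add, src_beta, tgt_beta, BOne.src_id, BOne.tgt_id, add_assoc]
  · rw [tgt_add, src_add, src_beta, tgt_beta, BOne.src_id, BOne.tgt_id, add_assoc]

/-- The morphism of `BOne` given by a term in the two crossings. -/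
noncomputable def morOfTerm : Term crossingSig → BOne.C2
  | .gen .pos => betaCell
  | .gen .neg => betaInvCell
  | .id n => BOne.id (n • gen)
  | .tens f g => morOfTerm f + morOfTerm g
  | .comp f g => morOfTerm g * morOfTerm f

theorem src_tgt_morOfTerm {t : Term crossingSig} (h : t.WF) :
    BOne.src (morOfTerm t) = t.dom • gen ∧ BOne.tgt (morOfTerm t) = t.dom • gen := by
  induction t with
  | gen g =>
    have e : (2 : ℕ) • gen = gen + gen := two_nsmul gen
    cases g
    · exact ⟨src_beta.trans e.symm, tgt_beta.trans e.symm⟩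
    · exact ⟨src_betaInv.trans e.symm, tgt_betaInv.trans e.symm⟩
  | id n => exact ⟨BOne.src_id _, BOne.tgt_id _⟩
  | tens f g hf hg =>
    obtain ⟨a, b⟩ := hf h.1
    obtain ⟨c, d⟩ := hg h.2
    exact ⟨(src_add _ _).trans (by rw [a, c, ← add_nsmul]; rfl),
      (tgt_add _ _).trans (by rw [b, d, ← add_nsmul]; rfl)⟩
  | comp f g hf hg =>
    obtain ⟨a, b⟩ := hf h.1
    obtain ⟨c, d⟩ := hg h.2.1
    have e : g.dom = f.dom := h.2.2.symm.trans (Braids.dom_eq_cod h.1).symm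
    refine ⟨(src_mul _ _).trans (c.trans (by rw [e]; rfl)), (tgt_mul ?_).trans b⟩
    rw [d, a, e]

theorem morOfTerm_composable {f g : Term crossingSig} (hf : f.WF) (hg : g.WF) (h : f.cod = g.dom) :
    BOne.tgt (morOfTerm g) = BOne.src (morOfTerm f) := by
  rw [(src_tgt_morOfTerm hg).2, (src_tgt_morOfTerm hf).1, Braids.dom_eq_cod hf, h]

theorem morOfTerm_cong {f g : Term crossingSig} (h : Cong Brd.Rel f g) :
    morOfTerm f = morOfTerm g := by
  induction h with
  | of h =>
    have e1 : morOfTerm Brd.one = BOne.id gen := congrArg BOne.id (one_nsmul gen)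
    have e2 : morOfTerm (.id 2) = BOne.id (gen + gen) := congrArg BOne.id (two_nsmul gen)
    cases h with
    | pos_neg => exact betaInv_mul_beta.trans e2.symm
    | neg_pos => exact beta_mul_betaInv.trans e2.symm
    | yang_baxter =>
      simp only [morOfTerm, e1]
      exact beta_yang_baxter
  | refl => rfl
  | symm _ ih => exact ih.symm
  | trans _ _ ih ih' => exact ih.trans ih'
  | tens _ _ ih ih' => exact congrArg₂ (· + ·) ih ih'
  | comp _ _ _ ih ih' => exact congrArg₂ (· * ·) ih' ih
  | tens_assoc => exact add_assoc _ _ _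
  | id_tens => exact (congrArg (· + _) (congrArg BOne.id (zero_nsmul gen))).trans (zero_add _)
  | tens_id => exact (congrArg (_ + ·) (congrArg BOne.id (zero_nsmul gen))).trans (add_zero _)
  | id_tens_id m n => exact (id_add_id _ _).trans (congrArg BOne.id (add_nsmul gen m n).symm)
  | comp_assoc hf hg hh e e' =>
    exact (mul_assoc_of (morOfTerm_composable hg hh e') (morOfTerm_composable hf hg e)).symm
  | id_comp hf => exact mul_id (src_tgt_morOfTerm hf).2
  | comp_id hf =>
    exact id_mul ((src_tgt_morOfTerm hf).1.trans (congrArg (· • gen) (Braids.dom_eq_cod hf)))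
  | interchange hf hf' hg hg' e e' =>
    exact (add_mul_add_of (morOfTerm_composable hf hf' e) (morOfTerm_composable hg hg' e')).symm

/-- The morphism of `BOne` given by a braid. -/
noncomputable def ofBraid (x : Braids.C2) : BOne.C2 :=
  Quotient.lift (s := Presented.cellSetoid Brd.Rel) (fun t => morOfTerm t.1)
    (fun _ _ h => morOfTerm_cong h) x

theorem ofBraid_pos : ofBraid Braids.pos = betaCell := rfl

theorem ofBraid_strand (n : ℕ) : ofBraid (Braids.strand n) = BOne.id (n • gen) := rfl

theorem ofBraid_add (x y : Braids.C2) : ofBraid (x + y) = ofBraid x + ofBraid y := by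
  obtain ⟨s, hs, rfl⟩ := Braids.exists_mk x
  obtain ⟨t, ht, rfl⟩ := Braids.exists_mk y
  rfl

theorem src_ofBraid (x : Braids.C2) : BOne.src (ofBraid x) = Braids.deg x • gen := by
  obtain ⟨t, ht, rfl⟩ := Braids.exists_mk x
  rw [Braids.deg_mk]
  exact (src_tgt_morOfTerm ht).1

theorem tgt_ofBraid (x : Braids.C2) : BOne.tgt (ofBraid x) = Braids.deg x • gen := by
  obtain ⟨t, ht, rfl⟩ := Braids.exists_mk x
  rw [Braids.deg_mk]
  exact (src_tgt_morOfTerm ht).2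

theorem ofBraid_mul {x y : Braids.C2} (h : Braids.deg x = Braids.deg y) :
    ofBraid (x * y) = ofBraid x * ofBraid y := by
  obtain ⟨s, hs, rfl⟩ := Braids.exists_mk x
  obtain ⟨t, ht, rfl⟩ := Braids.exists_mk y
  rw [Braids.deg_mk, Braids.deg_mk] at h
  rw [Braids.mk_mul ht hs ((Braids.dom_eq_cod ht).symm.trans h.symm)]
  rfl

end BOne

/-! ### Every braiding of objects is a braid -/

namespace BOne

open TwoMonoid T2 T3 Initial

/-- The morphisms of `BOne` that come from braids. -/
def IsBraid (x : BOne.C2) : Prop := ∃ y, ofBraid y = x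

theorem isBraid_id (n : ℕ) : IsBraid (BOne.id (n • gen)) := ⟨_, ofBraid_strand n⟩

theorem isBraid_id_gen : IsBraid (BOne.id gen) :=
  ⟨Braids.strand 1, congrArg BOne.id (one_nsmul gen)⟩

theorem IsBraid.add {x y : BOne.C2} (hx : IsBraid x) (hy : IsBraid y) : IsBraid (x + y) := by
  obtain ⟨a, rfl⟩ := hx
  obtain ⟨b, rfl⟩ := hy
  exact ⟨a + b, ofBraid_add a b⟩

theorem IsBraid.src_eq {x : BOne.C2} (hx : IsBraid x) :
    BOne.src x = dom (BOne.src x) • gen := by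
  obtain ⟨a, rfl⟩ := hx
  rw [src_ofBraid, dom_nsmul_gen]

theorem IsBraid.tgt_eq {x : BOne.C2} (hx : IsBraid x) : BOne.tgt x = BOne.src x := by
  obtain ⟨a, rfl⟩ := hx
  rw [src_ofBraid, tgt_ofBraid]

theorem IsBraid.mul {x y : BOne.C2} (hx : IsBraid x) (hy : IsBraid y)
    (h : dom (BOne.src x) = dom (BOne.src y)) : IsBraid (x * y) := by
  obtain ⟨a, rfl⟩ := hx
  obtain ⟨b, rfl⟩ := hy
  refine ⟨a * b, ofBraid_mul ?_⟩
  simpa only [src_ofBraid, dom_nsmul_gen] using h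

theorem dom_src_braiding {f g : T2} (hf : f.WF ∧ f.cod = 1) (hg : g.WF ∧ g.cod = 1) :
    dom (BOne.src (braiding f g hf hg)) = f.dom + g.dom := rfl

theorem tgt_braiding {f g : T2} (hf : f.WF ∧ f.cod = 1) (hg : g.WF ∧ g.cod = 1) :
    BOne.tgt (braiding f g hf hg) = algOb f hf + algOb g hg := rfl

theorem src_braiding {f g : T2} (hf : f.WF ∧ f.cod = 1) (hg : g.WF ∧ g.cod = 1) :
    BOne.src (braiding f g hf hg) = algOb g hg + algOb f hf := by
  have wf : (T3.id f).WF MonCell := hf.1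
  have wg : (T3.id g).WF MonCell := hg.1
  have wT : T.WF MonCell := trivial
  have wM : M.WF MonCell := trivial
  have d : (T3.id f ◦₀ .id g).src.cod = 2 := congrArg₂ (· + ·) hf.2 hg.2
  exact algOb_eq.2 (((CellEq.of_cong (Cong3.comp₁_assoc (wf_tens wf wg) wT wM d rfl).symm).trans
    ((tens_tau (K := MonCell) (A := .id f) (B := .id g) hf hg).comp₁ wM rfl)).facts.2.2.1)

/-- An invertible idempotent is an identity. -/
theorem eq_id_of_idempotent {A : T3} (hA : Alg MonCell A)
    (e : BOne.tgt (mor A hA) = BOne.src (mor A hA)) (h : mor A hA = mor A hA * mor A hA) :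
    mor A hA = BOne.id (BOne.src (mor A hA)) := by
  have hA' : Alg MonCell A.inv := ⟨hA.1, hA.tgt.2⟩
  have k := mor_mul_inv hA hA'
  have k' : mor A hA * mor A hA * mor A.inv hA' = mor A hA * (mor A hA * mor A.inv hA') :=
    mul_assoc_of e rfl
  rw [← h, k, mul_id e] at k'
  exact k'.symm

theorem eta_alg : eta.WF ∧ eta.cod = 1 := ⟨trivial, rfl⟩

theorem one_alg : one.WF ∧ one.cod = 1 := ⟨trivial, rfl⟩

theorem prod_alg {f g : T2} (hf : f.WF ∧ f.cod = 1) (hg : g.WF ∧ g.cod = 1) :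
    ((f ⋆₀ g) ⋆₁ mu).WF ∧ ((f ⋆₀ g) ⋆₁ mu).cod = 1 :=
  ⟨⟨⟨hf.1, hg.1⟩, trivial, congrArg₂ (· + ·) hf.2 hg.2⟩, rfl⟩

/-- The hexagon with two units makes this braiding idempotent, and it is invertible. -/
theorem braiding_eta {f : T2} (hf : f.WF ∧ f.cod = 1) :
    braiding f eta hf eta_alg = BOne.id (algOb f hf) := by
  have e : BOne.src (braiding f eta hf eta_alg) = algOb f hf :=
    (src_braiding hf eta_alg).trans (zero_add _)
  have h : braiding f eta hf eta_alg = braiding f eta hf eta_alg * braiding f eta hf eta_alg :=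
    (braiding_eq (hg' := prod_alg eta_alg eta_alg) rfl (zero_add (0 : BOne.C1)).symm).trans
      ((hexagon_right hf eta_alg eta_alg).trans
        (congrArg₂ (· * ·) (zero_add (M := BOne.C2) _) (add_zero (M := BOne.C2) _)))
  refine (eq_id_of_idempotent _ ?_ h).trans (congrArg BOne.id e)
  exact (tgt_braiding hf eta_alg).trans ((add_zero _).trans e.symm)

theorem eta_braiding {f : T2} (hf : f.WF ∧ f.cod = 1) :
    braiding eta f eta_alg hf = BOne.id (algOb f hf) := by
  have e : BOne.src (braiding eta f eta_alg hf) = algOb f hf :=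
    (src_braiding eta_alg hf).trans (add_zero _)
  have h : braiding eta f eta_alg hf = braiding eta f eta_alg hf * braiding eta f eta_alg hf :=
    (braiding_eq (hf' := prod_alg eta_alg eta_alg) (zero_add (0 : BOne.C1)).symm rfl).trans
      ((hexagon_left eta_alg eta_alg hf).trans
        (congrArg₂ (· * ·) (add_zero (M := BOne.C2) _) (zero_add (M := BOne.C2) _)))
  refine (eq_id_of_idempotent _ ?_ h).trans (congrArg BOne.id e)
  exact (tgt_braiding eta_alg hf).trans ((zero_add _).trans e.symm)

/-- The product of `n` copies of the generating object, bracketed to the left. -/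
def power : ℕ → T2
  | 0 => eta
  | n + 1 => (power n ⋆₀ one) ⋆₁ mu

theorem power_alg (n : ℕ) : (power n).WF ∧ (power n).cod = 1 := by
  induction n with
  | zero => exact eta_alg
  | succ n ih => exact prod_alg ih one_alg

theorem algOb_power (n : ℕ) : algOb (power n) (power_alg n) = n • gen := by
  induction n with
  | zero => exact (zero_nsmul gen).symm
  | succ n ih => exact (congrArg (· + gen) ih).trans (succ_nsmul gen n).symm

theorem isBraid_id_power (n : ℕ) : IsBraid (BOne.id (algOb (power n) (power_alg n))) := by
  rw [algOb_power]
  exact isBraid_id n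

theorem dom_src_id_add (f : T2) (hf : f.WF ∧ f.cod = 1) (x : BOne.C2) :
    dom (BOne.src (BOne.id (algOb f hf) + x)) = f.dom + dom (BOne.src x) := by
  rw [src_add, map_add, BOne.src_id, dom_algOb]

theorem dom_src_add_id (f : T2) (hf : f.WF ∧ f.cod = 1) (x : BOne.C2) :
    dom (BOne.src (x + BOne.id (algOb f hf))) = dom (BOne.src x) + f.dom := by
  rw [src_add, map_add, BOne.src_id, dom_algOb]

theorem isBraid_braiding_one (n : ℕ) :
    IsBraid (braiding one (power n) one_alg (power_alg n)) := by
  induction n with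
  | zero => exact (braiding_eta one_alg).symm ▸ isBraid_id_gen
  | succ n ih =>
    have h := hexagon_right one_alg (power_alg n) one_alg
    refine h.symm ▸ IsBraid.mul ?_ ?_ ?_
    · exact (isBraid_id_power n).add (betaCell_eq ▸ ⟨_, ofBraid_pos⟩)
    · exact ih.add isBraid_id_gen
    · rw [dom_src_id_add, dom_src_add_id, dom_src_braiding, dom_src_braiding]
      simp only [one, Term.dom]
      omega

theorem isBraid_braiding_power (m n : ℕ) :
    IsBraid (braiding (power m) (power n) (power_alg m) (power_alg n)) := by
  induction m with
  | zero => exact (eta_braiding (power_alg n)).symm ▸ isBraid_id_power n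
  | succ m ih =>
    have h := hexagon_left (power_alg m) one_alg (power_alg n)
    refine h.symm ▸ IsBraid.mul ?_ ?_ ?_
    · exact ih.add isBraid_id_gen
    · exact (isBraid_id_power m).add (isBraid_braiding_one n)
    · rw [dom_src_id_add, dom_src_add_id, dom_src_braiding, dom_src_braiding]
      simp only [one, Term.dom]
      omega

theorem isBraid_braiding {f g : T2} (hf : f.WF ∧ f.cod = 1) (hg : g.WF ∧ g.cod = 1)
    (ef : algOb f hf = f.dom • gen) (eg : algOb g hg = g.dom • gen) :
    IsBraid (braiding f g hf hg) := by
  rw [braiding_eq (ef.trans (algOb_power _).symm) (eg.trans (algOb_power _).symm)]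
  exact isBraid_braiding_power _ _

end BOne

/-! ### Every morphism of `BOne` is a braid -/

namespace BOne

open TwoMonoid T2 T3 Initial

/-- The algebraic 3-cells whose class comes from a braid. -/
def Generated (A : T3) : Prop := ∃ h : Alg MonCell A, IsBraid (mor A h)

namespace Generated

variable {A B : T3}

theorem congr (h : Generated A) (k : CellEq MonCell A B) : Generated B :=
  ⟨k.alg h.1, (mor_eq (hA := h.1) (hB := k.alg h.1)).2 k ▸ h.2⟩

theorem wf (h : Generated A) : A.WF MonCell := h.1.1

theorem algOb_src (h : Generated A) :
    algOb A.src ⟨h.wf.facts.1, h.1.2⟩ = A.src.dom • gen := h.2.src_eq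

theorem algOb_tgt (h : Generated A) : algOb A.tgt h.1.tgt = A.src.dom • gen :=
  h.2.tgt_eq.trans h.2.src_eq

theorem obEq (hA : Generated A) (hB : Generated B) (d : A.src.dom = B.src.dom) :
    ObEq MonCell A.tgt B.src :=
  algOb_eq.1 (hA.algOb_tgt.trans ((congrArg (· • gen) d).trans hB.algOb_src.symm))

theorem prod (hA : Generated A) (hB : Generated B) : Generated (prod A B) :=
  ⟨hA.1.prod hB.1, hA.2.add hB.2⟩

theorem comp₂ (hA : Generated A) (hB : Generated B) (e : Cong2 MonCell A.tgt B.src) :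
    Generated (A ◦₂ B) :=
  ⟨⟨wf_comp₂ hA.wf hB.wf e, hA.1.2⟩, mor_mul hA.1 hB.1 e ▸
    hA.2.mul hB.2 (hA.wf.facts.2.2.1.trans e.dom_eq)⟩

theorem id_tgt (h : Generated A) : Generated (.id A.tgt) :=
  ⟨h.1.tgt, Braids.strand A.src.dom, congrArg BOne.id h.algOb_tgt.symm⟩

theorem inv (h : Generated A) : Generated A.inv := by
  have hA' : Alg MonCell A.inv := ⟨h.wf, h.1.tgt.2⟩
  obtain ⟨x, hx⟩ := h.2
  have d := congrArg BOne.src hx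
  have d' := congrArg BOne.tgt hx
  rw [src_ofBraid] at d
  rw [tgt_ofBraid] at d'
  have k : mor A h.1 * ofBraid x⁻¹ = BOne.id (BOne.src (mor A h.1)) := by
    rw [← hx, ← ofBraid_mul (Braids.deg_inv x).symm, Braids.mul_inv, ofBraid_strand, src_ofBraid]
  refine ⟨hA', x⁻¹, (inverse_unique (x := mor A h.1) rfl ?_ (mor_inv_mul h.1 hA') k).symm⟩
  rw [src_ofBraid, Braids.deg_inv, d']

end Generated

theorem generated_one : Generated I := ⟨one_alg, isBraid_id_gen⟩

theorem generated_eta : Generated E := ⟨eta_alg, isBraid_id_power 0⟩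

/-- The product `⋆₀` of a list of 3-cells. -/
def tens3 : List T3 → T3
  | [] => .id (.id 0)
  | A :: As => A ◦₀ tens3 As

theorem wf_tens3 {As : List T3} (h : ∀ A ∈ As, Generated A) : (tens3 As).WF MonCell := by
  induction As with
  | nil => trivial
  | cons A As ih =>
    rw [List.forall_mem_cons] at h
    exact ⟨h.1.wf, ih h.2⟩

theorem cod_tens3 {As : List T3} (h : ∀ A ∈ As, Generated A) :
    (tens3 As).src.cod = As.length := by
  induction As with
  | nil => rfl
  | cons A As ih =>
    rw [List.forall_mem_cons] at h
    exact (congrArg₂ (· + ·) h.1.1.2 (ih h.2)).trans (Nat.add_comm _ _)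

theorem tens3_append {As Bs : List T3} (h : ∀ A ∈ As, Generated A) (k : ∀ B ∈ Bs, Generated B) :
    Cong3 MonCell (tens3 As ◦₀ tens3 Bs) (tens3 (As ++ Bs)) := by
  induction As with
  | nil => exact .id_tens (wf_tens3 k)
  | cons A As ih =>
    rw [List.forall_mem_cons] at h
    exact (Cong3.tens_assoc h.1.wf (wf_tens3 h.2) (wf_tens3 k)).trans
      (.tens (.refl h.1.wf) (ih h.2))

theorem tens3_inv {As : List T3} (h : ∀ A ∈ As, Generated A) :
    Cong3 MonCell (tens3 As).inv (tens3 (As.map T3.inv)) := by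
  induction As with
  | nil => exact inv_id trivial
  | cons A As ih =>
    rw [List.forall_mem_cons] at h
    exact (inv_tens h.1.wf (wf_tens3 h.2)).trans (.tens (.refl (A := A.inv) h.1.wf) (ih h.2))

theorem tens3_id_tgt {As : List T3} (h : ∀ A ∈ As, Generated A) :
    Cong3 MonCell (.id (tens3 As).tgt) (tens3 (As.map fun A => .id A.tgt)) := by
  induction As with
  | nil => exact .refl (wf_id trivial)
  | cons A As ih =>
    rw [List.forall_mem_cons] at h
    exact (Cong3.id_tens_id h.1.wf.facts.2.1 (wf_tens3 h.2).facts.2.1).symm.trans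
      (.tens (.refl (wf_id h.1.wf.facts.2.1)) (ih h.2))

/-- Products of generated 3-cells can be composed once the second factors have been permuted. -/
theorem tens3_comp₂ {As Bs : List T3} (h : ∀ A ∈ As, Generated A) (k : ∀ B ∈ Bs, Generated B)
    (d : As.map (fun A => A.src.dom) = Bs.map (fun B => B.src.dom)) :
    ∃ Cs Ds : List T3, (∀ D ∈ Ds, Generated D) ∧
      Ds.map (fun D => D.src.dom) = As.map (fun A => A.src.dom) ∧
      CellEq MonCell (tens3 Bs) (tens3 Cs) ∧ (tens3 Cs).WF MonCell ∧
      Cong2 MonCell (tens3 As).tgt (tens3 Cs).src ∧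
      Cong3 MonCell (tens3 As ◦₂ tens3 Cs) (tens3 Ds) := by
  induction As generalizing Bs with
  | nil =>
    obtain rfl : Bs = [] := by simpa using d.symm
    exact ⟨[], [], by simp, rfl, .refl (wf_id trivial), trivial, .refl trivial,
      .id_comp₂ (A := .id (.id 0)) trivial⟩
  | cons A As ih =>
    cases Bs with
    | nil => simp at d
    | cons B Bs =>
      rw [List.forall_mem_cons] at h k
      simp only [List.map_cons, List.cons.injEq] at d
      obtain ⟨Cs, Ds, g, dD, c, w, e, s⟩ := ih h.2 k.2 d.2
      obtain ⟨σ, p, q, r, t⟩ := h.1.obEq k.1 d.1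
      have hC : CellEq MonCell B (.id σ ◦₁ B) := (CellEq.perm p q k.1.wf r).symm
      have gC := k.1.congr hC
      refine ⟨(.id σ ◦₁ B) :: Cs, (A ◦₂ (.id σ ◦₁ B)) :: Ds,
        List.forall_mem_cons.2 ⟨h.1.comp₂ gC t, g⟩, congrArg (A.src.dom :: ·) dD, hC.tens c,
        ⟨gC.wf, w⟩, t.tens e, ?_⟩
      exact (Cong3.exchange₀₂ h.1.wf gC.wf (wf_tens3 h.2) w t e).symm.trans
        (.tens (.refl (wf_comp₂ h.1.wf gC.wf t)) s)

/-- The 3-cell `X` is, up to permutation, a product of 3-cells that come from braids, with numbers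
of inputs `d`. -/
def Decomposes (d : List ℕ) (X : T3) : Prop :=
  ∃ Bs : List T3, (∀ B ∈ Bs, Generated B) ∧ Bs.map (fun B => B.src.dom) = d ∧
    CellEq MonCell X (tens3 Bs)

theorem Generated.decomposes {A : T3} (h : Generated A) : Decomposes [A.src.dom] A :=
  ⟨[A], by simpa using h, rfl, .of_cong (Cong3.tens_id h.wf).symm⟩

namespace Decomposes

variable {d e : List ℕ} {X Y : T3}

theorem wf (h : Decomposes d X) : X.WF MonCell := by
  obtain ⟨Bs, g, rfl, k⟩ := h
  exact k.wf_left

theorem cod (h : Decomposes d X) : X.src.cod = d.length := by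
  obtain ⟨Bs, g, rfl, k⟩ := h
  rw [k.cod_eq, cod_tens3 g, List.length_map]

theorem congr (h : Decomposes d X) (k : CellEq MonCell Y X) : Decomposes d Y := by
  obtain ⟨Bs, g, rfl, k'⟩ := h
  exact ⟨Bs, g, rfl, k.trans k'⟩

theorem tens (h : Decomposes d X) (k : Decomposes e Y) : Decomposes (d ++ e) (X ◦₀ Y) := by
  obtain ⟨Bs, g, rfl, c⟩ := h
  obtain ⟨Cs, g', rfl, c'⟩ := k
  exact ⟨Bs ++ Cs, List.forall_mem_append.2 ⟨g, g'⟩, List.map_append,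
    (c.tens c').trans (.of_cong (tens3_append g g'))⟩

theorem split (h : Decomposes d X) {m n : ℕ} (k : d.length = m + n) :
    ∃ d₁ d₂ X₁ X₂, d = d₁ ++ d₂ ∧ d₁.length = m ∧ d₂.length = n ∧ Decomposes d₁ X₁ ∧
      Decomposes d₂ X₂ ∧ CellEq MonCell X (X₁ ◦₀ X₂) := by
  obtain ⟨Bs, g, rfl, c⟩ := h
  rw [List.length_map] at k
  have h1 : ∀ B ∈ Bs.take m, Generated B := fun B hB => g B (List.mem_of_mem_take hB)
  have h2 : ∀ B ∈ Bs.drop m, Generated B := fun B hB => g B (List.mem_of_mem_drop hB)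
  refine ⟨_, _, tens3 (Bs.take m), tens3 (Bs.drop m), ?_, ?_, ?_,
    ⟨_, h1, rfl, .refl (wf_tens3 h1)⟩, ⟨_, h2, rfl, .refl (wf_tens3 h2)⟩, c.trans (.of_cong ?_)⟩
  · rw [← List.map_append, List.take_append_drop]
  · simp
    omega
  · simp
    omega
  · have := tens3_append h1 h2
    rw [List.take_append_drop] at this
    exact this.symm

theorem exists_pair (h : Decomposes d X) (k : d.length = 2) :
    ∃ A B, Generated A ∧ Generated B ∧ d = [A.src.dom, B.src.dom] ∧
      CellEq MonCell X (A ◦₀ B) := by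
  obtain ⟨Bs, g, rfl, c⟩ := h
  rw [List.length_map] at k
  obtain ⟨A, B, rfl⟩ := List.length_eq_two.1 k
  simp only [List.forall_mem_cons] at g
  exact ⟨A, B, g.1, g.2.1, rfl,
    c.trans (.of_cong (.tens (.refl g.1.wf) (Cong3.tens_id g.2.1.wf)))⟩

theorem generated (h : Decomposes d X) (k : d.length = 1) : Generated X := by
  obtain ⟨Bs, g, rfl, c⟩ := h
  rw [List.length_map] at k
  obtain ⟨A, rfl⟩ := List.length_eq_one_iff.1 k
  simp only [List.forall_mem_cons] at g
  exact g.1.congr (c.trans (.of_cong (Cong3.tens_id g.1.wf))).symm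

theorem comp₂ (h : Decomposes d X) (k : Decomposes d Y) (e : Cong2 MonCell X.tgt Y.src) :
    Decomposes d (X ◦₂ Y) := by
  obtain ⟨As, g, rfl, c⟩ := h
  obtain ⟨Bs, g', d', c'⟩ := k
  obtain ⟨Cs, Ds, gD, dD, c'', w, e', s⟩ := tens3_comp₂ g g' d'.symm
  exact ⟨Ds, gD, dD, (CellEq.comp c (c'.trans c'') e e').trans (.of_cong s)⟩

theorem inv (h : Decomposes d X) : Decomposes d X.inv := by
  obtain ⟨As, g, rfl, c⟩ := h
  refine ⟨As.map T3.inv, ?_, ?_, c.inv.trans (.of_cong (tens3_inv g))⟩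
  · simpa using fun A hA => (g A hA).inv
  · simp only [List.map_map, List.map_inj_left]
    exact fun A hA => (g A hA).wf.facts.2.2.1.symm

theorem id_tgt (h : Decomposes d X) : Decomposes d (.id X.tgt) := by
  obtain ⟨As, g, rfl, c⟩ := h
  refine ⟨As.map fun A => .id A.tgt, ?_, ?_,
    (ObEq.id c.facts.2.2.2).trans (.of_cong (tens3_id_tgt g))⟩
  · simpa using fun A hA => (g A hA).id_tgt
  · simp only [List.map_map, List.map_inj_left]
    exact fun A hA => (g A hA).wf.facts.2.2.1.symm

end Decomposes

/-- Composing with `A` preserves products of 3-cells that come from braids. -/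
def Absorbs (A : T3) : Prop :=
  ∀ ⦃d X⦄, Decomposes d X → d.length = A.src.dom → Decomposes (Model.eval2 A.src d) (X ◦₁ A)

namespace Absorbs

variable {A B : T3}

theorem congr (h : Absorbs A) (k : Cong3 MonCell A B) : Absorbs B := by
  intro d X hX l
  have s := k.parallel.2.2.1
  have l' := l.trans s.dom_eq.symm
  rw [← Model.eval2_cong_mon s l']
  exact (h hX l').congr (.of_cong ((Cong3.refl hX.wf).comp₁ k (hX.cod.trans l')).symm)

theorem tens (wA : A.WF MonCell) (wB : B.WF MonCell) (h : Absorbs A) (k : Absorbs B) :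
    Absorbs (A ◦₀ B) := by
  intro d X hX l
  obtain ⟨d₁, d₂, X₁, X₂, rfl, l₁, l₂, h₁, h₂, c⟩ := hX.split l
  have e : Model.eval2 (A ◦₀ B).src (d₁ ++ d₂) =
      Model.eval2 A.src d₁ ++ Model.eval2 B.src d₂ := Model.par_append _ _ l₁
  rw [e]
  exact ((h h₁ l₁).tens (k h₂ l₂)).congr ((c.comp₁ (wf_tens wA wB) (hX.cod.trans l)).trans
    (.of_cong (Cong3.exchange₀₁ h₁.wf wA h₂.wf wB (h₁.cod.trans l₁) (h₂.cod.trans l₂)).symm))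

theorem comp₁ (wA : A.WF MonCell) (wB : B.WF MonCell) (e : A.src.cod = B.src.dom)
    (h : Absorbs A) (k : Absorbs B) : Absorbs (A ◦₁ B) := by
  intro d X hX l
  exact (k (h hX l) ((Model.length_eval2 wA.facts.1 l).trans e)).congr
    (.of_cong (Cong3.comp₁_assoc hX.wf wA wB (hX.cod.trans l) e).symm)

end Absorbs

/-- For identities of 2-cells: `mu` multiplies two members of a tuple, `eta` inserts a unit, and
`tau` exchanges two members. -/
theorem absorbs_id {f : T2} (w : f.WF) : Absorbs (.id f) := by
  induction f with
  | gen g =>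
    intro d X hX l
    cases g with
    | mu =>
      obtain ⟨A, B, hA, hB, rfl, c⟩ := hX.exists_pair l
      exact (hA.prod hB).decomposes.congr (c.comp₁ (C := M) trivial (hX.cod.trans l))
    | eta =>
      obtain ⟨Bs, g, rfl, c⟩ := hX
      obtain rfl : Bs = [] := by simpa using (List.length_eq_zero_iff.1 l)
      exact generated_eta.decomposes.congr ((c.comp₁ (C := E) trivial c.cod_eq).trans
        (.of_cong (.id_comp₁ (A := E) trivial)))
    | tau =>
      obtain ⟨A, B, hA, hB, rfl, c⟩ := hX.exists_pair l
      exact (hB.decomposes.tens hA.decomposes).congr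
        ((c.comp₁ (C := T) trivial (hX.cod.trans l)).trans (tens_tau hA.1 hB.1))
  | id n =>
    intro d X hX l
    have h : X.src.cod = n := hX.cod.trans l
    subst h
    exact hX.congr (.of_cong (.comp₁_id hX.wf))
  | tens f g hf hg =>
    exact ((hf w.1).tens (wf_id w.1) (wf_id w.2) (hg w.2)).congr (.id_tens_id w.1 w.2)
  | comp f g hf hg =>
    exact ((hf w.1).comp₁ (wf_id w.1) (wf_id w.2.1) w.2.2 (hg w.2.1)).congr
      (.id_comp₁_id w.1 w.2.1 w.2.2)

theorem decomposes_strands (n : ℕ) : Decomposes (List.replicate n 1) (.id (.id n)) := by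
  induction n with
  | zero => exact ⟨[], by simp, rfl, .refl (wf_id trivial)⟩
  | succ n ih =>
    refine (generated_one.decomposes.tens ih).congr (.of_cong ?_)
    exact ((Cong3.id_tens_id (f := one) (g := .id n) trivial trivial).trans
      (.id ((Cong.id_tens_id 1 n).trans (Nat.add_comm 1 n ▸ .refl trivial)))).symm

/-- Every object of `BOne` is a power of the generating object. -/
theorem algOb_eq_nsmul {f : T2} (hf : f.WF ∧ f.cod = 1) : algOb f hf = f.dom • gen := by
  have h := absorbs_id hf.1 (decomposes_strands f.dom) List.length_replicate
  have l := (Model.length_eval2 hf.1 (u := List.replicate f.dom 1) List.length_replicate).trans hf.2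
  exact ((h.generated l).congr (.of_cong (.id_comp₁ (wf_id hf.1)))).algOb_src

/-- The 3-cell `β` with inputs `A` and `B` is cut into the product of `B` and `A` and the braiding
of the targets of `A` and `B`. -/
theorem absorbs_beta : Absorbs β := by
  intro d X hX l
  obtain ⟨A, B, hA, hB, rfl, c⟩ := hX.exists_pair l
  have w := wf_tens hA.wf hB.wf
  have wβ : β.WF MonCell := trivial
  have dd : (A ◦₀ B).src.cod = β.src.dom := congrArg₂ (· + ·) hA.1.2 hB.1.2
  have h1 := absorbs_id (f := β.src) wβ.facts.1 hX l
  have d' : (A ◦₀ B).tgt.cod = β.src.dom := w.facts.2.2.2.symm.trans dd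
  have t : Cong3 MonCell (.id (A ◦₀ B).tgt ◦₁ β) ((.id A.tgt ◦₀ .id B.tgt) ◦₁ β) :=
    (Cong3.id_tens_id hA.wf.facts.2.1 hB.wf.facts.2.1).symm.comp₁ (.refl wβ) d'
  have g : Generated ((.id A.tgt ◦₀ .id B.tgt) ◦₁ β) :=
    ⟨beta_alg hA.1.tgt hB.1.tgt, isBraid_braiding hA.1.tgt hB.1.tgt
      (algOb_eq_nsmul hA.1.tgt) (algOb_eq_nsmul hB.1.tgt)⟩
  have cut := comp₁_cut w wβ dd
  have h2 := (g.congr (.of_cong t.symm)).decomposes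
  -- the value of `eval2` at a pair is the sum of the reversed list
  have e : (T3.id (A ◦₀ B).tgt ◦₁ β).src.dom = B.src.dom + (A.src.dom + 0) :=
    w.facts.2.2.1.symm.trans (Nat.add_comm _ _)
  rw [e] at h2
  exact ((h1.congr (c.symm.comp₁ wβ.facts.1 dd)).comp₂ h2 cut.parallel.2.1.2.2).congr
    ((c.comp₁ wβ (hX.cod.trans l)).trans (.of_cong cut))

/-- The induction that shows that all 3-cells are generated by `β`. The lists of numbers of inputs
are needed because the members of two tuples must be composable one by one in the case of `◦₂`. -/
theorem absorbs {A : T3} (w : A.WF MonCell) : Absorbs A := by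
  induction A with
  | gen g =>
    cases g with
    | beta => exact absorbs_beta
    | _ => exact (absorbs_id (T3.WF.facts w).1).congr (Cong3.collapse ⟨trivial, trivial⟩ w).symm
  | id f => exact absorbs_id w
  | tens A B ih ih' => exact (ih w.1).tens w.1 w.2 (ih' w.2)
  | comp₁ A B ih ih' => exact (ih w.1).comp₁ w.1 w.2.1 w.2.2 (ih' w.2.1)
  | comp₂ A B ih ih' =>
    intro d X hX l
    have l : d.length = A.src.dom := l
    have l' : d.length = A.tgt.dom := l.trans w.1.facts.2.2.1
    have c := hX.cod.trans l
    have h2 := ih' w.2.1 hX.id_tgt (l'.trans w.2.2.dom_eq)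
    rw [← Model.eval2_cong_mon w.2.2 l', ← Model.eval2_src_eq_tgt w.1 l] at h2
    have k : Cong3 MonCell (X ◦₁ (A ◦₂ B)) ((X ◦₁ A) ◦₂ (.id X.tgt ◦₁ B)) :=
      (Cong3.comp₁ (Cong3.comp₂_id hX.wf).symm (.refl (wf_comp₂ w.1 w.2.1 w.2.2)) c).trans
        (.exchange₁₂ hX.wf (wf_id hX.wf.facts.2.1) w.1 w.2.1 (.refl hX.wf.facts.2.1) w.2.2 c)
    exact ((ih w.1 hX l).comp₂ h2 k.parallel.2.1.2.2).congr (.of_cong k)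
  | inv A ih =>
    intro d X hX l
    have w : A.WF MonCell := w
    have w' : A.inv.WF MonCell := w
    have l' : d.length = A.src.dom := Eq.trans l w.facts.2.2.1.symm
    have c : X.src.cod = A.inv.src.dom := hX.cod.trans l
    have h1 := absorbs_id (f := A.tgt) w.facts.2.1 hX l
    have h2 := (ih w hX.id_tgt l').inv.congr (.of_cong (pre_inv hX.wf.facts.2.1 w
      (hX.id_tgt.cod.trans l')).symm)
    have cut := comp₁_cut hX.wf w' c
    rw [Model.eval2_src_eq_tgt w l'] at h2
    exact (h1.comp₂ h2 cut.parallel.2.1.2.2).congr (.of_cong cut)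

/-- Every morphism of `BOne` comes from a braid: put single strands on the inputs of a 3-cell that
represents it. -/
theorem isBraid (x : BOne.C2) : IsBraid x := by
  obtain ⟨A, hA, rfl⟩ := exists_mor x
  have h := absorbs hA.1 (decomposes_strands A.src.dom) List.length_replicate
  have l := (Model.length_eval2 hA.1.facts.1 (u := List.replicate A.src.dom 1)
    List.length_replicate).trans hA.2
  exact ((h.generated l).congr (.of_cong (.id_comp₁ hA.1))).2

end BOne

/-! ### The isomorphism -/

namespace BOne

open TwoMonoid T2 T3 Initial Model

/-- The braid given by a morphism of `BOne`: its component at the tuple of generating objects, in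
the model of braids. It is a list of length one, and the sum extracts its entry. -/
noncomputable def toBraid (x : BOne.C2) : Braids.C2 :=
  Quotient.lift (s := Initial.cellSetoid MonCell) (fun A => (component A.1).sum)
    (fun _ _ h => congrArg List.sum (component_eq h)) x

theorem toBraid_mor {A : T3} (hA : Alg MonCell A) : toBraid (mor A hA) = (component A).sum := rfl

theorem component_eq_singleton {A : T3} (hA : Alg MonCell A) :
    component A = [toBraid (mor A hA)] := by
  have l : (component A).length = 1 := (length_eval3 hA.1 List.length_replicate).trans hA.2
  obtain ⟨x, hx⟩ := List.length_eq_one_iff.1 l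
  rw [toBraid_mor, hx, List.sum_singleton]

theorem toBraid_add (x y : BOne.C2) : toBraid (x + y) = toBraid x + toBraid y := by
  obtain ⟨A, hA, rfl⟩ := exists_mor x
  obtain ⟨B, hB, rfl⟩ := exists_mor y
  rw [mor_add, toBraid_mor, toBraid_mor, toBraid_mor, component_prod, List.sum_singleton,
    List.sum_append]

theorem toBraid_mul {x y : BOne.C2} (h : BOne.tgt x = BOne.src y) :
    toBraid (x * y) = toBraid x * toBraid y := by
  obtain ⟨A, hA, rfl⟩ := exists_mor x
  obtain ⟨B, hB, rfl, e⟩ := exists_composable hA y h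
  have k : component (A ◦₂ B) = [toBraid (mor A hA) * toBraid (mor B hB)] := by
    rw [component_comp₂ hA.1 e, component_eq_singleton hA, component_eq_singleton hB]
    rfl
  exact (congrArg toBraid (mor_mul hA hB e)).trans ((congrArg List.sum k).trans List.sum_singleton)

theorem toBraid_id (n : ℕ) : toBraid (BOne.id (n • gen)) = Braids.strand n := by
  induction n with
  | zero =>
    exact (congrArg (fun a => toBraid (BOne.id a)) (zero_nsmul gen)).trans
      (add_zero (0 : Braids.C2))
  | succ n ih =>
    have h : toBraid (BOne.id gen) = Braids.strand 1 := add_zero (M := Braids.C2) _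
    rw [succ_nsmul, ← id_add_id, toBraid_add, ih, h, Braids.strand_add_strand]

theorem toBraid_beta : toBraid betaCell = Braids.pos := by
  have h : toBraid betaCell =
    (Braids.strand 1 + Braids.strand 1) * Braids.cross 1 1 + 0 := rfl
  rw [h, Braids.cross_one_one, Braids.strand_add_strand, Braids.strand_mul, add_zero]

theorem toBraid_betaInv : toBraid betaInvCell = Braids.neg := by
  have h : toBraid betaInvCell =
    (((Braids.strand 1)⁻¹ + (Braids.strand 1)⁻¹) *
      Braids.cross (Braids.deg (Braids.strand 1)⁻¹) (Braids.deg (Braids.strand 1)⁻¹))⁻¹ + 0 := rfl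
  rw [h, Braids.deg_inv, Braids.deg_strand, Braids.cross_one_one, Braids.inv_strand,
    Braids.strand_add_strand, Braids.strand_mul, add_zero, Braids.inv_eq Braids.pos_mul_neg]

theorem toBraid_ofBraid (x : Braids.C2) : toBraid (ofBraid x) = x := by
  induction x using Braids.induction with
  | hpos => exact toBraid_beta
  | hneg => exact toBraid_betaInv
  | hstrand n => exact toBraid_id n
  | hadd x y hx hy => rw [ofBraid_add, toBraid_add, hx, hy]
  | hmul x y e hx hy =>
    rw [ofBraid_mul e, toBraid_mul, hx, hy]
    rw [src_ofBraid, tgt_ofBraid, e]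

theorem ofBraid_toBraid (x : BOne.C2) : ofBraid (toBraid x) = x := by
  obtain ⟨y, rfl⟩ := isBraid x
  rw [toBraid_ofBraid]

theorem nsmul_dom (a : BOne.C1) : dom a • gen = a := by
  obtain ⟨f, hf, rfl⟩ := exists_algOb a
  exact (algOb_eq_nsmul hf).symm

/-- The isomorphism between `BOne` and the category of braids. -/
noncomputable def isoBraids : TwoMonoid.Iso BOne Braids where
  ob :=
    { toFun := dom
      invFun := fun n : ℕ => n • gen
      left_inv := nsmul_dom
      right_inv := dom_nsmul_gen
      map_add' := map_add dom }
  cell := ⟨toBraid, ofBraid, ofBraid_toBraid, toBraid_ofBraid⟩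
  src_cell x := by
    obtain ⟨y, rfl⟩ := isBraid x
    refine (congrArg Braids.src (toBraid_ofBraid y)).trans ?_
    exact (dom_nsmul_gen _).symm.trans (congrArg dom (src_ofBraid y).symm)
  tgt_cell x := by
    obtain ⟨y, rfl⟩ := isBraid x
    refine (congrArg Braids.tgt (toBraid_ofBraid y)).trans ((Braids.tgt_eq y).trans ?_)
    exact (dom_nsmul_gen _).symm.trans (congrArg dom (tgt_ofBraid y).symm)
  cell_id a := (congrArg (fun b => toBraid (BOne.id b)) (nsmul_dom a).symm).trans (toBraid_id _)
  cell_comp x y h := by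
    rw [comp_eq_mul, comp_eq_mul]
    exact toBraid_mul h
  cell_tens := toBraid_add

end BOne

theorem mainTheorem6 :
    ∃ Φ : TwoMonoid.Iso BOne BrdPro.op,
      (∀ (f : T2) (h : f.WF ∧ f.cod = 1), Φ.ob (algOb f h) = f.dom) ∧
      Φ.cell betaCell = positiveCrossing ∧
      Φ.cell betaInvCell = negativeCrossing :=
  ⟨BOne.isoBraids, fun _ _ => rfl, BOne.toBraid_beta, BOne.toBraid_betaInv⟩
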